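/- Let $k$ be an algebraically closed field of characteristic $0$, $G$ a finite group, $\mathcal A=\mathrm{Rep}(G)$ the category of finite-dimensional $k$-representations of $G$ with its symmetric braiding $c$ and standard pivotal structure, and $X_i$ ($i\in\mathrm{Irr}$) representatives of the simple objects, $d_i=\dim_k X_i$, $\mathcal D=\sum_i d_i^2$. Let $Z(\mathcal A)$ be the Drinfeld center, with objects $(X,\gamma)$, $\gamma_A:A\otimes X\to X\otimes A$ a half-braiding. For $(X,\gamma),(Y,\mu)\in Z(\mathcal A)$ let $Q_{\gamma,\mu}=\frac1{\mathcal D}\sum_i d_i L_i\in\mathrm{End}(X\otimes Y)$, where $L_i$ creates a pair $X_i\otimes X_i^*$ between $X$ and $Y$, moves $X_i$ to the left of $X$ and $X_i^*$ to the right of $Y$, returning in each case so that of the two crossings with $X$ (respectively $Y$) one is the symmetric braiding of $\mathcal A$ and the other is $\gamma$ (respectively $\mu$), and then annihilates the pair: the crossings are in order $c_{X,X_i}$ and $\mu_{X_i^*}$, then $\gamma_{X_i}$ and $c_{Y,X_i^*}$. $Q_{\gamma,\mu}$ is a projector, and the reduced tensor product is $(X,\gamma)\overline\otimes(Y,\mu)=(\mathrm{im}\,Q_{\gamma,\mu},\gamma\overline\otimes\mu)$,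 with half-braiding the restriction of $\gamma\otimes c^{-1}$ to $\mathrm{im}\,Q_{\gamma,\mu}$; $f\overline\otimes g$ and the associativity constraint are the restrictions of $f\otimes g$ and of the associativity constraint of $\mathcal A$. The unit $\overline{\mathbf 1}$ is the image of the trivial representation under the adjoint of the forgetful functor $Z(\mathcal A)\to\mathcal A$. The dual of $(X,\gamma)$ is carried by $X^*$ and the pivotal structure is that of $\mathcal A$. Let $D(G)=F(G)\rtimes k[G]$ be the Drinfeld double, where $F(G)$ is the algebra of functions on $G$ with pointwise product, spanned by the delta functions $\delta_g$, and $h\,\delta_g=\delta_{hgh^{-1}}\,h$. A finite-dimensional $D(G)$-module $V$ is the same as a $G$-equivariant bundle over $G$ (acted on by conjugation) with fibers $V_g=\delta_g V$ and $h:V_g\to V_{hgh^{-1}}$. The reduced, or fiberwise, tensor product is $(V\overline\otimes W)_g=V_g\otimes W_g$ with $h\in G$ acting by $h\otimes h$, and $(\varphi\overline\otimes\psi)_g=\varphi_g\otimes\psi_g$; its unit has all fibers $k$ with trivial action, the duals are $(V^\vee)_g=(V_g)^*$, and the pivotal structure is fiberwise the natural map $V_g\to (V_g)^{**}$. Let $T:Z(\mathrm{Rep}\,G)\to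 D(G)\text{-mod}$ be the functor that sends $(X,\gamma)$ to the vector space $X$ on which $G$ acts through the representation and $f\in F(G)$ acts by $f\cdot x=(\mathrm{id}_X\otimes f)(\gamma_{k[G]}(e\otimes x))$, $k[G]$ being the regular representation and $f$ being extended linearly to $k[G]$, and that is the identity on morphisms. **Theorem.** $T$ is an equivalence, the pivotal structures above are pivotal structures on $(Z(\mathrm{Rep}\,G),\overline\otimes)$ and on $(D(G)\text{-mod},\overline\otimes)$, and $T$ is a pivotal tensor equivalence $$T:(Z(\mathrm{Rep}\,G),\overline\otimes)\simeq_\otimes(D(G)\text{-mod},\overline\otimes).$$ Its tensor structure is the canonical one: for $v\in T(X)_g$, $w\in T(Y)_g$ it sends $v\otimes w\in T(X)_g\otimes T(Y)_g=(T(X)\overline\otimes T(Y))_g$ to the element of the fiber over $g$ of $T(X\overline\otimes Y)$ which is $v\otimes w\in\mathrm{im}\,Q_{\gamma,\mu}\subseteq X\otimes Y$. -/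

import Mathlib

set_option linter.unusedSectionVars false
set_option linter.unusedSimpArgs false
open CategoryTheory MonoidalCategory
universe u
noncomputable section
namespace DR
variable {k G : Type u} [Field k] [Group G]

/-! ### Representations: working with elements -/

/-- The linear map underlying a morphism of representations. -/
def lin {X Y : FDRep k G} (f : X ⟶ Y) : X →ₗ[k] Y := f.hom.hom.hom

/-- The elementary tensor `x ⊗ y` as an element of the tensor product of representations. -/
def tmL (X Y : FDRep k G) : X →ₗ[k] Y →ₗ[k] (X ⊗ Y : FDRep k G) := TensorProduct.mk k X Y

notation:70 x:70 " ⊠ " y:71 => tmL _ _ x y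

/-- A scalar as an element of the trivial representation. -/
def un (G : Type u) [Group G] (c : k) : (𝟙_ (FDRep k G) : FDRep k G) := c

theorem lin_ext {X Y : FDRep k G} {f g : X ⟶ Y} (h : lin f = lin g) : f = g := by
  apply Action.hom_ext
  apply FGModuleCat.hom_ext
  exact h

theorem tm_ext {X Y : FDRep k G} {V : Type*} [AddCommMonoid V] [Module k V]
    {f g : (X ⊗ Y : FDRep k G) →ₗ[k] V} (h : ∀ x y, f (x ⊠ y) = g (x ⊠ y)) : f = g :=
  TensorProduct.ext' (R := k) (M := X) (N := Y) h

theorem un_ext {V : Type*} [AddCommMonoid V] [Module k V]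
    {f g : (𝟙_ (FDRep k G) : FDRep k G) →ₗ[k] V} (h : f (un G 1) = g (un G 1)) : f = g :=
  LinearMap.ext_ring (R := k) h

theorem lin_ρ {X Y : FDRep k G} (f : X ⟶ Y) (g : G) (x : X) :
    lin f (X.ρ g x) = Y.ρ g (lin f x) :=
  congrArg (fun q : X.V ⟶ Y.V => q.hom.hom x) (f.comm g)

/-- An equivariant linear map as a morphism of representations. -/
def mkHom {X Y : FDRep k G} (f : X →ₗ[k] Y) (h : ∀ g x, f (X.ρ g x) = Y.ρ g (f x)) : X ⟶ Y where
  hom := InducedCategory.homMk (ModuleCat.ofHom f)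
  comm g := by
    apply FGModuleCat.hom_ext
    exact LinearMap.ext (h g)

section
variable {X Y Z W : FDRep k G}

@[simp] theorem lin_mkHom (f : X →ₗ[k] Y) (h) : lin (mkHom f h) = f := rfl
@[simp] theorem lin_id (X : FDRep k G) : lin (𝟙 X) = LinearMap.id := rfl
@[simp] theorem lin_comp (f : X ⟶ Y) (g : Y ⟶ Z) : lin (f ≫ g) = lin g ∘ₗ lin f := rfl
@[simp] theorem lin_whiskerRight (f : X ⟶ Y) (Z : FDRep k G) (x : X) (z : Z) :
    lin (f ▷ Z) (x ⊠ z) = lin f x ⊠ z := rfl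
@[simp] theorem lin_whiskerLeft (f : X ⟶ Y) (Z : FDRep k G) (x : X) (z : Z) :
    lin (Z ◁ f) (z ⊠ x) = z ⊠ lin f x := rfl
@[simp] theorem lin_tensorHom (f : X ⟶ Y) (g : Z ⟶ W) (x : X) (z : Z) :
    lin (f ⊗ₘ g) (x ⊠ z) = lin f x ⊠ lin g z := rfl
@[simp] theorem lin_assoc (x : X) (y : Y) (z : Z) :
    lin (α_ X Y Z).hom (x ⊠ y ⊠ z) = x ⊠ (y ⊠ z) := rfl
@[simp] theorem lin_assoc_inv (x : X) (y : Y) (z : Z) :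
    lin (α_ X Y Z).inv (x ⊠ (y ⊠ z)) = x ⊠ y ⊠ z := rfl
@[simp] theorem lin_leftUnitor (x : X) (c : k) : lin (λ_ X).hom (un G c ⊠ x) = c • x := rfl
@[simp] theorem lin_leftUnitor_inv (x : X) : lin (λ_ X).inv x = un G 1 ⊠ x := rfl
@[simp] theorem lin_rightUnitor (x : X) (c : k) : lin (ρ_ X).hom (x ⊠ un G c) = c • x := rfl
@[simp] theorem lin_rightUnitor_inv (x : X) : lin (ρ_ X).inv x = x ⊠ un G 1 := rfl
@[simp] theorem lin_braid (x : X) (y : Y) : lin (β_ X Y).hom (x ⊠ y) = y ⊠ x := rfl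
@[simp] theorem lin_braid_inv (x : X) (y : Y) : lin (β_ X Y).inv (y ⊠ x) = x ⊠ y := rfl
@[simp] theorem tensor_ρ (g : G) (x : X) (y : Y) : (X ⊗ Y).ρ g (x ⊠ y) = X.ρ g x ⊠ Y.ρ g y := rfl
@[simp] theorem unit_ρ (g : G) (c : k) : (𝟙_ (FDRep k G)).ρ g (un G c) = un G c := rfl

theorem mkHom_tensor (f : (X ⊗ Y : FDRep k G) →ₗ[k] Z)
    (h : ∀ g x y, f (X.ρ g x ⊠ Y.ρ g y) = Z.ρ g (f (x ⊠ y))) (g : G) (t : (X ⊗ Y : FDRep k G)) :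
    f ((X ⊗ Y).ρ g t) = Z.ρ g (f t) := by
  have : f ∘ₗ (X ⊗ Y).ρ g = Z.ρ g ∘ₗ f := tm_ext (h g)
  exact LinearMap.congr_fun this t

/-- The underlying linear map, as a linear function of the morphism. -/
def linL (X Y : FDRep k G) : (X ⟶ Y) →ₗ[k] (X →ₗ[k] Y) where
  toFun := lin
  map_add' _ _ := rfl
  map_smul' _ _ := rfl

@[simp] theorem lin_smul (c : k) (f : X ⟶ Y) : lin (c • f) = c • lin f := rfl
@[simp] theorem lin_sum {ι : Type*} (s : Finset ι) (f : ι → (X ⟶ Y)) :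
    lin (∑ i ∈ s, f i) = ∑ i ∈ s, lin (f i) := map_sum (linL X Y) f s

/-- Pairing of the second leg with a functional. -/
def pairR (X Y : FDRep k G) (f : Y →ₗ[k] k) : (X ⊗ Y : FDRep k G) →ₗ[k] X :=
  (TensorProduct.rid k X).toLinearMap ∘ₗ LinearMap.lTensor X f

@[simp] theorem pairR_tm (f : Y →ₗ[k] k) (x : X) (y : Y) : pairR X Y f (x ⊠ y) = f y • x := rfl
end



/-! ### Half-braidings as gradings -/

/-- The underlying representation of an object of the Drinfeld center. -/
def ob (X : Center (FDRep k G)) : FDRep k G := X.1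

/-- The half-braiding `γ_A : A ⊗ X ⟶ X ⊗ A` of an object `(X, γ)` of the Drinfeld center. -/
def gam (X : Center (FDRep k G)) (A : FDRep k G) : A ⊗ ob X ⟶ ob X ⊗ A := (X.2.β A).inv

/-- The inverse of the half-braiding. -/
def gamInv (X : Center (FDRep k G)) (A : FDRep k G) : ob X ⊗ A ⟶ A ⊗ ob X := (X.2.β A).hom

theorem gamInv_gam (X : Center (FDRep k G)) (A : FDRep k G) : gamInv X A ≫ gam X A = 𝟙 _ :=
  (X.2.β A).hom_inv_id

theorem gam_gamInv (X : Center (FDRep k G)) (A : FDRep k G) : gam X A ≫ gamInv X A = 𝟙 _ :=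
  (X.2.β A).inv_hom_id

theorem gam_naturality (X : Center (FDRep k G)) {A B : FDRep k G} (f : A ⟶ B) :
    gam X A ≫ ob X ◁ f = f ▷ ob X ≫ gam X B := by
  have := X.2.naturality f
  exact (Iso.inv_comp_eq _).mpr (by
    rw [← Category.assoc]; exact (Iso.eq_comp_inv _).mpr this)

theorem gam_tensor (X : Center (FDRep k G)) (A B : FDRep k G) :
    gam X (A ⊗ B) = (α_ A B (ob X)).hom ≫ A ◁ gam X B ≫ (α_ A (ob X) B).inv ≫ gam X A ▷ B ≫
      (α_ (ob X) A B).hom := by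
  have h := X.2.monoidal A B
  have h2 : X.2.β (A ⊗ B) = (α_ X.1 A B).symm ≪≫ whiskerRightIso (X.2.β A) B ≪≫ α_ A X.1 B ≪≫
      whiskerLeftIso A (X.2.β B) ≪≫ (α_ A B X.1).symm := by
    ext1; exact h
  have h3 := congrArg Iso.inv h2
  simp only [Iso.trans_inv, whiskerRightIso_inv, whiskerLeftIso_inv, Iso.symm_inv,
    Category.assoc] at h3
  exact h3

/-- The morphism of representations underlying a morphism of the Drinfeld center. -/
def und {X Y : Center (FDRep k G)} (f : X ⟶ Y) : ob X ⟶ ob Y := f.f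

theorem und_comm {X Y : Center (FDRep k G)} (f : X ⟶ Y) (U : FDRep k G) :
    U ◁ und f ≫ gam Y U = gam X U ≫ und f ▷ U := by
  have h := f.comm U
  exact (Iso.comp_inv_eq _).mpr (by
    rw [Category.assoc]; exact (Iso.eq_inv_comp _).mpr h.symm)

/-- A morphism of representations commuting with half-braidings is a morphism of the center. -/
def mkCenterHom {X Y : Center (FDRep k G)} (f : ob X ⟶ ob Y)
    (h : ∀ U, U ◁ f ≫ gam Y U = gam X U ≫ f ▷ U) : X ⟶ Y where
  f := f
  comm U := by
    have h2 := h U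
    have h3 : f ▷ U ≫ gamInv Y U = gamInv X U ≫ U ◁ f := by
      rw [← Category.comp_id (U ◁ f), ← gam_gamInv Y U, reassoc_of% h2, ← Category.assoc,
        gamInv_gam, Category.id_comp]
    exact h3

@[simp] theorem und_mkCenterHom {X Y : Center (FDRep k G)} (f : ob X ⟶ ob Y) (h) :
    und (mkCenterHom f h) = f := rfl
@[simp] theorem und_comp {X Y Z : Center (FDRep k G)} (f : X ⟶ Y) (g : Y ⟶ Z) :
    und (f ≫ g) = und f ≫ und g := rfl
@[simp] theorem und_id (X : Center (FDRep k G)) : und (𝟙 X) = 𝟙 (ob X) := rfl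
theorem und_ext {X Y : Center (FDRep k G)} {f g : X ⟶ Y} (h : und f = und g) : f = g :=
  Center.ext f g h

/-- The regular representation `k[G]`. -/
def reg (k G : Type u) [Field k] [Group G] [Finite G] : FDRep k G :=
  FDRep.of (Representation.leftRegular k G)

section
variable [Finite G]

/-- The basis vector of `k[G]` attached to `g`. -/
def regBasis (g : G) : reg k G := MonoidAlgebra.single g (1 : k)

/-- The coefficient functional on `k[G]` attached to `g`. -/
def regCoeff (g : G) : reg k G →ₗ[k] k :=
  Finsupp.lapply g ∘ₗ (MonoidAlgebra.coeffLinearEquiv k : MonoidAlgebra k G ≃ₗ[k] (G →₀ k)).toLinearMap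

theorem reg_ρ (g h : G) : (reg k G).ρ g (regBasis h) = regBasis (g * h) :=
  Representation.ofMulAction_single g h (1 : k)

theorem regCoeff_basis [DecidableEq G] (g h : G) :
    regCoeff g (regBasis h : reg k G) = if g = h then 1 else 0 := by
  change (Finsupp.single h (1:k)) g = _
  rw [Finsupp.single_apply]
  simp only [eq_comm]

theorem reg_ext {V : Type*} [AddCommGroup V] [Module k V] {f f' : reg k G →ₗ[k] V}
    (h : ∀ g, f (regBasis g) = f' (regBasis g)) : f = f' := by
  have : f ∘ₗ (MonoidAlgebra.coeffLinearEquiv k : MonoidAlgebra k G ≃ₗ[k] (G →₀ k)).symm.toLinearMap =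
     f' ∘ₗ (MonoidAlgebra.coeffLinearEquiv k : MonoidAlgebra k G ≃ₗ[k] (G →₀ k)).symm.toLinearMap := by
    apply Finsupp.lhom_ext'
    intro g
    ext
    exact h g
  ext x
  exact LinearMap.congr_fun this x.coeff

/-- The linear map `k[G] → A` with `g ↦ g • a`. -/
def orbitMap (A : FDRep k G) (a : A) : reg k G →ₗ[k] A :=
  Finsupp.linearCombination k (fun g : G => A.ρ g a) ∘ₗ
    (MonoidAlgebra.coeffLinearEquiv k : MonoidAlgebra k G ≃ₗ[k] (G →₀ k)).toLinearMap

theorem orbitMap_basis (A : FDRep k G) (a : A) (g : G) :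
    orbitMap A a (regBasis g) = A.ρ g a := by
  change Finsupp.linearCombination k _ (Finsupp.single _ _) = _
  simp

/-- The morphism `k[G] ⟶ A` with `g ↦ g • a`. -/
def orbitHom (A : FDRep k G) (a : A) : reg k G ⟶ A :=
  mkHom (orbitMap A a) (by
    intro g x
    have : orbitMap A a ∘ₗ (reg k G).ρ g = A.ρ g ∘ₗ orbitMap A a := by
      apply reg_ext
      intro h
      rw [LinearMap.comp_apply, LinearMap.comp_apply, reg_ρ, orbitMap_basis, orbitMap_basis,
        map_mul, Module.End.mul_apply]
    exact LinearMap.congr_fun this x)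

theorem orbitHom_basis (A : FDRep k G) (a : A) (g : G) :
    lin (orbitHom A a) (regBasis g) = A.ρ g a := orbitMap_basis A a g

/-- The action of a function `f` on `G` on an object `(X, γ)` of the center:
`f • x` is the pairing of `f` with the `k[G]`-leg of `γ (e ⊗ x)`. -/
def funAct (X : Center (FDRep k G)) (f : reg k G →ₗ[k] k) : ob X →ₗ[k] ob X :=
  pairR (ob X) (reg k G) f ∘ₗ lin (gam X (reg k G)) ∘ₗ tmL (reg k G) (ob X) (regBasis 1)

/-- The action of the delta function `δ_g` on an object of the center. -/
def del (X : Center (FDRep k G)) (g : G) : ob X →ₗ[k] ob X := funAct X (regCoeff g)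
end

/-- A compatible `G`-grading on a representation, given by the projections `δ g` onto the
graded pieces, with `h • V_g = V_{h g h⁻¹}`. -/
structure IsGrading [Fintype G] (V : FDRep k G) (δ : G → V →ₗ[k] V) : Prop where
  self : ∀ g v, δ g (δ g v) = δ g v
  ne : ∀ g h v, g ≠ h → δ g (δ h v) = 0
  sum : ∀ v, ∑ g, δ g v = v
  equivariant : ∀ h g v, V.ρ h (δ g v) = δ (h * g * h⁻¹) (V.ρ h v)

variable [Fintype G]

theorem regCoeff_expand {V : FDRep k G} (t : (V ⊗ reg k G : FDRep k G)) :
    t = ∑ g : G, (pairR V (reg k G) (regCoeff g) t) ⊠ regBasis g := by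
  classical
  have h : (LinearMap.id : (V ⊗ reg k G : FDRep k G) →ₗ[k] (V ⊗ reg k G : FDRep k G)) = ∑ g : G,
      (tmL V (reg k G)).flip (regBasis g) ∘ₗ pairR V (reg k G) (regCoeff g) := by
    apply tm_ext
    intro v x
    refine LinearMap.congr_fun (f := LinearMap.id ∘ₗ tmL V (reg k G) v)
      (g := (∑ g : G,
      (tmL V (reg k G)).flip (regBasis g) ∘ₗ pairR V (reg k G) (regCoeff g)) ∘ₗ tmL V (reg k G) v)
      (reg_ext fun g => ?_) x
    simp only [LinearMap.comp_apply, LinearMap.sum_apply, LinearMap.id_apply, pairR_tm,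
      regCoeff_basis, LinearMap.flip_apply]
    rw [Finset.sum_eq_single g] <;> simp +contextual
  have := LinearMap.congr_fun h t
  simpa [LinearMap.sum_apply] using this

theorem gam_basis (X : Center (FDRep k G)) (x : ob X) :
    lin (gam X (reg k G)) (regBasis 1 ⊠ x) = ∑ g, del X g x ⊠ regBasis g :=
  regCoeff_expand _

/-- The half-braiding in terms of the grading. -/
theorem gam_tmul (X : Center (FDRep k G)) (A : FDRep k G) (a : A) (x : ob X) :
    lin (gam X A) (a ⊠ x) = ∑ g, del X g x ⊠ A.ρ g a := by
  have h := congrArg (fun q => lin q (regBasis (k := k) (G := G) 1 ⊠ x))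
    (gam_naturality X (orbitHom A a))
  simp only [lin_comp, LinearMap.comp_apply, lin_whiskerRight, gam_basis, orbitHom_basis, map_one,
    Module.End.one_apply, map_sum, lin_whiskerLeft] at h
  exact h.symm

theorem coeff_eq {V : FDRep k G} {p q : G → V}
    (h : ∑ g, p g ⊠ (regBasis g : reg k G) = ∑ g, q g ⊠ (regBasis g : reg k G)) (g : G) :
    p g = q g := by
  classical
  have := congrArg (pairR V (reg k G) (regCoeff g)) h
  simp only [map_sum, pairR_tm, regCoeff_basis] at this
  simpa using this

theorem isGrading_del (X : Center (FDRep k G)) : IsGrading (ob X) (del X) := by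
  classical
  have key : ∀ (g h : G) (x : ob X), del X g (del X h x) = if g = h then del X g x else 0 := by
    intro g h x
    have e := congrArg (fun q => lin q (((regBasis 1 : reg k G) ⊠ (regBasis 1 : reg k G)) ⊠ x))
      (gam_tensor X (reg k G) (reg k G))
    simp only [lin_comp, LinearMap.comp_apply, gam_tmul, lin_assoc, lin_whiskerLeft, map_sum,
      lin_assoc_inv, lin_whiskerRight, tensor_ρ, reg_ρ, mul_one, LinearMap.sum_apply] at e
    have e2 := congrArg (fun t => pairR _ _ (regCoeff g) (pairR _ _ (regCoeff h)
      (lin (α_ _ _ _).inv t))) e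
    simp only [map_sum, pairR_tm, lin_assoc_inv, map_smul, regCoeff_basis] at e2
    simp at e2
    rw [← e2]
    simp only [eq_comm]
  have hsum : ∀ x : ob X, ∑ g, del X g x = x := by
    set P : ob X →ₗ[k] ob X := ∑ g, del X g with hP
    have hPP : ∀ x, P (P x) = P x := by
      intro x
      simp only [hP, LinearMap.sum_apply, map_sum, key]
      simp
    have hb : ∀ x, ∃ y, P y = x := by
      intro x
      have h1 : lin (gam X (𝟙_ _)) (lin (gamInv X (𝟙_ _)) (x ⊠ un G 1)) = x ⊠ un G 1 := by
        rw [← LinearMap.comp_apply, ← lin_comp, gamInv_gam]; rfl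
      have h2 : ∀ t : (𝟙_ (FDRep k G) ⊗ ob X : FDRep k G), ∃ y : ob X, t = un G 1 ⊠ y := fun t =>
        ⟨lin (λ_ _).hom t, by
          rw [← lin_leftUnitor_inv, ← LinearMap.comp_apply, ← lin_comp, Iso.hom_inv_id]; rfl⟩
      obtain ⟨y, hy⟩ := h2 (lin (gamInv X (𝟙_ _)) (x ⊠ un G 1))
      refine ⟨y, ?_⟩
      rw [hy, gam_tmul] at h1
      have h4 := congrArg (lin (ρ_ (ob X)).hom) h1
      simp only [map_sum, unit_ρ, lin_rightUnitor, one_smul] at h4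
      rw [hP, LinearMap.sum_apply, h4]
    intro x
    obtain ⟨y, rfl⟩ := hb x
    have := hPP y
    rw [← LinearMap.sum_apply]
    exact this
  refine ⟨fun g v => by simp [key], fun g h v hgh => by simp [key, hgh], hsum, ?_⟩
  intro h g v
  have e := lin_ρ (gam X (reg k G)) h ((regBasis 1 : reg k G) ⊠ v)
  rw [gam_basis, tensor_ρ, gam_tmul, map_sum] at e
  simp only [tensor_ρ, reg_ρ, mul_one] at e
  rw [← Equiv.sum_comp (Equiv.mulRight h⁻¹)] at e
  conv_rhs at e => rw [← Equiv.sum_comp (Equiv.mulLeft h⁻¹)]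
  simp only [Equiv.coe_mulRight, Equiv.coe_mulLeft, inv_mul_cancel_right, mul_inv_cancel_left] at e
  have := coeff_eq e (h * g)
  simpa using this.symm


/-! ### The Drinfeld center from gradings -/

theorem ρ_mul (V : FDRep k G) (a b : G) (v : V) : V.ρ a (V.ρ b v) = V.ρ (a * b) v := by
  rw [map_mul, Module.End.mul_apply]

theorem ρ_one (V : FDRep k G) (v : V) : V.ρ 1 v = v := by
  rw [map_one, Module.End.one_apply]

/-- A linear map out of a tensor product of representations. -/
def tmLift {X Y : FDRep k G} {V : Type u} [AddCommGroup V] [Module k V] (f : X →ₗ[k] Y →ₗ[k] V) :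
    (X ⊗ Y : FDRep k G) →ₗ[k] V := TensorProduct.lift (R := k) (M := X) (N := Y) f

@[simp] theorem tmLift_tm {X Y : FDRep k G} {V : Type u} [AddCommGroup V] [Module k V]
    (f : X →ₗ[k] Y →ₗ[k] V) (x : X) (y : Y) : tmLift f (x ⊠ y) = f x y :=
  TensorProduct.lift.tmul (R := k) (M := X) (N := Y) x y

theorem hom_ext_tm {X Y Z : FDRep k G} {f g : X ⊗ Y ⟶ Z}
    (h : ∀ x y, lin f (x ⊠ y) = lin g (x ⊠ y)) : f = g := lin_ext (tm_ext h)

theorem hom_ext_tm3 {X Y Z W : FDRep k G} {f g : (X ⊗ Y) ⊗ Z ⟶ W}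
    (h : ∀ x y z, lin f (x ⊠ y ⊠ z) = lin g (x ⊠ y ⊠ z)) : f = g := by
  apply hom_ext_tm
  intro t z
  exact LinearMap.congr_fun (f := lin f ∘ₗ (tmL _ _).flip z) (g := lin g ∘ₗ (tmL _ _).flip z)
    (tm_ext fun x y => h x y z) t

theorem hom_ext_tm3' {X Y Z W : FDRep k G} {f g : X ⊗ (Y ⊗ Z) ⟶ W}
    (h : ∀ x y z, lin f (x ⊠ (y ⊠ z)) = lin g (x ⊠ (y ⊠ z))) : f = g := by
  apply hom_ext_tm
  intro x t
  exact LinearMap.congr_fun (f := lin f ∘ₗ tmL _ _ x) (g := lin g ∘ₗ tmL _ _ x)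
    (tm_ext fun y z => h x y z) t

namespace IsGrading
variable {V : FDRep k G} {δ : G → V →ₗ[k] V}

theorem apply [DecidableEq G] (h : IsGrading V δ) (g g' : G) (v : V) :
    δ g (δ g' v) = if g = g' then δ g v else 0 := by
  split_ifs with e
  · rw [← e, h.self]
  · exact h.ne _ _ _ e

theorem equivariant' (h : IsGrading V δ) (x g : G) (v : V) :
    δ g (V.ρ x v) = V.ρ x (δ (x⁻¹ * g * x) v) := by
  rw [h.equivariant]; congr 2; group

/-- The morphism `A ⊗ V ⟶ V ⊗ A`, `a ⊗ v ↦ ∑ g, δ_g v ⊗ g a`. -/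
def gamHom (h : IsGrading V δ) (A : FDRep k G) : A ⊗ V ⟶ V ⊗ A :=
  mkHom (tmLift (∑ g, (tmL V A).flip.compl₁₂ (A.ρ g) (δ g))) (by
    refine mkHom_tensor _ fun x a v => ?_
    simp only [tmLift_tm, LinearMap.sum_apply, LinearMap.compl₁₂_apply, LinearMap.flip_apply,
      map_sum, tensor_ρ, h.equivariant]
    rw [← Equiv.sum_comp (MulAut.conj x).toEquiv]
    refine Finset.sum_congr rfl fun g _ => ?_
    simp only [MulEquiv.toEquiv_eq_coe, MulEquiv.coe_toEquiv, MulAut.conj_apply, ρ_mul,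
      inv_mul_cancel_right])

@[simp] theorem gamHom_tm (h : IsGrading V δ) (A : FDRep k G) (a : A) (v : V) :
    lin (h.gamHom A) (a ⊠ v) = ∑ g, δ g v ⊠ A.ρ g a := by
  simp only [gamHom, lin_mkHom, tmLift_tm, LinearMap.sum_apply, LinearMap.compl₁₂_apply,
    LinearMap.flip_apply]

/-- The morphism `V ⊗ A ⟶ A ⊗ V`, `v ⊗ a ↦ ∑ g, g⁻¹ a ⊗ δ_g v`. -/
def gamHomInv (h : IsGrading V δ) (A : FDRep k G) : V ⊗ A ⟶ A ⊗ V :=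
  mkHom (tmLift (∑ g, (tmL A V).flip.compl₁₂ (δ g) (A.ρ g⁻¹))) (by
    refine mkHom_tensor _ fun x v a => ?_
    simp only [tmLift_tm, LinearMap.sum_apply, LinearMap.compl₁₂_apply, LinearMap.flip_apply,
      map_sum, tensor_ρ, h.equivariant]
    rw [← Equiv.sum_comp (MulAut.conj x).toEquiv]
    refine Finset.sum_congr rfl fun g _ => ?_
    simp only [MulEquiv.toEquiv_eq_coe, MulEquiv.coe_toEquiv, MulAut.conj_apply, ρ_mul,
      mul_inv_rev, inv_inv, mul_assoc, inv_mul_cancel, mul_one])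

@[simp] theorem gamHomInv_tm (h : IsGrading V δ) (A : FDRep k G) (a : A) (v : V) :
    lin (h.gamHomInv A) (v ⊠ a) = ∑ g, A.ρ g⁻¹ a ⊠ δ g v := by
  simp only [gamHomInv, lin_mkHom, tmLift_tm, LinearMap.sum_apply, LinearMap.compl₁₂_apply,
    LinearMap.flip_apply]

/-- A grading makes `V` an object of the Drinfeld center. -/
def toCenter (h : IsGrading V δ) : Center (FDRep k G) :=
  ⟨V, { β := fun A =>
          { hom := h.gamHomInv A
            inv := h.gamHom A
            hom_inv_id := by
              classical
              apply hom_ext_tm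
              intro v a
              simp only [lin_comp, LinearMap.comp_apply, gamHomInv_tm, map_sum, gamHom_tm, h.apply,
                apply_ite (tmL V A), map_zero, apply_ite DFunLike.coe, ite_apply,
                LinearMap.zero_apply, Finset.sum_ite_eq', Finset.mem_univ, if_true, ρ_mul,
                mul_inv_cancel, ρ_one, Finset.sum_ite_eq]
              rw [← LinearMap.sum_apply, ← map_sum, h.sum, lin_id, LinearMap.id_apply]
            inv_hom_id := by
              classical
              apply hom_ext_tm
              intro a v
              simp only [lin_comp, LinearMap.comp_apply, gamHomInv_tm, map_sum, gamHom_tm, h.apply,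
                apply_ite (tmL A V _), map_zero, Finset.sum_ite_eq', Finset.sum_ite_eq,
                Finset.mem_univ, if_true, ρ_mul, inv_mul_cancel, ρ_one]
              rw [← map_sum, h.sum, lin_id, LinearMap.id_apply] }
        monoidal := by
          classical
          intro A B
          apply hom_ext_tm3'
          intro v a b
          simp only [lin_comp, LinearMap.comp_apply, gamHomInv_tm, map_sum, lin_assoc_inv, tensor_ρ,
            lin_whiskerRight, lin_whiskerLeft, LinearMap.sum_apply, lin_assoc, h.apply,
            apply_ite (tmL B V _), map_zero, apply_ite (tmL A (B ⊗ V) _), Finset.sum_ite_eq',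
            apply_ite (lin (α_ A B V).inv), Finset.sum_ite_eq, Finset.mem_univ, if_true]
        naturality := by
          intro A B f
          apply hom_ext_tm
          intro v a
          simp only [lin_comp, LinearMap.comp_apply, gamHomInv_tm, map_sum, lin_whiskerLeft,
            lin_whiskerRight, lin_ρ] }⟩

end IsGrading

theorem toCenter_ob {V : FDRep k G} {δ : G → V →ₗ[k] V} (h : IsGrading V δ) :
    ob h.toCenter = V := rfl

theorem toCenter_gam {V : FDRep k G} {δ : G → V →ₗ[k] V} (h : IsGrading V δ) (A : FDRep k G) :
    gam h.toCenter A = h.gamHom A := rfl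

theorem toCenter_del {V : FDRep k G} {δ : G → V →ₗ[k] V} (h : IsGrading V δ) (g : G) :
    del h.toCenter g = δ g := by
  classical
  have key : ∀ v : V, pairR V (reg k G) (regCoeff g) (lin (h.gamHom (reg k G)) (regBasis 1 ⊠ v)) =
      δ g v := by
    intro v
    rw [h.gamHom_tm, map_sum]
    simp only [pairR_tm, reg_ρ, mul_one, regCoeff_basis, ite_smul, one_smul, zero_smul,
      Finset.sum_ite_eq, Finset.mem_univ, if_true]
  exact LinearMap.ext key

section
variable {X Y : Center (FDRep k G)}

theorem und_del (f : X ⟶ Y) (g : G) (x : ob X) : lin (und f) (del X g x) = del Y g (lin (und f) x) := by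
  have h := congrArg (fun q => lin q (regBasis (k := k) 1 ⊠ x)) (und_comm f (reg k G))
  simp only [lin_comp, LinearMap.comp_apply, lin_whiskerLeft, gam_basis, map_sum,
    lin_whiskerRight] at h
  exact (coeff_eq h g).symm

/-- A morphism of representations commuting with the gradings is a morphism of the center. -/
def homOfDel (f : ob X ⟶ ob Y) (h : ∀ g x, lin f (del X g x) = del Y g (lin f x)) : X ⟶ Y :=
  mkCenterHom f fun U => by
    apply hom_ext_tm
    intro u x
    simp only [lin_comp, LinearMap.comp_apply, lin_whiskerLeft, gam_tmul, map_sum,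
      lin_whiskerRight, h]

@[simp] theorem und_homOfDel (f : ob X ⟶ ob Y) (h) : und (homOfDel f h) = f := rfl

theorem ob_ext {f g : X ⟶ Y} (h : ∀ x, lin (und f) x = lin (und g) x) : f = g :=
  und_ext (lin_ext (LinearMap.ext h))

theorem del_self (g : G) (x : ob X) : del X g (del X g x) = del X g x := (isGrading_del X).self g x
theorem del_ne (g h : G) (x : ob X) (e : g ≠ h) : del X g (del X h x) = 0 :=
  (isGrading_del X).ne g h x e
theorem del_apply [DecidableEq G] (g h : G) (x : ob X) :
    del X g (del X h x) = if g = h then del X g x else 0 := (isGrading_del X).apply g h x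
theorem del_sum (x : ob X) : ∑ g, del X g x = x := (isGrading_del X).sum x
theorem ρ_del (h g : G) (x : ob X) :
    (ob X).ρ h (del X g x) = del X (h * g * h⁻¹) ((ob X).ρ h x) :=
  (isGrading_del X).equivariant h g x
end

/-! ### Simple representations and the global dimension -/

/-- The set `Irr` of isomorphism classes of simple representations. -/
def Irr (k G : Type u) [Field k] [Group G] : Type (u + 1) :=
  {c : Quotient (isIsomorphicSetoid (FDRep k G)) // Simple c.out}

/-- The chosen representative `X_i` of the class `i`. -/
def Irr.rep (i : Irr k G) : FDRep k G := i.1.out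

instance (i : Irr k G) : Simple i.rep := i.2

theorem Irr.eq_of_iso {i j : Irr k G} (e : i.rep ≅ j.rep) : i = j := by
  apply Subtype.ext
  rw [← Quotient.out_eq i.1, ← Quotient.out_eq j.1]
  exact Quotient.sound ⟨e⟩

theorem Irr.exists_iso (V : FDRep k G) [Simple V] : ∃ i : Irr k G, Nonempty (V ≅ i.rep) := by
  have h : Nonempty ((Quotient.mk (isIsomorphicSetoid (FDRep k G)) V).out ≅ V) :=
    Quotient.mk_out (s := isIsomorphicSetoid (FDRep k G)) V
  obtain ⟨e⟩ := h
  exact ⟨⟨_, Simple.of_iso e⟩, ⟨e.symm⟩⟩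

section
variable [IsAlgClosed k] [CharZero k]

theorem char_sum (i j : Irr k G) :
    ∑ g : G, i.rep.character g * j.rep.character g⁻¹ = open scoped Classical in if i = j then (Nat.card G : k) else 0 := by
  classical
  have hG : (Nat.card G : k) ≠ 0 := by simp
  have := invertibleOfNonzero hG
  have h := FDRep.char_orthonormal i.rep j.rep
  rw [inv_mul_eq_iff_eq_mul₀ hG] at h
  rw [h]
  by_cases e : i = j
  · subst e
    simp [Nonempty.intro (Iso.refl i.rep)]
  · have : ¬ Nonempty (i.rep ≅ j.rep) := fun ⟨f⟩ => e (Irr.eq_of_iso f)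
    simp [e, this]

theorem char_linearIndependent :
    LinearIndependent k (fun (i : Irr k G) => (i.rep.character : G → k)) := by
  classical
  rw [linearIndependent_iff']
  intro s c hc j hj
  have h1 : ∑ g : G, (∑ i ∈ s, c i • (i.rep.character : G → k)) g * j.rep.character g⁻¹ = 0 := by
    rw [hc]; simp
  simp only [Finset.sum_apply, Pi.smul_apply, smul_eq_mul, Finset.sum_mul] at h1
  rw [Finset.sum_comm] at h1
  simp only [mul_assoc, ← Finset.mul_sum, char_sum, mul_ite, mul_zero] at h1
  rw [Finset.sum_ite_eq' s j, if_pos hj] at h1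
  simpa using h1

instance : Finite (Irr k G) := char_linearIndependent.finite

instance : Fintype (Irr k G) := Fintype.ofFinite _

/-- The categorical dimension `d_i` of the simple object `X_i`. -/
def Irr.dim (i : Irr k G) : k := Module.finrank k i.rep

/-- The global dimension `∑ i, d_i ^ 2`. -/
def globalDim (k G : Type u) [Field k] [IsAlgClosed k] [CharZero k] [Group G] [Fintype G] : k :=
  ∑ i : Irr k G, i.dim ^ 2
end

/-! ### Subrepresentations -/

/-- An invariant subspace as a representation. -/
def subRep (V : FDRep k G) (U : Submodule k V) (h : ∀ g, ∀ u ∈ U, V.ρ g u ∈ U) : FDRep k G :=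
  FDRep.of (V := U)
    { toFun := fun g => (V.ρ g).restrict (h g)
      map_one' := by ext u; exact ρ_one V u
      map_mul' := fun a b => by ext u; exact (ρ_mul V a b u).symm }

/-- The inclusion of an invariant subspace. -/
def subIncl (V : FDRep k G) (U : Submodule k V) (h : ∀ g, ∀ u ∈ U, V.ρ g u ∈ U) :
    subRep V U h ⟶ V := mkHom U.subtype (fun _ _ => rfl)

/-! ### The sum of the irreducible characters, weighted by dimension -/

section
variable [IsAlgClosed k] [CharZero k]

theorem sum_smul_ρ_eq_zero {f : G → k} (hf : ∀ x g, f (x * g * x⁻¹) = f g)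
    (h0 : ∀ i : Irr k G, ∑ g, f g * i.rep.character g = 0) (n : ℕ) :
    ∀ V : FDRep k G, Module.finrank k V = n → ∀ v : V, ∑ g, f g • V.ρ g v = 0 := by
  induction n using Nat.strong_induction_on with
  | _ n ih =>
  intro V hV v
  by_cases hS : Simple V
  · obtain ⟨i, ⟨e⟩⟩ := Irr.exists_iso V
    have hE : ∀ x w, (∑ g, f g • V.ρ g) (V.ρ x w) = V.ρ x ((∑ g, f g • V.ρ g) w) := by
      intro x w
      simp only [LinearMap.sum_apply, LinearMap.smul_apply, map_sum, map_smul, ρ_mul]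
      rw [← Equiv.sum_comp (MulAut.conj x).toEquiv]
      refine Finset.sum_congr rfl fun g _ => ?_
      simp only [MulEquiv.toEquiv_eq_coe, MulEquiv.coe_toEquiv, MulAut.conj_apply, hf,
        inv_mul_cancel_right]
    obtain ⟨c, hc⟩ := CategoryTheory.endomorphism_simple_eq_smul_id k (mkHom _ hE)
    have hc' : c • LinearMap.id = ∑ g, f g • V.ρ g := congrArg lin hc
    have ht := congrArg (LinearMap.trace k V) hc'
    rw [map_sum] at ht
    simp only [map_smul, LinearMap.trace_id, smul_eq_mul] at ht
    have h1 := h0 i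
    rw [← FDRep.char_iso e] at h1
    rw [show ∑ g, f g * (LinearMap.trace k V) (V.ρ g) = 0 from h1] at ht
    have h2 := congrArg (fun q => q v) hc'
    simp only [LinearMap.smul_apply, LinearMap.id_apply, LinearMap.sum_apply] at h2
    rw [← h2]
    rcases mul_eq_zero.mp ht with h3 | h3
    · rw [h3, zero_smul]
    · have h4 : Module.finrank k V = 0 := by exact_mod_cast h3
      have := Module.finrank_zero_iff.mp h4
      exact Subsingleton.elim _ _
  · by_cases hV0 : Subsingleton V
    · exact Subsingleton.elim _ _
    have hV1 : (𝟙 V : V ⟶ V) ≠ 0 := by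
      intro h
      apply hV0
      refine ⟨fun a b => ?_⟩
      have h1 : ∀ w : V, w = 0 := fun w => congrArg (fun q => lin q w) h
      rw [h1 a, h1 b]
    have : ∃ (W : FDRep k G) (j : W ⟶ V), Mono j ∧ j ≠ 0 ∧ ¬ IsIso j := by
      by_contra! hcon
      apply hS
      refine ⟨fun {W} j hj => ⟨?_, fun h => hcon W j hj h⟩⟩
      intro hi h
      apply hV1
      calc 𝟙 V = inv j ≫ j := (IsIso.inv_hom_id j).symm
        _ = inv j ≫ 0 := congrArg _ h
        _ = 0 := Limits.comp_zero
    obtain ⟨W, j, hj, hj0, hji⟩ := this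
    let r : V ⟶ W := Injective.factorThru (𝟙 W) j
    have hr : j ≫ r = 𝟙 W := Injective.comp_factorThru _ _
    have hr' : ∀ w, lin r (lin j w) = w := fun w => congrArg (fun q => lin q w) hr
    have hjinj : Function.Injective (lin j) := Function.LeftInverse.injective hr'
    have hW : Module.finrank k W < n := by
      rw [← hV]
      refine lt_of_le_of_ne (LinearMap.finrank_le_finrank_of_injective hjinj) fun heq => hji ?_
      have hsurj := (LinearMap.injective_iff_surjective_of_finrank_eq_finrank heq).mp hjinj
      refine ⟨r, hr, lin_ext (LinearMap.ext fun w => ?_)⟩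
      obtain ⟨w, rfl⟩ := hsurj w
      exact congrArg (lin j) (hr' w)
    have hinv : ∀ g, ∀ u ∈ LinearMap.ker (lin r), V.ρ g u ∈ LinearMap.ker (lin r) := by
      intro g u hu
      rw [LinearMap.mem_ker] at hu ⊢
      rw [lin_ρ, hu, map_zero]
    have hU : Module.finrank k (subRep V _ hinv) < n := by
      rw [← hV]
      change Module.finrank k (LinearMap.ker (lin r)) < _
      refine Submodule.finrank_lt (fun htop => hj0 ?_)
      apply lin_ext
      ext w
      have : lin j w ∈ LinearMap.ker (lin r) := by rw [htop]; trivial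
      rw [LinearMap.mem_ker, hr'] at this
      rw [this, map_zero]; rfl
    have h1 := ih _ hW W rfl (lin r v)
    have hmem : v - lin j (lin r v) ∈ LinearMap.ker (lin r) := by
      rw [LinearMap.mem_ker, map_sub, hr', sub_self]
    let w : subRep V _ hinv := ⟨_, hmem⟩
    have h3 : lin (subIncl V _ hinv) w = v - lin j (lin r v) := rfl
    have h2 := ih _ hU (subRep V _ hinv) rfl w
    have h1' := congrArg (lin j) h1
    have h2' := congrArg (lin (subIncl V _ hinv)) h2
    simp only [map_sum, map_smul, lin_ρ, map_zero] at h1' h2'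
    rw [h3] at h2'
    simp only [map_sub, smul_sub, Finset.sum_sub_distrib, h1', sub_zero] at h2'
    exact h2'

theorem sum_dim_char (g : G) : ∑ i : Irr k G, i.dim * i.rep.character g =
    open scoped Classical in if g = 1 then (Nat.card G : k) else 0 := by
  classical
  let f : G → k := fun g => ∑ i : Irr k G, i.dim * i.rep.character g⁻¹ -
    if g = 1 then (Nat.card G : k) else 0
  have hf : ∀ x g, f (x * g * x⁻¹) = f g := by
    intro x g
    have : x * g * x⁻¹ = 1 ↔ g = 1 := by
      rw [mul_inv_eq_one, mul_eq_left]
    have h2 : (x * g * x⁻¹)⁻¹ = x * g⁻¹ * x⁻¹ := by group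
    simp only [f, this, h2, FDRep.char_conj]
  have h0 : ∀ i : Irr k G, ∑ g, f g * i.rep.character g = 0 := by
    intro j
    simp only [f, sub_mul, Finset.sum_sub_distrib, Finset.sum_mul]
    rw [Finset.sum_comm]
    have h1 : ∀ i : Irr k G, ∑ g : G, i.dim * i.rep.character g⁻¹ * j.rep.character g =
        i.dim * if j = i then (Nat.card G : k) else 0 := by
      intro i
      rw [← char_sum j i, Finset.mul_sum]
      exact Finset.sum_congr rfl fun g _ => by ring
    simp only [h1, ite_mul, zero_mul, Finset.sum_ite_eq', Finset.mem_univ, if_true,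
      FDRep.char_one, mul_ite, mul_zero, Finset.sum_ite_eq]
    rw [Irr.dim]; ring
  have h := sum_smul_ρ_eq_zero hf h0 _ (reg k G) rfl (regBasis 1)
  have h1 := congrArg (regCoeff (g⁻¹)) h
  simp only [map_sum, map_smul, reg_ρ, mul_one, regCoeff_basis, map_zero, smul_eq_mul, mul_ite,
    mul_zero, Finset.sum_ite_eq, Finset.mem_univ, if_true] at h1
  simp only [f, inv_inv, inv_eq_one] at h1
  exact sub_eq_zero.mp h1

theorem globalDim_eq : globalDim k G = Nat.card G := by
  have h := sum_dim_char (k := k) (1 : G)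
  rw [if_pos rfl] at h
  rw [← h, globalDim]
  exact Finset.sum_congr rfl fun i _ => by rw [FDRep.char_one, Irr.dim, sq]

theorem globalDim_ne_zero : globalDim k G ≠ 0 := by
  rw [globalDim_eq]; simp
end

/-! ### Dual representations -/

/-- The dual representation `A*`. -/
def dualRep (A : FDRep k G) : FDRep k G := FDRep.of (Representation.dual A.ρ)

/-- A functional as an element of the dual representation. -/
def dl (A : FDRep k G) (f : A →ₗ[k] k) : dualRep A := f

/-- The application of a functional. -/
def ap (A : FDRep k G) : dualRep A →ₗ[k] A →ₗ[k] k := LinearMap.id (R := k) (M := Module.Dual k A)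

@[simp] theorem ap_dl (A : FDRep k G) (f : A →ₗ[k] k) (a : A) : ap A (dl A f) a = f a := rfl

theorem ap_ext {A : FDRep k G} {f g : dualRep A} (h : ∀ a, ap A f a = ap A g a) : f = g :=
  LinearMap.ext (f := ap A f) (g := ap A g) h

@[simp] theorem ap_ρ (A : FDRep k G) (g : G) (f : dualRep A) (a : A) :
    ap A ((dualRep A).ρ g f) a = ap A f (A.ρ g⁻¹ a) := rfl

theorem ap_injective (A : FDRep k G) {a b : A} (h : ∀ f, ap A f a = ap A f b) : a = b := by
  have : Module.Dual.eval k A a = Module.Dual.eval k A b := LinearMap.ext h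
  exact Module.eval_apply_injective k this

/-- A basis of a representation. -/
def bas (A : FDRep k G) : Module.Basis (Fin (Module.finrank k A)) k A := Module.finBasis k A

/-- The dual basis. -/
def cobas (A : FDRep k G) (i : Fin (Module.finrank k A)) : dualRep A := dl A ((bas A).coord i)

theorem bas_expand (A : FDRep k G) (a : A) : ∑ i, ap A (cobas A i) a • bas A i = a :=
  (bas A).sum_repr a

theorem cobas_expand (A : FDRep k G) (f : dualRep A) : ∑ i, ap A f (bas A i) • cobas A i = f := by
  apply ap_ext
  intro a
  conv_rhs => rw [← bas_expand A a]
  simp only [map_sum, LinearMap.sum_apply, map_smul, LinearMap.smul_apply, smul_eq_mul, mul_comm]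

theorem dual_tm_expand {V A : FDRep k G} (t : (V ⊗ dualRep A : FDRep k G)) :
    t = ∑ i, pairR V (dualRep A) ((ap A).flip (bas A i)) t ⊠ cobas A i := by
  have h : (LinearMap.id : (V ⊗ dualRep A : FDRep k G) →ₗ[k] (V ⊗ dualRep A : FDRep k G)) =
      ∑ i, (tmL V (dualRep A)).flip (cobas A i) ∘ₗ
        pairR V (dualRep A) ((ap A).flip (bas A i)) := by
    apply tm_ext
    intro v f
    simp only [LinearMap.id_apply, LinearMap.sum_apply, LinearMap.comp_apply, pairR_tm,
      LinearMap.flip_apply, map_smul, LinearMap.smul_apply]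
    conv_lhs => rw [← cobas_expand A f]
    simp only [map_sum, map_smul]
  have := LinearMap.congr_fun h t
  simpa only [LinearMap.sum_apply, LinearMap.id_apply, LinearMap.comp_apply,
    LinearMap.flip_apply] using this

theorem dual_tm_ext {V A : FDRep k G} {t t' : (V ⊗ dualRep A : FDRep k G)}
    (h : ∀ a, pairR V (dualRep A) ((ap A).flip a) t = pairR V (dualRep A) ((ap A).flip a) t') :
    t = t' := by
  rw [dual_tm_expand t, dual_tm_expand t']
  simp only [h]

/-- A linear map out of the trivial representation. -/
def unLift {V : Type u} [AddCommGroup V] [Module k V] (v : V) :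
    (𝟙_ (FDRep k G) : FDRep k G) →ₗ[k] V := LinearMap.toSpanSingleton k V v

@[simp] theorem unLift_un {V : Type u} [AddCommGroup V] [Module k V] (v : V) (c : k) :
    unLift (k := k) (G := G) v (un G c) = c • v := rfl

/-- The functional on the trivial representation with values scalars. -/
def unL (k G : Type u) [Field k] [Group G] : k →ₗ[k] (𝟙_ (FDRep k G) : FDRep k G) :=
  LinearMap.id (R := k) (M := k)

@[simp] theorem unL_apply (c : k) : unL k G c = un G c := rfl

theorem mkHom_unit {V : FDRep k G} (f : (𝟙_ (FDRep k G) : FDRep k G) →ₗ[k] V)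
    (h : ∀ g, V.ρ g (f (un G 1)) = f (un G 1)) (g : G) (c : (𝟙_ (FDRep k G) : FDRep k G)) :
    f ((𝟙_ (FDRep k G)).ρ g c) = V.ρ g (f c) := by
  have : f ∘ₗ (𝟙_ (FDRep k G)).ρ g = V.ρ g ∘ₗ f := un_ext (by
    rw [LinearMap.comp_apply, LinearMap.comp_apply, unit_ρ, h])
  exact LinearMap.congr_fun this c

theorem coev_pair (A : FDRep k G) (a : A) : pairR A (dualRep A) ((ap A).flip a)
    (∑ i, bas A i ⊠ cobas A i) = a := by
  simp only [map_sum, pairR_tm, LinearMap.flip_apply, bas_expand]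

theorem coev_invariant (A : FDRep k G) (g : G) : (A ⊗ dualRep A).ρ g (∑ i, bas A i ⊠ cobas A i) =
    ∑ i, bas A i ⊠ cobas A i := by
  apply dual_tm_ext
  intro a
  rw [coev_pair]
  simp only [map_sum, pairR_tm, LinearMap.flip_apply, tensor_ρ, ap_ρ]
  conv_rhs => rw [← ρ_one A a, ← mul_inv_cancel g, ← ρ_mul, ← bas_expand A (A.ρ g⁻¹ a)]
  simp only [map_sum, map_smul]

/-- The coevaluation `1 ⟶ A ⊗ A*`. -/
def coev (A : FDRep k G) : 𝟙_ (FDRep k G) ⟶ A ⊗ dualRep A :=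
  mkHom (unLift (∑ i, bas A i ⊠ cobas A i)) (mkHom_unit _ fun g => by
    rw [unLift_un, one_smul, coev_invariant])

@[simp] theorem lin_coev (A : FDRep k G) (c : k) :
    lin (coev A) (un G c) = c • ∑ i, bas A i ⊠ cobas A i := rfl

/-- The evaluation `A* ⊗ A ⟶ 1`. -/
def ev (A : FDRep k G) : dualRep A ⊗ A ⟶ 𝟙_ (FDRep k G) :=
  mkHom (tmLift ((ap A).compr₂ (unL k G))) (mkHom_tensor _ fun g f a => by
    simp only [tmLift_tm, LinearMap.compr₂_apply, ap_ρ, unL_apply, unit_ρ, ρ_mul, inv_mul_cancel,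
      ρ_one])

@[simp] theorem lin_ev (A : FDRep k G) (f : dualRep A) (a : A) :
    lin (ev A) (f ⊠ a) = un G (ap A f a) := by
  simp only [ev, lin_mkHom, tmLift_tm, LinearMap.compr₂_apply, unL_apply]

theorem un_eq (c : k) : un G c = c • un G (1 : k) := (mul_one c).symm

theorem coev_ev (A : FDRep k G) : dualRep A ◁ coev A ≫ (α_ _ _ _).inv ≫ ev A ▷ dualRep A =
    (ρ_ (dualRep A)).hom ≫ (λ_ (dualRep A)).inv := by
  apply lin_ext; apply tm_ext
  intro f c
  obtain ⟨c, rfl⟩ : ∃ c' : k, un G c' = c := ⟨c, rfl⟩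
  simp only [lin_comp, LinearMap.comp_apply, lin_whiskerLeft, lin_coev, map_smul, map_sum,
    lin_assoc_inv, lin_whiskerRight, lin_ev, lin_rightUnitor, lin_leftUnitor_inv]
  conv_rhs => rw [← cobas_expand A f]
  simp only [map_sum, map_smul]
  congr 1
  refine Finset.sum_congr rfl fun i _ => ?_
  rw [un_eq]
  simp only [map_smul, LinearMap.smul_apply]

theorem ev_coev (A : FDRep k G) : coev A ▷ A ≫ (α_ _ _ _).hom ≫ A ◁ ev A =
    (λ_ A).hom ≫ (ρ_ A).inv := by
  apply lin_ext; apply tm_ext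
  intro c a
  obtain ⟨c, rfl⟩ : ∃ c' : k, un G c' = c := ⟨c, rfl⟩
  simp only [lin_comp, LinearMap.comp_apply, lin_whiskerRight, lin_coev, map_smul, map_sum,
    LinearMap.smul_apply, LinearMap.sum_apply,
    lin_assoc, lin_whiskerLeft, lin_ev, lin_leftUnitor, lin_rightUnitor_inv]
  conv_rhs => rw [← bas_expand A a]
  simp only [map_sum, map_smul, LinearMap.sum_apply, LinearMap.smul_apply]
  congr 1
  refine Finset.sum_congr rfl fun i _ => ?_
  rw [un_eq]
  simp only [map_smul]

/-- The representation `A*` is the right dual of `A`. -/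
instance (A : FDRep k G) : ExactPairing A (dualRep A) where
  coevaluation' := coev A
  evaluation' := ev A
  coevaluation_evaluation' := coev_ev A
  evaluation_coevaluation' := ev_coev A

/-- The evaluation `A ⊗ A* ⟶ 1` given by the pivotal structure. -/
def ev' (A : FDRep k G) : A ⊗ dualRep A ⟶ 𝟙_ (FDRep k G) := (β_ A (dualRep A)).hom ≫ ev A

@[simp] theorem lin_ev' (A : FDRep k G) (f : dualRep A) (a : A) :
    lin (ev' A) (a ⊠ f) = un G (ap A f a) := by
  rw [ev', lin_comp, LinearMap.comp_apply, lin_braid, lin_ev]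

/-! ### The projector defining the reduced tensor product -/

/-- The endomorphism of `X ⊗ Y` given by an `A`-labelled loop that half-braids with `X` and
with `Y`. -/
def loop (A : FDRep k G) (X Y : Center (FDRep k G)) : ob X ⊗ ob Y ⟶ ob X ⊗ ob Y :=
  ob X ◁ ((λ_ (ob Y)).inv ≫ coev A ▷ ob Y ≫ (α_ A (dualRep A) (ob Y)).hom) ≫
  (α_ (ob X) A (dualRep A ⊗ ob Y)).inv ≫
  ((β_ (ob X) A).hom ⊗ₘ gam Y (dualRep A)) ≫
  (gam X A ⊗ₘ (β_ (ob Y) (dualRep A)).hom) ≫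
  (α_ (ob X) A (dualRep A ⊗ ob Y)).hom ≫
  ob X ◁ ((α_ A (dualRep A) (ob Y)).inv ≫ ev' A ▷ ob Y ≫ (λ_ (ob Y)).hom)

theorem character_eq (A : FDRep k G) (g : G) :
    A.character g = ∑ i, ap A (cobas A i) (A.ρ g (bas A i)) := by
  change LinearMap.trace k A (A.ρ g) = _
  rw [LinearMap.trace_eq_matrix_trace k (bas A), Matrix.trace]
  refine Finset.sum_congr rfl fun i _ => ?_
  rw [Matrix.diag_apply, LinearMap.toMatrix_apply]
  rfl

theorem lin_loop (A : FDRep k G) (X Y : Center (FDRep k G)) (x : ob X) (y : ob Y) :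
    lin (loop A X Y) (x ⊠ y) =
      ∑ h₁, ∑ h₂, A.character (h₂⁻¹ * h₁) • (del X h₁ x ⊠ del Y h₂ y) := by
  rw [loop]
  simp only [lin_comp, LinearMap.comp_apply, lin_whiskerLeft, lin_leftUnitor_inv, lin_whiskerRight,
    lin_coev, one_smul, map_sum, LinearMap.sum_apply, lin_assoc, lin_assoc_inv, lin_tensorHom,
    lin_braid, gam_tmul, lin_ev', lin_leftUnitor, map_smul, ap_ρ, ρ_mul]
  simp only [character_eq, Finset.sum_smul]
  rw [Finset.sum_comm]
  refine (Finset.sum_congr rfl fun h _ => Finset.sum_comm).trans ?_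
  rw [Finset.sum_comm]

section
variable [IsAlgClosed k] [CharZero k]

/-- The projector `Q = 𝒟⁻¹ ∑ i, d_i loop_{X_i}` on `X ⊗ Y`. -/
def Q (X Y : Center (FDRep k G)) : ob X ⊗ ob Y ⟶ ob X ⊗ ob Y :=
  (globalDim k G)⁻¹ • ∑ i : Irr k G, i.dim • loop i.rep X Y

theorem lin_Q (X Y : Center (FDRep k G)) (x : ob X) (y : ob Y) :
    lin (Q X Y) (x ⊠ y) = ∑ h, del X h x ⊠ del Y h y := by
  classical
  have hG : (Nat.card G : k) ≠ 0 := by simp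
  have h : ∀ a b : G, b⁻¹ * a = 1 ↔ a = b := fun a b => by
    rw [inv_mul_eq_one]; exact eq_comm
  simp only [Q, lin_smul, lin_sum, LinearMap.smul_apply, LinearMap.sum_apply, lin_loop,
    Finset.smul_sum, smul_smul]
  rw [Finset.sum_comm]
  refine Finset.sum_congr rfl fun a _ => ?_
  rw [Finset.sum_comm]
  rw [Finset.sum_eq_single a]
  · rw [← Finset.sum_smul]
    simp only [mul_assoc, ← Finset.mul_sum, sum_dim_char, h, if_true]
    rw [globalDim_eq, inv_mul_cancel₀ hG, one_smul]
  · intro b _ hb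
    rw [← Finset.sum_smul]
    simp only [mul_assoc, ← Finset.mul_sum, sum_dim_char, h, Ne.symm hb, if_false, mul_zero,
      zero_smul]
  · simp
end

/-! ### The reduced tensor product of two objects -/

section
variable [IsAlgClosed k] [CharZero k]

/-- The half-braiding `γ ⊗ c⁻¹` on `X ⊗ Y`: half-braid `A` over `X` with `γ`, then use the symmetric
braiding for `Y`. -/
def redBraid (X Y : Center (FDRep k G)) (A : FDRep k G) :
    A ⊗ (ob X ⊗ ob Y) ⟶ (ob X ⊗ ob Y) ⊗ A :=
  (α_ A (ob X) (ob Y)).inv ≫ gam X A ▷ ob Y ≫ (α_ (ob X) A (ob Y)).hom ≫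
    ob X ◁ (β_ (ob Y) A).inv ≫ (α_ (ob X) (ob Y) A).inv

/-- The operator `δ_g ⊗ id` on `X ⊗ Y`. -/
def delL (X Y : Center (FDRep k G)) (g : G) :
    (ob X ⊗ ob Y : FDRep k G) →ₗ[k] (ob X ⊗ ob Y : FDRep k G) :=
  tmLift ((tmL (ob X) (ob Y)) ∘ₗ del X g)

@[simp] theorem delL_tm (X Y : Center (FDRep k G)) (g : G) (x : ob X) (y : ob Y) :
    delL X Y g (x ⊠ y) = del X g x ⊠ y := by
  simp only [delL, tmLift_tm, LinearMap.comp_apply]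

theorem delL_Q (X Y : Center (FDRep k G)) (g : G) (t : (ob X ⊗ ob Y : FDRep k G)) :
    delL X Y g (lin (Q X Y) t) = lin (Q X Y) (delL X Y g t) := by
  classical
  refine LinearMap.congr_fun (f := delL X Y g ∘ₗ lin (Q X Y)) (g := lin (Q X Y) ∘ₗ delL X Y g)
    (tm_ext fun x y => ?_) t
  simp only [LinearMap.comp_apply, lin_Q, map_sum, delL_tm]
  refine Finset.sum_congr rfl fun h _ => ?_
  simp only [del_apply, @eq_comm _ h g]
  split_ifs with e
  · rw [e]
  · rfl

theorem Q_Q (X Y : Center (FDRep k G)) (t : (ob X ⊗ ob Y : FDRep k G)) :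
    lin (Q X Y) (lin (Q X Y) t) = lin (Q X Y) t := by
  classical
  refine LinearMap.congr_fun (f := lin (Q X Y) ∘ₗ lin (Q X Y)) (g := lin (Q X Y))
    (tm_ext fun x y => ?_) t
  simp only [LinearMap.comp_apply, lin_Q, map_sum]
  refine Finset.sum_congr rfl fun h _ => ?_
  rw [Finset.sum_eq_single h]
  · rw [del_self, del_self]
  · intro l _ hl
    rw [del_ne l h _ hl, map_zero, LinearMap.zero_apply]
  · simp

/-- The image of `Q` as a subspace of `X ⊗ Y`. -/
def rtSub (X Y : Center (FDRep k G)) : Submodule k (ob X ⊗ ob Y : FDRep k G) :=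
  LinearMap.range (lin (Q X Y))

theorem rtSub_ρ (X Y : Center (FDRep k G)) (g : G) (t : (ob X ⊗ ob Y : FDRep k G))
    (h : t ∈ rtSub X Y) : (ob X ⊗ ob Y).ρ g t ∈ rtSub X Y := by
  obtain ⟨s, rfl⟩ := h
  exact ⟨(ob X ⊗ ob Y).ρ g s, lin_ρ _ _ _⟩

theorem rtSub_delL (X Y : Center (FDRep k G)) (g : G) (t : (ob X ⊗ ob Y : FDRep k G))
    (h : t ∈ rtSub X Y) : delL X Y g t ∈ rtSub X Y := by
  obtain ⟨s, rfl⟩ := h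
  exact ⟨delL X Y g s, (delL_Q _ _ _ _).symm⟩

/-- The representation underlying the reduced tensor product: the image of `Q`. -/
def rtRep (X Y : Center (FDRep k G)) : FDRep k G := subRep (ob X ⊗ ob Y) (rtSub X Y) (rtSub_ρ X Y)

/-- The inclusion of the image of `Q`. -/
def rtIncl (X Y : Center (FDRep k G)) : rtRep X Y ⟶ ob X ⊗ ob Y := subIncl _ _ _

theorem rtIncl_injective (X Y : Center (FDRep k G)) : Function.Injective (lin (rtIncl X Y)) :=
  Subtype.val_injective

/-- The restriction of `δ_g ⊗ id` to the image of `Q`. -/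
def rtDel (X Y : Center (FDRep k G)) (g : G) : rtRep X Y →ₗ[k] rtRep X Y :=
  (delL X Y g).restrict (rtSub_delL X Y g)

theorem rtIncl_rtDel (X Y : Center (FDRep k G)) (g : G) (t : rtRep X Y) :
    lin (rtIncl X Y) (rtDel X Y g t) = delL X Y g (lin (rtIncl X Y) t) := rfl

theorem isGrading_rtDel (X Y : Center (FDRep k G)) : IsGrading (rtRep X Y) (rtDel X Y) := by
  classical
  refine ⟨fun g v => ?_, fun g h v e => ?_, fun v => ?_, fun h g v => ?_⟩ <;>
    apply rtIncl_injective <;>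
    simp only [rtIncl_rtDel, map_sum, lin_ρ, map_zero]
  · refine LinearMap.congr_fun (f := delL X Y g ∘ₗ delL X Y g) (g := delL X Y g)
      (tm_ext fun x y => ?_) _
    simp only [LinearMap.comp_apply, delL_tm, del_self]
  · refine LinearMap.congr_fun (f := delL X Y g ∘ₗ delL X Y h) (g := 0)
      (tm_ext fun x y => ?_) _
    simp only [LinearMap.comp_apply, delL_tm, del_ne _ _ _ e, map_zero, LinearMap.zero_apply]
  · refine (LinearMap.sum_apply _ _ _).symm.trans <|
      LinearMap.congr_fun (f := ∑ g, delL X Y g) (g := LinearMap.id) (tm_ext fun x y => ?_) _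
    simp only [LinearMap.sum_apply, delL_tm, LinearMap.id_apply]
    rw [← LinearMap.sum_apply, ← map_sum, del_sum]
  · refine LinearMap.congr_fun (f := (ob X ⊗ ob Y).ρ h ∘ₗ delL X Y g)
      (g := delL X Y (h * g * h⁻¹) ∘ₗ (ob X ⊗ ob Y).ρ h) (tm_ext fun x y => ?_) _
    simp only [LinearMap.comp_apply, delL_tm, tensor_ρ, ρ_del]

/-- The reduced tensor product `X ⊗̄ Y`: the image of `Q`, with the restriction of the half-braiding
`γ ⊗ c⁻¹`, that is, with the restriction of the grading of `X`. -/
def rt (X Y : Center (FDRep k G)) : Center (FDRep k G) := (isGrading_rtDel X Y).toCenter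

/-- The inclusion `X ⊗̄ Y ⟶ X ⊗ Y`. -/
def rι (X Y : Center (FDRep k G)) : ob (rt X Y) ⟶ ob X ⊗ ob Y := rtIncl X Y

/-- The projection `X ⊗ Y ⟶ X ⊗̄ Y`. -/
def rπ (X Y : Center (FDRep k G)) : ob X ⊗ ob Y ⟶ ob (rt X Y) :=
  mkHom (Y := rtRep X Y) ((lin (Q X Y)).rangeRestrict)
    (fun g x => rtIncl_injective X Y (lin_ρ (Q X Y) g x))

theorem rπ_rι (X Y : Center (FDRep k G)) : rπ X Y ≫ rι X Y = Q X Y := rfl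

theorem lin_rι_rπ (X Y : Center (FDRep k G)) (x : ob X) (y : ob Y) :
    lin (rι X Y) (lin (rπ X Y) (x ⊠ y)) = ∑ h, del X h x ⊠ del Y h y := lin_Q X Y x y

theorem rι_injective (X Y : Center (FDRep k G)) : Function.Injective (lin (rι X Y)) :=
  rtIncl_injective X Y

theorem lin_rι_rπ' (X Y : Center (FDRep k G)) (t : (ob X ⊗ ob Y : FDRep k G)) :
    lin (rι X Y) (lin (rπ X Y) t) = lin (Q X Y) t := rfl

theorem lin_rπ_rι (X Y : Center (FDRep k G)) (t : ob (rt X Y)) :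
    lin (rπ X Y) (lin (rι X Y) t) = t := by
  apply rι_injective
  obtain ⟨s, hs⟩ : ∃ s, lin (Q X Y) s = lin (rι X Y) t := t.2
  rw [lin_rι_rπ', ← hs, Q_Q]

theorem rι_rπ (X Y : Center (FDRep k G)) : rι X Y ≫ rπ X Y = 𝟙 _ :=
  lin_ext (LinearMap.ext (lin_rπ_rι X Y))

theorem lin_rι_del (X Y : Center (FDRep k G)) (g : G) (t : ob (rt X Y)) :
    lin (rι X Y) (del (rt X Y) g t) = delL X Y g (lin (rι X Y) t) :=
  congrArg (lin (rtIncl X Y)) (LinearMap.congr_fun (toCenter_del (isGrading_rtDel X Y) g) t)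

@[simp] theorem del_rπ {X Y : Center (FDRep k G)} (g : G) (x : ob X) (y : ob Y) :
    del (rt X Y) g (lin (rπ X Y) (x ⊠ y)) = lin (rπ X Y) (del X g x ⊠ y) := by
  apply rι_injective
  rw [lin_rι_del, lin_rι_rπ', lin_rι_rπ', delL_Q, delL_tm]

theorem rπ_bal {X Y : Center (FDRep k G)} (g : G) (x : ob X) (y : ob Y) :
    lin (rπ X Y) (del X g x ⊠ y) = lin (rπ X Y) (x ⊠ del Y g y) := by
  classical
  apply rι_injective
  rw [lin_rι_rπ, lin_rι_rπ]
  refine Finset.sum_congr rfl fun h _ => ?_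
  simp only [del_apply]
  split_ifs with e
  · rfl
  · rw [map_zero, map_zero, LinearMap.zero_apply]

@[simp] theorem ρ_rπ {X Y : Center (FDRep k G)} (g : G) (x : ob X) (y : ob Y) :
    (ob (rt X Y)).ρ g (lin (rπ X Y) (x ⊠ y)) =
      lin (rπ X Y) ((ob X).ρ g x ⊠ (ob Y).ρ g y) := by
  rw [← lin_ρ, tensor_ρ]

theorem rπ_ext {X Y : Center (FDRep k G)} {V : Type*} [AddCommMonoid V] [Module k V]
    {f f' : ob (rt X Y) →ₗ[k] V}
    (h : ∀ x y, f (lin (rπ X Y) (x ⊠ y)) = f' (lin (rπ X Y) (x ⊠ y))) : f = f' := by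
  have : f ∘ₗ lin (rπ X Y) = f' ∘ₗ lin (rπ X Y) := tm_ext h
  ext t
  rw [← lin_rπ_rι X Y t]
  exact LinearMap.congr_fun this _

theorem rι_bal {X Y : Center (FDRep k G)} {V : Type*} [AddCommMonoid V] [Module k V]
    (f : (ob X ⊗ ob Y : FDRep k G) →ₗ[k] V)
    (h : ∀ g x y, f (del X g x ⊠ y) = f (x ⊠ del Y g y)) (x : ob X) (y : ob Y) :
    f (lin (rι X Y) (lin (rπ X Y) (x ⊠ y))) = f (x ⊠ y) := by
  rw [lin_rι_rπ, map_sum]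
  simp only [← h, del_self]
  rw [← map_sum, ← LinearMap.sum_apply, ← map_sum, del_sum]

/-- The inclusion `X ⊗̄ Y ⟶ X ⊗ Y` intertwines the half-braiding of `X ⊗̄ Y` with `γ ⊗ c⁻¹`. -/
theorem rι_gam (X Y : Center (FDRep k G)) (A : FDRep k G) :
    A ◁ rι X Y ≫ redBraid X Y A = gam (rt X Y) A ≫ rι X Y ▷ A := by
  apply hom_ext_tm
  intro a t
  simp only [lin_comp, LinearMap.comp_apply, lin_whiskerLeft, gam_tmul, map_sum,
    lin_whiskerRight, lin_rι_del]
  refine LinearMap.congr_fun (f := lin (redBraid X Y A) ∘ₗ tmL _ _ a)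
    (g := ∑ g, (tmL _ _).flip (A.ρ g a) ∘ₗ delL X Y g) (tm_ext fun x y => ?_) _ |>.trans ?_
  · simp only [redBraid, lin_comp, LinearMap.comp_apply, lin_assoc_inv, lin_whiskerRight, gam_tmul,
      map_sum, LinearMap.sum_apply, lin_assoc, lin_whiskerLeft, lin_braid_inv, delL_tm,
      LinearMap.flip_apply]
  · simp only [LinearMap.sum_apply, LinearMap.comp_apply, LinearMap.flip_apply]
end

/-! ### The monoidal category `(Z(Rep G), ⊗̄)` -/

section
variable [IsAlgClosed k] [CharZero k]

/-- The image of an elementary tensor in the reduced tensor product. -/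
def rpL (X Y : Center (FDRep k G)) : ob X →ₗ[k] ob Y →ₗ[k] ob (rt X Y) :=
  (tmL (ob X) (ob Y)).compr₂ (lin (rπ X Y))

notation:70 x:70 " ⊡ " y:71 => rpL _ _ x y

variable {X Y Z W X' Y' Z' : Center (FDRep k G)}

@[simp] theorem lin_rπ (x : ob X) (y : ob Y) : lin (rπ X Y) (x ⊠ y) = x ⊡ y := rfl
theorem rp_del (g : G) (x : ob X) (y : ob Y) : del (rt X Y) g (x ⊡ y) = del X g x ⊡ y :=
  del_rπ g x y
theorem rp_bal (g : G) (x : ob X) (y : ob Y) : del X g x ⊡ y = x ⊡ del Y g y := rπ_bal g x y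
theorem rp_ρ (g : G) (x : ob X) (y : ob Y) :
    (ob (rt X Y)).ρ g (x ⊡ y) = (ob X).ρ g x ⊡ (ob Y).ρ g y := ρ_rπ g x y
theorem rp_ext {V : Type*} [AddCommMonoid V] [Module k V] {f f' : ob (rt X Y) →ₗ[k] V}
    (h : ∀ x y, f (x ⊡ y) = f' (x ⊡ y)) : f = f' := rπ_ext h
theorem lin_rι (x : ob X) (y : ob Y) : lin (rι X Y) (x ⊡ y) = ∑ h, del X h x ⊠ del Y h y :=
  lin_rι_rπ X Y x y

/-- A map out of the tensor product, restricted to the reduced tensor product. -/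
theorem lin_rι_comp {V : FDRep k G} (f : ob X ⊗ ob Y ⟶ V)
    (h : ∀ g x y, lin f (del X g x ⊠ y) = lin f (x ⊠ del Y g y)) (x : ob X) (y : ob Y) :
    lin (rι X Y ≫ f) (x ⊡ y) = lin f (x ⊠ y) := rι_bal (lin f) h x y

theorem sum_rp_del (x : ob X) (y : ob Y) : ∑ h, del X h x ⊡ del Y h y = x ⊡ y := by
  simp only [← rp_bal, del_self]
  rw [← LinearMap.sum_apply, ← map_sum, del_sum]

/-- A morphism of representations out of a reduced tensor product, as a morphism of the center. -/
def homRt (f : ob (rt X Y) ⟶ ob Z)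
    (h : ∀ g x y, lin f (del X g x ⊡ y) = del Z g (lin f (x ⊡ y))) : rt X Y ⟶ Z :=
  homOfDel f fun g t => LinearMap.congr_fun (f := lin f ∘ₗ del (rt X Y) g) (g := del Z g ∘ₗ lin f)
    (rp_ext fun x y => by rw [LinearMap.comp_apply, LinearMap.comp_apply, rp_del, h]) t

@[simp] theorem und_homRt (f : ob (rt X Y) ⟶ ob Z) (h) : und (homRt f h) = f := rfl

theorem rt_hom_ext {f g : rt X Y ⟶ Z} (h : ∀ x y, lin (und f) (x ⊡ y) = lin (und g) (x ⊡ y)) :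
    f = g := und_ext (lin_ext (rp_ext h))

theorem rt_hom_ext₃ {f g : rt (rt X Y) Z ⟶ W}
    (h : ∀ x y z, lin (und f) (x ⊡ y ⊡ z) = lin (und g) (x ⊡ y ⊡ z)) : f = g := by
  apply rt_hom_ext
  intro t z
  exact LinearMap.congr_fun (f := lin (und f) ∘ₗ (rpL _ _).flip z)
    (g := lin (und g) ∘ₗ (rpL _ _).flip z) (rp_ext fun x y => h x y z) t

theorem rt_hom_ext₃' {f g : rt X (rt Y Z) ⟶ W}
    (h : ∀ x y z, lin (und f) (x ⊡ (y ⊡ z)) = lin (und g) (x ⊡ (y ⊡ z))) : f = g := by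
  apply rt_hom_ext
  intro x t
  exact LinearMap.congr_fun (f := lin (und f) ∘ₗ rpL _ _ x)
    (g := lin (und g) ∘ₗ rpL _ _ x) (rp_ext fun y z => h x y z) t

theorem rt_hom_ext₄ {V : Center (FDRep k G)} {f g : rt (rt (rt X Y) Z) W ⟶ V}
    (h : ∀ x y z w, lin (und f) (x ⊡ y ⊡ z ⊡ w) = lin (und g) (x ⊡ y ⊡ z ⊡ w)) : f = g := by
  apply rt_hom_ext₃
  intro t z w
  exact LinearMap.congr_fun (f := lin (und f) ∘ₗ (rpL _ _).flip w ∘ₗ (rpL _ _).flip z)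
    (g := lin (und g) ∘ₗ (rpL _ _).flip w ∘ₗ (rpL _ _).flip z)
    (rp_ext fun x y => h x y z w) t

/-- The reduced tensor product of morphisms: the restriction of `f ⊗ g`. -/
def rtHom (f : X ⟶ X') (g : Y ⟶ Y') : rt X Y ⟶ rt X' Y' :=
  homRt (rι X Y ≫ (und f ⊗ₘ und g) ≫ rπ X' Y') (by
    intro a x y
    have h : ∀ g' x y, lin ((und f ⊗ₘ und g) ≫ rπ X' Y') (del X g' x ⊠ y) =
        lin ((und f ⊗ₘ und g) ≫ rπ X' Y') (x ⊠ del Y g' y) := by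
      intro b x y
      simp only [lin_comp, LinearMap.comp_apply, lin_tensorHom, lin_rπ, und_del, rp_bal]
    rw [lin_rι_comp _ h, lin_rι_comp _ h]
    simp only [lin_comp, LinearMap.comp_apply, lin_tensorHom, lin_rπ, und_del, rp_del])

@[simp] theorem lin_rtHom (f : X ⟶ X') (g : Y ⟶ Y') (x : ob X) (y : ob Y) :
    lin (und (rtHom f g)) (x ⊡ y) = lin (und f) x ⊡ lin (und g) y := by
  rw [rtHom, und_homRt, lin_rι_comp]
  · rfl
  · intro b x y
    simp only [lin_comp, LinearMap.comp_apply, lin_tensorHom, lin_rπ, und_del, rp_bal]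

/-- The restriction of the associator of `Rep G`. -/
def rtAssocHom (X Y Z : Center (FDRep k G)) : ob (rt (rt X Y) Z) ⟶ ob (rt X (rt Y Z)) :=
  rι (rt X Y) Z ≫ rι X Y ▷ ob Z ≫ (α_ (ob X) (ob Y) (ob Z)).hom ≫ ob X ◁ rπ Y Z ≫ rπ X (rt Y Z)

/-- The restriction of the inverse of the associator of `Rep G`. -/
def rtAssocInv (X Y Z : Center (FDRep k G)) : ob (rt X (rt Y Z)) ⟶ ob (rt (rt X Y) Z) :=
  rι X (rt Y Z) ≫ ob X ◁ rι Y Z ≫ (α_ (ob X) (ob Y) (ob Z)).inv ≫ rπ X Y ▷ ob Z ≫ rπ (rt X Y) Z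

theorem lin_rtAssocHom (x : ob X) (y : ob Y) (z : ob Z) :
    lin (rtAssocHom X Y Z) (x ⊡ y ⊡ z) = x ⊡ (y ⊡ z) := by
  rw [rtAssocHom]
  simp only [lin_comp, LinearMap.comp_apply, lin_rι, rp_del, map_sum, lin_whiskerRight,
    LinearMap.sum_apply, lin_assoc, lin_whiskerLeft, lin_rπ]
  refine (Finset.sum_congr rfl fun h _ => ?_).trans (sum_rp_del x (y ⊡ z))
  calc _ = ∑ l, del X l (del X h x) ⊡ del (rt Y Z) l (y ⊡ del Z h z) :=
        Finset.sum_congr rfl fun l _ => by rw [rp_del]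
    _ = del X h x ⊡ (y ⊡ del Z h z) := sum_rp_del _ _
    _ = _ := by rw [rp_del, rp_bal h y z]

theorem lin_rtAssocInv (x : ob X) (y : ob Y) (z : ob Z) :
    lin (rtAssocInv X Y Z) (x ⊡ (y ⊡ z)) = x ⊡ y ⊡ z := by
  rw [rtAssocInv]
  simp only [lin_comp, LinearMap.comp_apply, lin_rι, rp_del, map_sum, lin_whiskerLeft,
    lin_assoc_inv, lin_whiskerRight, lin_rπ]
  calc _ = ∑ h, (del X h x ⊡ del Y h y) ⊡ z := Finset.sum_congr rfl fun h _ => by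
        rw [← sum_rp_del (del X h x ⊡ del Y h y) z]
        exact Finset.sum_congr rfl fun l _ => by rw [rp_del, rp_bal l (del X h x)]
    _ = x ⊡ y ⊡ z := by rw [← LinearMap.sum_apply, ← map_sum, sum_rp_del]

end

/-- The functions on `G` with the conjugation action. -/
def unitRep (k G : Type u) [Field k] [Group G] [Fintype G] : FDRep k G :=
  FDRep.of (V := G → k)
    { toFun := fun h => LinearMap.funLeft k k (fun x => h⁻¹ * x * h)
      map_one' := by ext f x; simp [LinearMap.funLeft_apply]
      map_mul' := fun a b => by
        apply LinearMap.ext; intro f; funext x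
        simp [LinearMap.funLeft_apply, mul_assoc] }

section
open scoped Classical in
/-- The delta function at `g`. -/
def ub (g : G) : unitRep k G := (fun x => if x = g then 1 else 0 : G → k)

/-- The value at `g`. -/
def uc (g : G) : unitRep k G →ₗ[k] k := LinearMap.proj (R := k) (φ := fun _ : G => k) g

theorem uc_ub [DecidableEq G] (g h : G) : uc g (ub h : unitRep k G) = if g = h then 1 else 0 := by
  refine (show uc g (ub h) = @ite k (g = h) (Classical.propDecidable _) 1 0 from rfl).trans ?_
  congr

theorem uc_ext {e e' : unitRep k G} (h : ∀ g, uc g e = uc g e') : e = e' := funext h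

theorem uc_ρ (g h : G) (e : unitRep k G) : uc g ((unitRep k G).ρ h e) = uc (h⁻¹ * g * h) e := rfl

theorem ub_expand (e : unitRep k G) : ∑ g, uc g e • ub g = e := by
  classical
  apply uc_ext
  intro h
  simp [uc_ub]

theorem ub_ext {V : Type*} [AddCommMonoid V] [Module k V] {f f' : unitRep k G →ₗ[k] V}
    (h : ∀ g, f (ub g) = f' (ub g)) : f = f' := by
  ext e
  rw [← ub_expand e, map_sum, map_sum]
  exact Finset.sum_congr rfl fun g _ => by rw [map_smul, map_smul, h]

theorem ub_ρ (h g : G) : (unitRep k G).ρ h (ub g) = ub (h * g * h⁻¹) := by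
  classical
  apply uc_ext
  intro l
  rw [uc_ρ, uc_ub, uc_ub]
  have : h⁻¹ * l * h = g ↔ l = h * g * h⁻¹ := by
    constructor
    · rintro rfl; group
    · rintro rfl; group
  simp only [this]
end

theorem isGrading_unit : IsGrading (unitRep k G)
    (fun g => (uc g).smulRight (ub g) : G → unitRep k G →ₗ[k] unitRep k G) := by
  classical
  refine ⟨fun g v => ?_, fun g h v e => ?_, fun v => ?_, fun h g v => ?_⟩
  · simp [uc_ub]
  · simp [uc_ub, e]
  · simp only [LinearMap.smulRight_apply, ub_expand]
  · simp only [LinearMap.smulRight_apply, map_smul, ub_ρ, uc_ρ]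
    congr 2; group

/-- The unit object for the reduced tensor product: functions on `G`, graded by their support,
with the conjugation action. -/
def rU (k G : Type u) [Field k] [Group G] [Fintype G] : Center (FDRep k G) :=
  (isGrading_unit (k := k) (G := G)).toCenter

/-- The delta functions in the unit object. -/
def eU (g : G) : ob (rU k G) := (ub g : unitRep k G)

/-- The values of an element of the unit object. -/
def cU (g : G) : ob (rU k G) →ₗ[k] k := (uc g : unitRep k G →ₗ[k] k)

theorem cU_eU [DecidableEq G] (g h : G) : cU g (eU h : ob (rU k G)) = if g = h then 1 else 0 :=
  uc_ub g h
theorem eU_ext {V : Type*} [AddCommMonoid V] [Module k V] {f f' : ob (rU k G) →ₗ[k] V}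
    (h : ∀ g, f (eU g) = f' (eU g)) : f = f' := ub_ext h
theorem eU_expand (e : ob (rU k G)) : ∑ g, cU g e • eU g = e := ub_expand e
theorem eU_ρ (h g : G) : (ob (rU k G)).ρ h (eU g) = eU (h * g * h⁻¹) := ub_ρ h g
theorem cU_ρ (h g : G) (e : ob (rU k G)) : cU g ((ob (rU k G)).ρ h e) = cU (h⁻¹ * g * h) e :=
  uc_ρ g h e
theorem eU_del (g : G) (e : ob (rU k G)) : del (rU k G) g e = cU g e • eU g :=
  LinearMap.congr_fun (toCenter_del isGrading_unit g) e

/-- The constant function `1` in the unit object. -/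
def oneU (k G : Type u) [Field k] [Group G] [Fintype G] : ob (rU k G) := ∑ g, eU g

theorem oneU_ρ (h : G) : (ob (rU k G)).ρ h (oneU k G) = oneU k G := by
  simp only [oneU, map_sum, eU_ρ]
  exact Equiv.sum_comp (MulAut.conj h).toEquiv (fun g => (eU g : ob (rU k G)))

theorem del_oneU (g : G) : del (rU k G) g (oneU k G) = eU g := by
  classical
  simp only [oneU, eU_del, map_sum, cU_eU, Finset.sum_ite_eq, Finset.mem_univ, if_true, one_smul,
    ite_smul, zero_smul]

/-- The invariant vector `1` of the unit object. -/
def unitHom (k G : Type u) [Field k] [Group G] [Fintype G] :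
    𝟙_ (FDRep k G) ⟶ ob (rU k G) :=
  mkHom (unLift (oneU k G)) (mkHom_unit _ fun g => by rw [unLift_un, one_smul, oneU_ρ])

@[simp] theorem lin_unitHom (c : k) : lin (unitHom k G) (un G c) = c • oneU k G := rfl

/-- The unit object corepresents the invariants of the underlying representation: it is the image
of the trivial representation under the left adjoint of the forgetful functor. -/
theorem unit_corepresents (X : Center (FDRep k G)) :
    Function.Bijective (fun f : rU k G ⟶ X => unitHom k G ≫ und f) := by
  constructor
  · intro f f' h
    apply und_ext; apply lin_ext; apply eU_ext
    intro g
    have h1 : lin (und f) (oneU k G) = lin (und f') (oneU k G) := by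
      have := congrArg (fun q => lin q (un G 1)) h
      simpa only [lin_comp, LinearMap.comp_apply, lin_unitHom, one_smul] using this
    rw [← del_oneU, und_del, und_del, h1]
  · intro f
    let x := lin f (un G 1)
    have hx : ∀ g, (ob X).ρ g x = x := fun g => (lin_ρ f g (un G 1)).symm
    let F : ob (rU k G) →ₗ[k] ob X := ∑ g, (cU g).smulRight (del X g x)
    have hF : ∀ g, F (eU g) = del X g x := by
      classical
      intro g
      simp only [F, LinearMap.sum_apply, LinearMap.smulRight_apply, cU_eU, ite_smul, one_smul,
        zero_smul, Finset.sum_ite_eq', Finset.mem_univ, if_true]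
    have hρ : ∀ g e, F ((ob (rU k G)).ρ g e) = (ob X).ρ g (F e) := fun g e =>
      LinearMap.congr_fun (f := F ∘ₗ (ob (rU k G)).ρ g) (g := (ob X).ρ g ∘ₗ F) (eU_ext fun h => by
        rw [LinearMap.comp_apply, LinearMap.comp_apply, eU_ρ, hF, hF, ρ_del, hx]) e
    have hd : ∀ g e, F (del _ g e) = del X g (F e) := fun g e =>
      LinearMap.congr_fun (f := F ∘ₗ del _ g) (g := del X g ∘ₗ F) (eU_ext fun h => by
        classical
        rw [LinearMap.comp_apply, LinearMap.comp_apply, eU_del, hF, cU_eU, del_apply, map_smul, hF,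
          ite_smul, one_smul, zero_smul]) e
    let f' : ob (rU k G) ⟶ ob X := mkHom F hρ
    have hd' : ∀ g e, lin f' (del _ g e) = del X g (lin f' e) := hd
    refine ⟨homOfDel f' hd', ?_⟩
    have hs : lin f' (oneU k G) = x := by
      change F (oneU k G) = x
      simp only [oneU, map_sum, hF, del_sum]
    apply lin_ext; apply un_ext
    simp only [lin_comp, LinearMap.comp_apply, lin_unitHom, one_smul, und_homOfDel, hs]
    rfl

section
variable [IsAlgClosed k] [CharZero k]
variable {X Y Z W X' Y' Z' : Center (FDRep k G)}

theorem rtAssocHom_del (g : G) (t : ob (rt X Y)) (z : ob Z) :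
    lin (rtAssocHom X Y Z) (del (rt X Y) g t ⊡ z) = del _ g (lin (rtAssocHom X Y Z) (t ⊡ z)) :=
  LinearMap.congr_fun
    (f := lin (rtAssocHom X Y Z) ∘ₗ (rpL _ _).flip z ∘ₗ del _ g)
    (g := del _ g ∘ₗ lin (rtAssocHom X Y Z) ∘ₗ (rpL _ _).flip z) (rp_ext fun x y => by
      simp only [LinearMap.comp_apply, LinearMap.flip_apply, rp_del, lin_rtAssocHom]) t

theorem rtAssocInv_del (g : G) (x : ob X) (t : ob (rt Y Z)) :
    lin (rtAssocInv X Y Z) (del X g x ⊡ t) = del _ g (lin (rtAssocInv X Y Z) (x ⊡ t)) :=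
  LinearMap.congr_fun
    (f := lin (rtAssocInv X Y Z) ∘ₗ rpL _ _ (del _ g x))
    (g := del _ g ∘ₗ lin (rtAssocInv X Y Z) ∘ₗ rpL _ _ x) (rp_ext fun y z => by
      simp only [LinearMap.comp_apply, rp_del, lin_rtAssocInv]) t

/-- The associativity constraint of the reduced tensor product. -/
def rtAssoc (X Y Z : Center (FDRep k G)) : rt (rt X Y) Z ≅ rt X (rt Y Z) where
  hom := homRt (rtAssocHom X Y Z) rtAssocHom_del
  inv := homRt (rtAssocInv X Y Z) rtAssocInv_del
  hom_inv_id := rt_hom_ext₃ fun x y z => by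
    simp only [und_comp, und_homRt, lin_comp, LinearMap.comp_apply, lin_rtAssocHom, lin_rtAssocInv,
      und_id, lin_id, LinearMap.id_apply]
  inv_hom_id := rt_hom_ext₃' fun x y z => by
    simp only [und_comp, und_homRt, lin_comp, LinearMap.comp_apply, lin_rtAssocHom, lin_rtAssocInv,
      und_id, lin_id, LinearMap.id_apply]

@[simp] theorem lin_rtAssoc_hom (x : ob X) (y : ob Y) (z : ob Z) :
    lin (und (rtAssoc X Y Z).hom) (x ⊡ y ⊡ z) = x ⊡ (y ⊡ z) := lin_rtAssocHom x y z

@[simp] theorem lin_rtAssoc_inv (x : ob X) (y : ob Y) (z : ob Z) :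
    lin (und (rtAssoc X Y Z).inv) (x ⊡ (y ⊡ z)) = x ⊡ y ⊡ z := lin_rtAssocInv x y z

/-- The map `e ⊗ x ↦ ∑ g, e(g) δ_g x`. -/
def unitActL (X : Center (FDRep k G)) : (ob (rU k G) ⊗ ob X : FDRep k G) →ₗ[k] ob X :=
  tmLift (∑ g, (LinearMap.lsmul k (ob X)).compl₁₂ (cU g) (del X g))

@[simp] theorem unitActL_tm (e : ob (rU k G)) (x : ob X) :
    unitActL X (e ⊠ x) = ∑ g, cU g e • del X g x := by
  simp only [unitActL, tmLift_tm, LinearMap.sum_apply, LinearMap.compl₁₂_apply,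
    LinearMap.lsmul_apply]

/-- The map `e ⊗ x ↦ ∑ g, e(g) δ_g x` as a morphism of representations. -/
def unitAct (X : Center (FDRep k G)) : ob (rU k G) ⊗ ob X ⟶ ob X :=
  mkHom (unitActL X) (mkHom_tensor _ fun h e x => by
    simp only [unitActL_tm, map_sum, map_smul, ρ_del, cU_ρ]
    rw [← Equiv.sum_comp (MulAut.conj h).toEquiv]
    refine Finset.sum_congr rfl fun g _ => ?_
    simp only [MulEquiv.toEquiv_eq_coe, MulEquiv.coe_toEquiv, MulAut.conj_apply]
    congr 2; group)

@[simp] theorem lin_unitAct (e : ob (rU k G)) (x : ob X) :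
    lin (unitAct X) (e ⊠ x) = ∑ g, cU g e • del X g x := unitActL_tm e x

theorem unitAct_bal (g : G) (e : ob (rU k G)) (x : ob X) :
    lin (unitAct X) (del _ g e ⊠ x) = lin (unitAct X) (e ⊠ del X g x) := by
  classical
  simp only [lin_unitAct, eU_del, map_smul, cU_eU, del_apply, LinearMap.smul_apply, smul_ite,
    smul_zero, Finset.sum_ite_eq, Finset.sum_ite_eq', Finset.mem_univ, if_true, ite_smul, one_smul,
    zero_smul]

theorem unitAct_del (g : G) (e : ob (rU k G)) (x : ob X) :
    lin (unitAct X) (del _ g e ⊠ x) = del X g (lin (unitAct X) (e ⊠ x)) := by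
  classical
  rw [unitAct_bal]
  simp only [lin_unitAct, map_sum, map_smul, del_apply]
  refine Finset.sum_congr rfl fun h _ => ?_
  simp only [@eq_comm _ h g]
  split_ifs with e
  · rw [e]
  · rfl

theorem unitAct_one (x : ob X) : lin (unitAct X) (oneU k G ⊠ x) = x := by
  classical
  simp only [oneU, map_sum, LinearMap.sum_apply, lin_unitAct, cU_eU, ite_smul, one_smul, zero_smul,
    Finset.sum_ite_eq', Finset.mem_univ, if_true, del_sum]

/-- The morphism `e ⊗ x ↦ ∑ g, e(g) δ_g x` on the reduced tensor product. -/
def lUHom (X : Center (FDRep k G)) : ob (rt (rU k G) X) ⟶ ob X := rι (rU k G) X ≫ unitAct X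

theorem lin_lUHom (e : ob (rU k G)) (x : ob X) :
    lin (lUHom X) (e ⊡ x) = lin (unitAct X) (e ⊠ x) := lin_rι_comp _ unitAct_bal _ _

theorem lUHom_del (g : G) (e : ob (rU k G)) (x : ob X) :
    lin (lUHom X) (del _ g e ⊡ x) = del X g (lin (lUHom X) (e ⊡ x)) := by
  rw [lin_lUHom, lin_lUHom, unitAct_del]

/-- The morphism `x ↦ 1 ⊗ x`. -/
def lUInv (X : Center (FDRep k G)) : ob X ⟶ ob (rt (rU k G) X) :=
  (λ_ (ob X)).inv ≫ unitHom k G ▷ ob X ≫ rπ (rU k G) X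

theorem lin_lUInv (x : ob X) : lin (lUInv X) x = oneU k G ⊡ x := by
  simp only [lUInv, lin_comp, LinearMap.comp_apply, lin_leftUnitor_inv, lin_whiskerRight,
    lin_unitHom, one_smul, lin_rπ]

theorem lUInv_del (g : G) (x : ob X) : lin (lUInv X) (del X g x) = del _ g (lin (lUInv X) x) := by
  rw [lin_lUInv, lin_lUInv, rp_del, rp_bal]

theorem sum_eU_rp (e : ob (rU k G)) (x : ob X) : ∑ g, cU g e • (eU g ⊡ x) = e ⊡ x := by
  conv_rhs => rw [← eU_expand e]
  simp only [map_sum, map_smul, LinearMap.sum_apply, LinearMap.smul_apply]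

theorem sum_rp_eU (e : ob (rU k G)) (x : ob X) : ∑ g, cU g e • (x ⊡ eU g) = x ⊡ e := by
  conv_rhs => rw [← eU_expand e]
  simp only [map_sum, map_smul]

/-- The left unit constraint. -/
def rtLeftUnitor (X : Center (FDRep k G)) : rt (rU k G) X ≅ X where
  hom := homRt (lUHom X) lUHom_del
  inv := homOfDel (lUInv X) lUInv_del
  hom_inv_id := rt_hom_ext fun e x => by
    simp only [und_comp, und_homRt, und_homOfDel, und_id, lin_id, LinearMap.id_apply, lin_comp,
      LinearMap.comp_apply, lin_lUHom, lin_unitAct, map_sum, map_smul, lin_lUInv]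
    simp only [← rp_bal, del_oneU, sum_eU_rp]
  inv_hom_id := ob_ext fun x => by
    simp only [und_comp, und_homRt, und_homOfDel, und_id, lin_id, LinearMap.id_apply, lin_comp,
      LinearMap.comp_apply, lin_lUInv, lin_lUHom, unitAct_one]

@[simp] theorem lin_rtLeftUnitor_hom (e : ob (rU k G)) (x : ob X) :
    lin (und (rtLeftUnitor X).hom) (e ⊡ x) = ∑ g, cU g e • del X g x :=
  (lin_lUHom e x).trans (lin_unitAct e x)

theorem unitAct_bal' (g : G) (x : ob X) (e : ob (rU k G)) :
    lin ((β_ (ob X) (ob (rU k G))).hom ≫ unitAct X) (del X g x ⊠ e) =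
      lin ((β_ (ob X) (ob (rU k G))).hom ≫ unitAct X) (x ⊠ del _ g e) := by
  simp only [lin_comp, LinearMap.comp_apply, lin_braid, unitAct_bal]

/-- The morphism `x ⊗ e ↦ ∑ g, e(g) δ_g x` on the reduced tensor product. -/
def rUHom (X : Center (FDRep k G)) : ob (rt X (rU k G)) ⟶ ob X :=
  rι X (rU k G) ≫ (β_ (ob X) (ob (rU k G))).hom ≫ unitAct X

theorem lin_rUHom (x : ob X) (e : ob (rU k G)) :
    lin (rUHom X) (x ⊡ e) = lin (unitAct X) (e ⊠ x) := by
  refine (lin_rι_comp _ unitAct_bal' _ _).trans ?_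
  simp only [lin_comp, LinearMap.comp_apply, lin_braid]

theorem rUHom_del (g : G) (x : ob X) (e : ob (rU k G)) :
    lin (rUHom X) (del _ g x ⊡ e) = del X g (lin (rUHom X) (x ⊡ e)) := by
  rw [lin_rUHom, lin_rUHom, ← unitAct_del, unitAct_bal]

/-- The morphism `x ↦ x ⊗ 1`. -/
def rUInv (X : Center (FDRep k G)) : ob X ⟶ ob (rt X (rU k G)) :=
  (ρ_ (ob X)).inv ≫ ob X ◁ unitHom k G ≫ rπ X (rU k G)

theorem lin_rUInv (x : ob X) : lin (rUInv X) x = x ⊡ oneU k G := by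
  simp only [rUInv, lin_comp, LinearMap.comp_apply, lin_rightUnitor_inv, lin_whiskerLeft,
    lin_unitHom, one_smul, lin_rπ]

theorem rUInv_del (g : G) (x : ob X) : lin (rUInv X) (del X g x) = del _ g (lin (rUInv X) x) := by
  rw [lin_rUInv, lin_rUInv, rp_del]

/-- The right unit constraint. -/
def rtRightUnitor (X : Center (FDRep k G)) : rt X (rU k G) ≅ X where
  hom := homRt (rUHom X) rUHom_del
  inv := homOfDel (rUInv X) rUInv_del
  hom_inv_id := rt_hom_ext fun x e => by
    simp only [und_comp, und_homRt, und_homOfDel, und_id, lin_id, LinearMap.id_apply, lin_comp,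
      LinearMap.comp_apply, lin_rUHom, lin_unitAct, map_sum, map_smul, lin_rUInv]
    simp only [rp_bal, del_oneU, sum_rp_eU]
  inv_hom_id := ob_ext fun x => by
    simp only [und_comp, und_homRt, und_homOfDel, und_id, lin_id, LinearMap.id_apply, lin_comp,
      LinearMap.comp_apply, lin_rUInv, lin_rUHom, unitAct_one]

@[simp] theorem lin_rtRightUnitor_hom (e : ob (rU k G)) (x : ob X) :
    lin (und (rtRightUnitor X).hom) (x ⊡ e) = ∑ g, cU g e • del X g x :=
  (lin_rUHom x e).trans (lin_unitAct e x)

theorem rtHom_id : rtHom (𝟙 X) (𝟙 Y) = 𝟙 (rt X Y) := rt_hom_ext fun x y => by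
  simp only [lin_rtHom, und_id, lin_id, LinearMap.id_apply]

theorem rtHom_comp {X'' Y'' : Center (FDRep k G)} (f : X ⟶ X') (g : Y ⟶ Y') (f' : X' ⟶ X'')
    (g' : Y' ⟶ Y'') : rtHom f g ≫ rtHom f' g' = rtHom (f ≫ f') (g ≫ g') :=
  rt_hom_ext fun x y => by
    simp only [lin_rtHom, und_comp, lin_comp, LinearMap.comp_apply]

theorem rtAssoc_naturality (f : X ⟶ X') (g : Y ⟶ Y') (h : Z ⟶ Z') :
    rtHom (rtHom f g) h ≫ (rtAssoc X' Y' Z').hom = (rtAssoc X Y Z).hom ≫ rtHom f (rtHom g h) :=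
  rt_hom_ext₃ fun x y z => by
    simp only [lin_rtHom, und_comp, lin_comp, LinearMap.comp_apply, lin_rtAssoc_hom]

theorem rtLeftUnitor_naturality (f : X ⟶ Y) :
    rtHom (𝟙 (rU k G)) f ≫ (rtLeftUnitor Y).hom = (rtLeftUnitor X).hom ≫ f :=
  rt_hom_ext fun e x => by
    simp only [lin_rtHom, und_comp, lin_comp, LinearMap.comp_apply, lin_rtLeftUnitor_hom, und_id,
      lin_id, LinearMap.id_apply, map_sum, map_smul, und_del]

theorem rtRightUnitor_naturality (f : X ⟶ Y) :
    rtHom f (𝟙 (rU k G)) ≫ (rtRightUnitor Y).hom = (rtRightUnitor X).hom ≫ f :=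
  rt_hom_ext fun x e => by
    simp only [lin_rtHom, und_comp, lin_comp, LinearMap.comp_apply, lin_rtRightUnitor_hom, und_id,
      lin_id, LinearMap.id_apply, map_sum, map_smul, und_del]

theorem rt_pentagon (W X Y Z : Center (FDRep k G)) :
    rtHom (rtAssoc W X Y).hom (𝟙 Z) ≫ (rtAssoc W (rt X Y) Z).hom ≫
      rtHom (𝟙 W) (rtAssoc X Y Z).hom =
    (rtAssoc (rt W X) Y Z).hom ≫ (rtAssoc W X (rt Y Z)).hom := rt_hom_ext₄ fun w x y z => by
  simp only [lin_rtHom, und_comp, lin_comp, LinearMap.comp_apply, lin_rtAssoc_hom, und_id, lin_id,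
    LinearMap.id_apply]

theorem rt_triangle (X Y : Center (FDRep k G)) :
    (rtAssoc X (rU k G) Y).hom ≫ rtHom (𝟙 X) (rtLeftUnitor Y).hom =
      rtHom (rtRightUnitor X).hom (𝟙 Y) := rt_hom_ext₃ fun x e y => by
  simp only [lin_rtHom, und_comp, lin_comp, LinearMap.comp_apply, lin_rtAssoc_hom, und_id, lin_id,
    LinearMap.id_apply, lin_rtLeftUnitor_hom, lin_rtRightUnitor_hom, map_sum, map_smul,
    LinearMap.sum_apply, LinearMap.smul_apply, rp_bal]

end

/-- The Drinfeld center of `Rep G` as a category, to carry the reduced tensor product. -/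
def RedCenter (k G : Type u) [Field k] [Group G] : Type (u + 1) := Center (FDRep k G)

instance : Category (RedCenter k G) := inferInstanceAs (Category (Center (FDRep k G)))

section
variable [IsAlgClosed k] [CharZero k]

instance : MonoidalCategoryStruct (RedCenter k G) where
  tensorObj X Y := rt X Y
  tensorHom f g := rtHom f g
  whiskerLeft X _ _ f := rtHom (𝟙 (X : Center (FDRep k G))) f
  whiskerRight f X := rtHom f (𝟙 (X : Center (FDRep k G)))
  tensorUnit := rU k G
  associator X Y Z := rtAssoc (k := k) (G := G) X Y Z
  leftUnitor X := rtLeftUnitor (k := k) (G := G) X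
  rightUnitor X := rtRightUnitor (k := k) (G := G) X

/-- The category `(Z(Rep G), ⊗̄)`. -/
instance : MonoidalCategory (RedCenter k G) := MonoidalCategory.ofTensorHom
  (id_tensorHom_id := fun X Y => rtHom_id (k := k) (G := G) (X := X) (Y := Y))
  (tensorHom_comp_tensorHom := fun f₁ f₂ g₁ g₂ => rtHom_comp (k := k) (G := G) f₁ f₂ g₁ g₂)
  (associator_naturality := fun f₁ f₂ f₃ => rtAssoc_naturality (k := k) (G := G) f₁ f₂ f₃)
  (leftUnitor_naturality := fun f => rtLeftUnitor_naturality (k := k) (G := G) f)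
  (rightUnitor_naturality := fun f => rtRightUnitor_naturality (k := k) (G := G) f)
  (pentagon := fun W X Y Z => rt_pentagon (k := k) (G := G) W X Y Z)
  (triangle := fun X Y => rt_triangle (k := k) (G := G) X Y)
  (id_tensorHom := fun _ _ _ _ => rfl)
  (tensorHom_id := fun _ _ => rfl)

end

/-! ### Duals and the pivotal structure -/

theorem isGrading_dual (X : Center (FDRep k G)) : IsGrading (dualRep (ob X))
    (fun g => (del X g).dualMap : G → Module.Dual k (ob X) →ₗ[k] Module.Dual k (ob X)) := by
  refine ⟨fun g f => ?_, fun g h f e => ?_, fun f => ?_, fun h g f => ?_⟩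
  · apply ap_ext
    intro x
    exact congrArg (ap _ f) (del_self g x)
  · apply ap_ext
    intro x
    refine (congrArg (ap _ f) (del_ne h g x e.symm)).trans ?_
    rw [map_zero, map_zero, LinearMap.zero_apply]
  · apply ap_ext
    intro x
    rw [map_sum, LinearMap.sum_apply]
    refine (map_sum (ap _ f) (fun g => del X g x) _).symm.trans ?_
    rw [del_sum]
  · apply ap_ext
    intro x
    rw [ap_ρ]
    refine congrArg (ap _ f) ((?_ : del X g ((ob X).ρ h⁻¹ x) =
      (ob X).ρ h⁻¹ (del X (h * g * h⁻¹) x)))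
    rw [ρ_del]
    congr 2; group

/-- The dual object `X*`, whose underlying representation is the dual representation and whose
graded pieces are the duals of the graded pieces of `X`. -/
def rD (X : Center (FDRep k G)) : Center (FDRep k G) := (isGrading_dual X).toCenter

/-- The application of a functional. -/
def apD (X : Center (FDRep k G)) : ob (rD X) →ₗ[k] ob X →ₗ[k] k :=
  (ap (ob X) : dualRep (ob X) →ₗ[k] ob X →ₗ[k] k)

theorem apD_ext {X : Center (FDRep k G)} {f f' : ob (rD X)} (h : ∀ x, apD X f x = apD X f' x) :
    f = f' := ap_ext (A := ob X) h

theorem apD_del (X : Center (FDRep k G)) (g : G) (f : ob (rD X)) (x : ob X) :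
    apD X (del (rD X) g f) x = apD X f (del X g x) :=
  congrArg (fun q : dualRep (ob X) => ap (ob X) q x)
    (LinearMap.congr_fun (toCenter_del (isGrading_dual X) g) f)

theorem apD_ρ (X : Center (FDRep k G)) (g : G) (f : ob (rD X)) (x : ob X) :
    apD X ((ob (rD X)).ρ g f) x = apD X f ((ob X).ρ g⁻¹ x) := rfl

/-- The dual basis. -/
def cobD (X : Center (FDRep k G)) (i : Fin (Module.finrank k (ob X))) : ob (rD X) := cobas (ob X) i

theorem basD_expand (X : Center (FDRep k G)) (x : ob X) :
    ∑ i, apD X (cobD X i) x • bas (ob X) i = x := bas_expand _ _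

theorem cobD_expand (X : Center (FDRep k G)) (f : ob (rD X)) :
    ∑ i, apD X f (bas (ob X) i) • cobD X i = f := cobas_expand _ _

section
variable [IsAlgClosed k] [CharZero k]

/-- The map `ξ ⊗ x ↦ (g ↦ ξ(δ_g x))`. -/
def evL (X : Center (FDRep k G)) : (ob (rD X) ⊗ ob X : FDRep k G) →ₗ[k] ob (rU k G) :=
  tmLift (∑ g, ((apD X).compl₂ (del X g)).compr₂ ((LinearMap.id (R := k) (M := k)).smulRight (eU g)))

theorem evL_tm (X : Center (FDRep k G)) (f : ob (rD X)) (x : ob X) :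
    evL X (f ⊠ x) = ∑ g, apD X f (del X g x) • eU g := by
  simp only [evL, tmLift_tm, LinearMap.sum_apply, LinearMap.compr₂_apply, LinearMap.compl₂_apply,
    LinearMap.smulRight_apply, LinearMap.id_apply]

/-- The map `ξ ⊗ x ↦ (g ↦ ξ(δ_g x))` as a morphism of representations. -/
def evH (X : Center (FDRep k G)) : ob (rD X) ⊗ ob X ⟶ ob (rU k G) :=
  mkHom (evL X) (mkHom_tensor _ fun h f x => by
    simp only [evL_tm, apD_ρ, map_sum, map_smul, eU_ρ]
    rw [← Equiv.sum_comp (MulAut.conj h).toEquiv]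
    refine Finset.sum_congr rfl fun g _ => ?_
    simp only [MulEquiv.toEquiv_eq_coe, MulEquiv.coe_toEquiv, MulAut.conj_apply]
    congr 2
    rw [← ρ_del, ρ_mul, inv_mul_cancel, ρ_one])

theorem lin_evH (X : Center (FDRep k G)) (f : ob (rD X)) (x : ob X) :
    lin (evH X) (f ⊠ x) = ∑ g, apD X f (del X g x) • eU g := evL_tm X f x

theorem evH_bal (X : Center (FDRep k G)) (g : G) (f : ob (rD X)) (x : ob X) :
    lin (evH X) (del _ g f ⊠ x) = lin (evH X) (f ⊠ del X g x) := by
  classical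
  simp only [lin_evH, apD_del, del_apply, @eq_comm _ g]
  refine Finset.sum_congr rfl fun h _ => ?_
  split_ifs with e
  · rw [e]
  · rfl

/-- The evaluation as a morphism of representations. -/
def rtEvH (X : Center (FDRep k G)) : ob (rt (rD X) X) ⟶ ob (rU k G) := rι (rD X) X ≫ evH X

theorem lin_rtEvH (X : Center (FDRep k G)) (f : ob (rD X)) (x : ob X) :
    lin (rtEvH X) (f ⊡ x) = ∑ g, apD X f (del X g x) • eU g :=
  (lin_rι_comp _ (evH_bal X) _ _).trans (lin_evH X f x)

theorem rtEvH_del (X : Center (FDRep k G)) (g : G) (f : ob (rD X)) (x : ob X) :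
    lin (rtEvH X) (del _ g f ⊡ x) = del _ g (lin (rtEvH X) (f ⊡ x)) := by
  classical
  simp only [lin_rtEvH, apD_del, map_sum, map_smul, eU_del, cU_eU, ite_smul, one_smul, zero_smul,
    smul_ite, smul_zero, del_apply]
  refine Finset.sum_congr rfl fun h _ => ?_
  split_ifs with e
  · rw [e]
  · rw [map_zero, zero_smul]

/-- The evaluation `X* ⊗̄ X ⟶ 1`, `ξ ⊗ x ↦ (g ↦ ξ(δ_g x))`. -/
def rtEv (X : Center (FDRep k G)) : rt (rD X) X ⟶ rU k G := homRt (rtEvH X) (rtEvH_del X)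

@[simp] theorem lin_rtEv (X : Center (FDRep k G)) (f : ob (rD X)) (x : ob X) :
    lin (und (rtEv X)) (f ⊡ x) = ∑ g, apD X f (del X g x) • eU g := lin_rtEvH X f x

/-- The coevaluation of `Rep G`, projected to the reduced tensor product. -/
def coevH (X : Center (FDRep k G)) : 𝟙_ (FDRep k G) ⟶ ob (rt X (rD X)) := coev (ob X) ≫ rπ X (rD X)

theorem lin_coevH (X : Center (FDRep k G)) :
    lin (coevH X) (un G 1) = ∑ i, bas (ob X) i ⊡ cobD X i := by
  have h : lin (coev (ob X)) (un G 1) = ∑ i, bas (ob X) i ⊠ cobas (ob X) i := by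
    rw [lin_coev, one_smul]
  refine (congrArg (lin (rπ X (rD X))) h).trans ?_
  exact map_sum (lin (rπ X (rD X))) (fun i => bas (ob X) i ⊠ cobas (ob X) i) Finset.univ

/-- The coevaluation as a morphism of representations. -/
def rtCoevH (X : Center (FDRep k G)) : ob (rU k G) ⟶ ob (rt X (rD X)) :=
  (ρ_ (ob (rU k G))).inv ≫ ob (rU k G) ◁ coevH X ≫ unitAct (rt X (rD X))

theorem lin_rtCoevH (X : Center (FDRep k G)) (g : G) :
    lin (rtCoevH X) (eU g) = ∑ i, del X g (bas (ob X) i) ⊡ cobD X i := by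
  classical
  simp only [rtCoevH, lin_comp, LinearMap.comp_apply, lin_rightUnitor_inv, lin_whiskerLeft,
    lin_coevH, lin_unitAct, cU_eU, ite_smul, one_smul, zero_smul, Finset.sum_ite_eq',
    Finset.mem_univ, if_true, map_sum, rp_del]

theorem rtCoevH_del (X : Center (FDRep k G)) (g : G) (e : ob (rU k G)) :
    lin (rtCoevH X) (del _ g e) = del _ g (lin (rtCoevH X) e) := by
  simp only [rtCoevH, lin_comp, LinearMap.comp_apply, lin_rightUnitor_inv, lin_whiskerLeft,
    unitAct_del]

/-- The coevaluation `1 ⟶ X ⊗̄ X*`, which on the unit `∑ g, δ_g` is the coevaluation of `Rep G`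
projected to the reduced tensor product. -/
def rtCoev (X : Center (FDRep k G)) : rU k G ⟶ rt X (rD X) := homOfDel (rtCoevH X) (rtCoevH_del X)

@[simp] theorem lin_rtCoev (X : Center (FDRep k G)) (g : G) :
    lin (und (rtCoev X)) (eU g) = ∑ i, del X g (bas (ob X) i) ⊡ cobD X i := lin_rtCoevH X g

theorem lin_lUInv' (X : Center (FDRep k G)) (x : ob X) :
    lin (und (rtLeftUnitor X).inv) x = oneU k G ⊡ x := lin_lUInv x

theorem lin_rUInv' (X : Center (FDRep k G)) (x : ob X) :
    lin (und (rtRightUnitor X).inv) x = x ⊡ oneU k G := lin_rUInv x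

theorem rt_eU_ext {X Y : Center (FDRep k G)} {f f' : rt (rU k G) X ⟶ Y}
    (h : ∀ g x, lin (und f) (eU g ⊡ x) = lin (und f') (eU g ⊡ x)) : f = f' :=
  rt_hom_ext fun e x => LinearMap.congr_fun (f := lin (und f) ∘ₗ (rpL _ _).flip x)
    (g := lin (und f') ∘ₗ (rpL _ _).flip x) (eU_ext fun g => h g x) e

theorem rt_eU_ext' {X Y : Center (FDRep k G)} {f f' : rt X (rU k G) ⟶ Y}
    (h : ∀ x g, lin (und f) (x ⊡ eU g) = lin (und f') (x ⊡ eU g)) : f = f' :=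
  rt_hom_ext fun x e => LinearMap.congr_fun (f := lin (und f) ∘ₗ rpL _ _ x)
    (g := lin (und f') ∘ₗ rpL _ _ x) (eU_ext fun g => h x g) e

theorem sum_cU_eU {V : Type*} [AddCommMonoid V] [Module k V] (p : G → V) (h : G) :
    ∑ g, cU (k := k) g (eU h) • p g = p h := by
  classical
  simp only [cU_eU, ite_smul, one_smul, zero_smul, Finset.sum_ite_eq', Finset.mem_univ, if_true]

theorem sum_apD_eU (X : Center (FDRep k G)) (f : ob (rD X)) (g : G) (x : ob X) :
    ∑ h, apD X f (del X h (del X g x)) • (eU h : ob (rU k G)) = apD X f (del X g x) • eU g := by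
  classical
  rw [Finset.sum_eq_single g]
  · rw [del_self]
  · intro h _ e
    rw [del_ne _ _ _ e, map_zero, zero_smul]
  · simp

theorem del_eU_self (g : G) : del (rU k G) g (eU g) = eU g := by rw [← del_oneU, del_self]

theorem rtCoev_rtEv (X : Center (FDRep k G)) :
    rtHom (𝟙 (rD X)) (rtCoev X) ≫ (rtAssoc (rD X) X (rD X)).inv ≫ rtHom (rtEv X) (𝟙 (rD X)) =
      (rtRightUnitor (rD X)).hom ≫ (rtLeftUnitor (rD X)).inv := rt_eU_ext' fun f g => by
  simp only [und_comp, lin_comp, LinearMap.comp_apply, lin_rtHom, und_id, lin_id,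
    LinearMap.id_apply, lin_rtCoev, map_sum, lin_rtAssoc_inv, lin_rtEv, sum_apD_eU,
    lin_rtRightUnitor_hom, sum_cU_eU, lin_lUInv', map_smul, LinearMap.smul_apply]
  rw [← rp_bal, del_oneU]
  simp only [← map_smul, ← map_sum, ← apD_del, cobD_expand]
  rw [← rp_bal, del_eU_self]

theorem rtEv_rtCoev (X : Center (FDRep k G)) :
    rtHom (rtCoev X) (𝟙 X) ≫ (rtAssoc X (rD X) X).hom ≫ rtHom (𝟙 X) (rtEv X) =
      (rtLeftUnitor X).hom ≫ (rtRightUnitor X).inv := rt_eU_ext fun g x => by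
  simp only [und_comp, lin_comp, LinearMap.comp_apply, lin_rtHom, und_id, lin_id,
    LinearMap.id_apply, lin_rtCoev, map_sum, LinearMap.sum_apply, lin_rtAssoc_hom, lin_rtEv,
    lin_rtLeftUnitor_hom, sum_cU_eU, lin_rUInv', map_smul, LinearMap.smul_apply]
  rw [Finset.sum_comm]
  have h1 : ∀ h, ∑ i, apD X (cobD X i) (del X h x) • (del X g (bas (ob X) i) ⊡
      (eU h : ob (rU k G))) = del X g (del X h x) ⊡ eU h := by
    intro h
    conv_rhs => rw [← basD_expand X (del X h x)]
    simp only [map_sum, map_smul, LinearMap.sum_apply, LinearMap.smul_apply]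
  simp only [h1]
  rw [Finset.sum_eq_single g]
  · rw [del_self, rp_bal, rp_bal, del_oneU, del_eU_self]
  · intro h _ e
    rw [del_ne _ _ _ e.symm, map_zero, LinearMap.zero_apply]
  · simp

/-- The object `X*` is the right dual of `X` with respect to the reduced tensor product. -/
instance (X : RedCenter k G) : HasRightDual X where
  rightDual := rD X
  exact := 
    { coevaluation' := rtCoev (k := k) (G := G) X
      evaluation' := rtEv (k := k) (G := G) X
      coevaluation_evaluation' := rtCoev_rtEv (k := k) (G := G) X
      evaluation_coevaluation' := rtEv_rtCoev (k := k) (G := G) X }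

instance : RightRigidCategory (RedCenter k G) where

/-- The canonical map of `X` to its double dual. -/
def pivL (X : Center (FDRep k G)) : ob X →ₗ[k] ob (rD (rD X)) :=
  (Module.Dual.eval k (ob X) : ob X →ₗ[k] Module.Dual k (Module.Dual k (ob X)))

theorem apD_pivL (X : Center (FDRep k G)) (x : ob X) (f : ob (rD X)) :
    apD (rD X) (pivL X x) f = apD X f x := rfl

/-- The canonical map of `X` to its double dual, as a morphism of the center. -/
def pivH (X : Center (FDRep k G)) : X ⟶ rD (rD X) :=
  homOfDel (mkHom (pivL X) fun g x => apD_ext fun f => by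
    rw [apD_pivL, apD_ρ, apD_pivL, apD_ρ, inv_inv]) fun g x => apD_ext fun f => by
    rw [lin_mkHom, apD_pivL, apD_del, apD_pivL, apD_del]

@[simp] theorem lin_pivH (X : Center (FDRep k G)) (x : ob X) (f : ob (rD X)) :
    apD (rD X) (lin (und (pivH X)) x) f = apD X f x := rfl

end

/-! ### The Drinfeld double -/

/-- The algebra of functions on `G`, with `G` acting by conjugation. -/
def FunG (k G : Type u) : Type u := G → k

instance : CommRing (FunG k G) := inferInstanceAs (CommRing (G → k))
instance : Algebra k (FunG k G) := inferInstanceAs (Algebra k (G → k))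
instance : Module.Finite k (FunG k G) := inferInstanceAs (Module.Finite k (G → k))

/-- The value of a function. -/
def fval (b : FunG k G) (g : G) : k := b g

theorem fval_ext {b c : FunG k G} (h : ∀ g, fval b g = fval c g) : b = c := funext h
@[simp] theorem fval_add (b c : FunG k G) (g : G) : fval (b + c) g = fval b g + fval c g := rfl
@[simp] theorem fval_mul (b c : FunG k G) (g : G) : fval (b * c) g = fval b g * fval c g := rfl
@[simp] theorem fval_smul (r : k) (b : FunG k G) (g : G) : fval (r • b) g = r * fval b g := rfl
@[simp] theorem fval_one (g : G) : fval (1 : FunG k G) g = 1 := rfl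
@[simp] theorem fval_zero (g : G) : fval (0 : FunG k G) g = 0 := rfl

instance : MulSemiringAction G (FunG k G) where
  smul h b := fun g => fval b (h⁻¹ * g * h)
  one_smul b := fval_ext fun g => (by group : fval b (1⁻¹ * g * 1) = fval b g)
  mul_smul a c b := fval_ext fun g =>
    (by group : fval b ((a * c)⁻¹ * g * (a * c)) = fval b (c⁻¹ * (a⁻¹ * g * a) * c))
  smul_zero _ := rfl
  smul_add _ _ _ := rfl
  smul_one _ := rfl
  smul_mul _ _ _ := rfl

theorem fval_conj (h : G) (b : FunG k G) (g : G) : fval (h • b) g = fval b (h⁻¹ * g * h) := rfl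

instance : SMulCommClass G k (FunG k G) := ⟨fun _ _ _ => rfl⟩

open scoped Classical in
/-- The delta function `δ_g`. -/
def fdel (k : Type u) [Field k] (g : G) : FunG k G := fun x => if x = g then 1 else 0

open scoped Classical in
theorem fval_fdel (g x : G) : fval (fdel k g) x = if x = g then 1 else 0 := rfl

theorem conj_fdel (h g : G) : h • fdel k g = fdel k (h * g * h⁻¹) := fval_ext fun x => by
  classical
  rw [fval_conj, fval_fdel, fval_fdel]
  have : h⁻¹ * x * h = g ↔ x = h * g * h⁻¹ := by
    constructor <;> rintro rfl <;> group
  simp only [this]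

theorem fdel_self (g : G) : fdel k g * fdel k g = fdel k g := fval_ext fun x => by
  classical
  rw [fval_mul, fval_fdel]; split_ifs <;> simp

theorem fdel_ne {g h : G} (e : g ≠ h) : fdel k g * fdel k h = 0 := fval_ext fun x => by
  classical
  rw [fval_mul, fval_fdel, fval_fdel, fval_zero]
  split_ifs with h1 h2
  · exact (e (h1.symm.trans h2)).elim
  all_goals simp

/-- The Drinfeld double `D(G)`: the semidirect product of the group algebra of `G` with the algebra
of functions on `G`, with respect to the conjugation action. -/
abbrev DG (k G : Type u) [Field k] [Group G] : Type u := SkewMonoidAlgebra (FunG k G) G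

/-- The element `g ⊗ f` of `D(G) = k[G] ⊗ F(G)`, that is, the product of `g` and `f`. -/
def dgEl (g : G) (f : FunG k G) : DG k G := SkewMonoidAlgebra.single g (g • f)

/-- The product formula of the Drinfeld double. -/
theorem dgEl_mul (g₁ g₂ h₁ h₂ : G) : dgEl g₁ (fdel k h₁) * dgEl g₂ (fdel k h₂) =
    dgEl (g₁ * g₂) (fdel k (g₂⁻¹ * h₁ * g₂) * fdel k h₂) := by
  rw [dgEl, dgEl, dgEl, SkewMonoidAlgebra.single_mul_single, smul_mul', conj_fdel, conj_fdel,
    conj_fdel, conj_fdel, conj_fdel]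
  congr 3
  · group
  · group

instance : Module.Finite k (DG k G) :=
  Module.Finite.equiv
    (SkewMonoidAlgebra.coeffLinearEquiv : DG k G ≃ₗ[k] (G →₀ FunG k G)).symm

/-- A function on `G` as a functional on `k[G]`. -/
def toFunctional (f : FunG k G) : reg k G →ₗ[k] k := ∑ g, fval f g • regCoeff g

/-- The action of functions on an object `(X, γ)` of the center: `f • x` is the pairing of `f` with
the `k[G]`-leg of `γ (e ⊗ x)`. -/
def funEnd (X : Center (FDRep k G)) (f : FunG k G) : ob X →ₗ[k] ob X := funAct X (toFunctional f)

theorem funEnd_apply (X : Center (FDRep k G)) (f : FunG k G) (x : ob X) :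
    funEnd X f x = ∑ g, fval f g • del X g x := by
  classical
  rw [funEnd, funAct, LinearMap.comp_apply, LinearMap.comp_apply, gam_basis, map_sum]
  refine Finset.sum_congr rfl fun g _ => ?_
  simp only [pairR_tm, toFunctional, LinearMap.sum_apply, LinearMap.smul_apply, regCoeff_basis,
    smul_eq_mul, mul_ite, mul_one, mul_zero, Finset.sum_ite_eq', Finset.mem_univ, if_true]

/-- The action of functions on an object of the center, as a homomorphism of algebras. -/
def funAlg (X : Center (FDRep k G)) : FunG k G →ₐ[k] Module.End k (ob X) :=
  AlgHom.ofLinearMap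
    { toFun := fun f => (funEnd X f : Module.End k (ob X))
      map_add' := fun f g => LinearMap.ext fun x => by
        rw [LinearMap.add_apply, funEnd_apply, funEnd_apply, funEnd_apply]
        simp only [fval_add, add_smul, Finset.sum_add_distrib]
      map_smul' := fun r f => LinearMap.ext fun x => by
        rw [RingHom.id_apply, LinearMap.smul_apply, funEnd_apply, funEnd_apply]
        simp only [fval_smul, mul_smul, Finset.smul_sum] }
    (LinearMap.ext fun x => by
      refine (funEnd_apply X 1 x).trans ?_
      simp only [fval_one, one_smul, del_sum, Module.End.one_apply])
    (fun f g => LinearMap.ext fun x => by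
      classical
      refine (funEnd_apply X (f * g) x).trans ?_
      refine Eq.trans ?_ (congrArg (funEnd X f) (funEnd_apply X g x)).symm
      simp only [funEnd_apply, fval_mul, map_sum, map_smul, del_apply, smul_ite, smul_zero,
        Finset.smul_sum, Finset.sum_ite_eq, Finset.mem_univ, if_true, mul_smul]
      refine (Finset.sum_congr rfl fun h _ => ?_).trans Finset.sum_comm
      simp only [Finset.sum_ite_eq, Finset.mem_univ, if_true, smul_comm (fval f _) (fval g _)])

theorem funAlg_apply (X : Center (FDRep k G)) (f : FunG k G) (x : ob X) :
    funAlg X f x = ∑ g, fval f g • del X g x := funEnd_apply X f x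

/-- The action of `D(G)` on an object of the center: `G` acts through the representation, functions
on `G` act through the half-braiding. -/
def dgAct (X : Center (FDRep k G)) : DG k G →ₐ[k] Module.End k (ob X) :=
  SkewMonoidAlgebra.liftNCAlgHom (funAlg X) (ob X).ρ (by
    intro f h
    ext x
    rw [Module.End.mul_apply, Module.End.mul_apply, funAlg_apply, funAlg_apply, map_sum,
      ← Equiv.sum_comp (MulAut.conj h).toEquiv]
    refine Finset.sum_congr rfl fun g _ => ?_
    simp only [MulEquiv.toEquiv_eq_coe, MulEquiv.coe_toEquiv, MulAut.conj_apply, map_smul, ρ_del,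
      fval_conj]
    congr 2; group)

theorem dgAct_single (X : Center (FDRep k G)) (g : G) (f : FunG k G) (x : ob X) :
    dgAct X (SkewMonoidAlgebra.single g f) x = ∑ h, fval f h • del X h ((ob X).ρ g x) := by
  rw [← funAlg_apply]
  have : dgAct X (SkewMonoidAlgebra.single g f) = funAlg X f * (ob X).ρ g :=
    SkewMonoidAlgebra.liftNC_single _ _ _ _
  rw [this, Module.End.mul_apply]

/-- An object of the center, to be regarded as a module over `D(G)`. -/
def TObj (X : Center (FDRep k G)) : Type u := ob X

instance (X : Center (FDRep k G)) : AddCommGroup (TObj X) := inferInstanceAs (AddCommGroup (ob X))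
instance (X : Center (FDRep k G)) : Module k (TObj X) := inferInstanceAs (Module k (ob X))
instance (X : Center (FDRep k G)) : Module.Finite k (TObj X) :=
  inferInstanceAs (Module.Finite k (ob X))

/-- The identity, into the module over `D(G)`. -/
def toT (X : Center (FDRep k G)) : ob X ≃ₗ[k] TObj X := LinearEquiv.refl k (ob X)

instance (X : Center (FDRep k G)) : Module (DG k G) (TObj X) :=
  letI : Module (Module.End k (ob X)) (ob X) := Module.End.applyModule
  (Module.compHom (ob X) (dgAct X).toRingHom : Module (DG k G) (ob X))

theorem smul_toT (X : Center (FDRep k G)) (d : DG k G) (x : ob X) :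
    d • toT X x = toT X (dgAct X d x) := rfl

instance (X : Center (FDRep k G)) : IsScalarTower k (DG k G) (TObj X) :=
  ⟨fun r d x => by
    obtain ⟨x, rfl⟩ := (toT X).surjective x
    rw [smul_toT, smul_toT, map_smul, LinearMap.smul_apply, map_smul]⟩

instance (X : Center (FDRep k G)) : Module.Finite (DG k G) (TObj X) :=
  Module.Finite.of_restrictScalars_finite k (DG k G) (TObj X)

theorem dgAct_comm {X Y : Center (FDRep k G)} (f : X ⟶ Y) (d : DG k G) (x : ob X) :
    lin (und f) (dgAct X d x) = dgAct Y d (lin (und f) x) := by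
  induction d using SkewMonoidAlgebra.induction_on' with
  | single g b =>
    rw [dgAct_single, dgAct_single, map_sum]
    simp only [map_smul, und_del, lin_ρ]
  | add a b ha hb => simp only [map_add, LinearMap.add_apply, ha, hb]

/-- A morphism of the center as a `D(G)`-linear map. -/
def TMap {X Y : Center (FDRep k G)} (f : X ⟶ Y) : TObj X →ₗ[DG k G] TObj Y where
  toFun x := toT Y (lin (und f) ((toT X).symm x))
  map_add' x y := by simp only [map_add]
  map_smul' d x := by
    obtain ⟨x, rfl⟩ := (toT X).surjective x
    rw [smul_toT, LinearEquiv.symm_apply_apply, LinearEquiv.symm_apply_apply, dgAct_comm,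
      RingHom.id_apply, smul_toT]

/-- An object of the center as a finitely generated module over `D(G)`. -/
def TFG (X : Center (FDRep k G)) : FGModuleCat.{u} (DG k G) := FGModuleCat.of (DG k G) (TObj X)

/-- A morphism of the center as a morphism of `D(G)`-modules. -/
def TFGMap {X Y : Center (FDRep k G)} (f : X ⟶ Y) : TFG X ⟶ TFG Y := FGModuleCat.ofHom (TMap f)

/-- The standard functor from the Drinfeld center of `Rep G` to the category of finite dimensional
modules over the Drinfeld double. -/
def T (k G : Type u) [Field k] [Group G] [Fintype G] : RedCenter k G ⥤ FGModuleCat.{u} (DG k G) where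
  obj X := TFG (k := k) (G := G) X
  map f := TFGMap (k := k) (G := G) f
  map_id _ := rfl
  map_comp _ _ := rfl

/-! ### Equivariant bundles over `G` -/

/-- The category of `G`-equivariant bundles of finite dimensional vector spaces over `G`, where `G`
acts on itself by conjugation. The tensor product and the duals of bundles are formed fiberwise, with
the diagonal and the contragredient action of `G`. -/
abbrev Bun (k G : Type u) [Field k] [Group G] : Type (u + 1) :=
  ActionCategory (ConjAct G) G ⥤ FGModuleCat.{u} k

/-- The element `h` of `D(G)`. -/
def gEl (k : Type u) [Field k] (h : G) : DG k G := SkewMonoidAlgebra.single h 1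

/-- The element `δ_g` of `D(G)`. -/
def dEl (k : Type u) [Field k] (g : G) : DG k G := SkewMonoidAlgebra.single 1 (fdel k g)

theorem gEl_mul (a b : G) : gEl k a * gEl k b = gEl k (a * b) := by
  rw [gEl, gEl, gEl, SkewMonoidAlgebra.single_mul_single, smul_one, mul_one]

theorem gEl_one : gEl k (1 : G) = 1 := rfl

theorem gEl_dEl (h g : G) : gEl k h * dEl k g = dEl k (h * g * h⁻¹) * gEl k h := by
  rw [gEl, dEl, dEl, SkewMonoidAlgebra.single_mul_single, SkewMonoidAlgebra.single_mul_single,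
    conj_fdel, one_mul, mul_one, one_mul, smul_one, mul_one]

theorem dEl_self (g : G) : dEl k g * dEl k g = dEl k g := by
  rw [dEl, SkewMonoidAlgebra.single_mul_single, one_smul, mul_one, fdel_self]

/-- A `D(G)`-module as a vector space. -/
def dgK (M : FGModuleCat.{u} (DG k G)) : Type u := M

instance (M : FGModuleCat.{u} (DG k G)) : AddCommGroup (dgK M) := inferInstanceAs (AddCommGroup M)
instance (M : FGModuleCat.{u} (DG k G)) : Module (DG k G) (dgK M) :=
  inferInstanceAs (Module (DG k G) M)
instance (M : FGModuleCat.{u} (DG k G)) : Module.Finite (DG k G) (dgK M) :=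
  inferInstanceAs (Module.Finite (DG k G) M)
instance (M : FGModuleCat.{u} (DG k G)) : Module k (dgK M) :=
  Module.compHom (dgK M) (algebraMap k (DG k G))
instance (M : FGModuleCat.{u} (DG k G)) : IsScalarTower k (DG k G) (dgK M) :=
  ⟨fun r d m => by
    rw [Algebra.smul_def, mul_smul]; rfl⟩
instance (M : FGModuleCat.{u} (DG k G)) : Module.Finite k (dgK M) :=
  Module.Finite.trans (DG k G) (dgK M)

/-- The action of an element of `D(G)` as a linear map. -/
def dgEnd (M : FGModuleCat.{u} (DG k G)) : DG k G →ₐ[k] Module.End k (dgK M) :=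
  Algebra.lsmul k k (dgK M)

theorem dgEnd_mul (M : FGModuleCat.{u} (DG k G)) (a b : DG k G) (v : dgK M) :
    dgEnd M a (dgEnd M b v) = dgEnd M (a * b) v := by rw [map_mul, Module.End.mul_apply]

/-- The fiber `M_g = δ_g M`. -/
def fibSub (M : FGModuleCat.{u} (DG k G)) (g : G) : Submodule k (dgK M) :=
  LinearMap.range (dgEnd M (dEl k g))

theorem fibSub_map (M : FGModuleCat.{u} (DG k G)) {p q : ActionCategory (ConjAct G) G} (f : p ⟶ q)
    (v : dgK M) (hv : v ∈ fibSub M p.back) :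
    dgEnd M (gEl k (ConjAct.ofConjAct f.1)) v ∈ fibSub M q.back := by
  obtain ⟨w, rfl⟩ := hv
  refine ⟨dgEnd M (gEl k (ConjAct.ofConjAct f.1)) w, ?_⟩
  rw [dgEnd_mul, dgEnd_mul, gEl_dEl]
  have : ConjAct.ofConjAct f.1 * p.back * (ConjAct.ofConjAct f.1)⁻¹ = q.back := f.2
  rw [this]

/-- The fiber as a finite dimensional vector space. -/
def fibObj (M : FGModuleCat.{u} (DG k G)) (g : G) : FGModuleCat.{u} k :=
  FGModuleCat.of k (fibSub M g)

/-- The action of `G` on the fibers. -/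
def fibAct (M : FGModuleCat.{u} (DG k G)) {p q : ActionCategory (ConjAct G) G} (f : p ⟶ q) :
    fibObj M p.back ⟶ fibObj M q.back :=
  FGModuleCat.ofHom
    (((dgEnd M (gEl k (ConjAct.ofConjAct f.1))).restrict (fibSub_map M f) :
      fibSub M p.back →ₗ[k] fibSub M q.back))

/-- The linear map underlying a morphism of finite dimensional vector spaces. -/
def flin {V W : FGModuleCat.{u} k} (f : V ⟶ W) : V →ₗ[k] W := f.hom.hom

theorem flin_ext {V W : FGModuleCat.{u} k} {f g : V ⟶ W} (h : ∀ v, flin f v = flin g v) : f = g :=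
  FGModuleCat.hom_ext (LinearMap.ext h)

/-- The inclusion of the fiber. -/
def fibIncl (M : FGModuleCat.{u} (DG k G)) (g : G) : fibObj M g →ₗ[k] dgK M := (fibSub M g).subtype

theorem fibIncl_injective (M : FGModuleCat.{u} (DG k G)) (g : G) :
    Function.Injective (fibIncl M g) := Subtype.val_injective

theorem fibIncl_act (M : FGModuleCat.{u} (DG k G)) {p q : ActionCategory (ConjAct G) G} (f : p ⟶ q)
    (v : fibObj M p.back) : fibIncl M q.back (flin (fibAct M f) v) =
      dgEnd M (gEl k (ConjAct.ofConjAct f.1)) (fibIncl M p.back v) := rfl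

/-- The equivariant bundle of a `D(G)`-module. -/
def fibBun (M : FGModuleCat.{u} (DG k G)) : Bun k G where
  obj p := fibObj M p.back
  map f := fibAct M f
  map_id p := flin_ext fun v => fibIncl_injective M _ (by
    rw [fibIncl_act]
    exact (one_smul (DG k G) (fibIncl M p.back v)))
  map_comp {p q r} f g := flin_ext fun v => fibIncl_injective M _ (by
    rw [fibIncl_act]
    change _ = fibIncl M r.back (flin (fibAct M g) (flin (fibAct M f) v))
    rw [fibIncl_act, fibIncl_act, dgEnd_mul, gEl_mul]
    rfl)

/-- A morphism of `D(G)`-modules as a linear map. -/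
def dgLin {M N : FGModuleCat.{u} (DG k G)} (f : M ⟶ N) : dgK M →ₗ[k] dgK N where
  toFun v := (f.hom.hom : M →ₗ[DG k G] N) v
  map_add' := (f.hom.hom : M →ₗ[DG k G] N).map_add
  map_smul' r v := (f.hom.hom : M →ₗ[DG k G] N).map_smul (algebraMap k (DG k G) r) v

theorem dgLin_act {M N : FGModuleCat.{u} (DG k G)} (f : M ⟶ N) (d : DG k G) (v : dgK M) :
    dgLin f (dgEnd M d v) = dgEnd N d (dgLin f v) := (f.hom.hom : M →ₗ[DG k G] N).map_smul d v

theorem fibSub_hom {M N : FGModuleCat.{u} (DG k G)} (f : M ⟶ N) (g : G) (v : dgK M)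
    (hv : v ∈ fibSub M g) : dgLin f v ∈ fibSub N g := by
  obtain ⟨w, rfl⟩ := hv
  exact ⟨dgLin f w, (dgLin_act f _ w).symm⟩

/-- A morphism of `D(G)`-modules restricted to the fibers. -/
def fibHom {M N : FGModuleCat.{u} (DG k G)} (f : M ⟶ N) (g : G) : fibObj M g ⟶ fibObj N g :=
  FGModuleCat.ofHom (((dgLin f).restrict (fibSub_hom f g) : fibSub M g →ₗ[k] fibSub N g))

theorem fibIncl_hom {M N : FGModuleCat.{u} (DG k G)} (f : M ⟶ N) (g : G) (v : fibObj M g) :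
    fibIncl N g (flin (fibHom f g) v) = dgLin f (fibIncl M g v) := rfl

theorem fibHom_act {M N : FGModuleCat.{u} (DG k G)} (f : M ⟶ N)
    {p q : ActionCategory (ConjAct G) G} (a : p ⟶ q) :
    fibAct M a ≫ fibHom f q.back = fibHom f p.back ≫ fibAct N a :=
  flin_ext fun v => fibIncl_injective N _ (by
    change fibIncl N _ (flin (fibHom f q.back) (flin (fibAct M a) v)) =
      fibIncl N _ (flin (fibAct N a) (flin (fibHom f p.back) v))
    rw [fibIncl_hom, fibIncl_act, fibIncl_act, fibIncl_hom, dgLin_act])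

/-- The functor from `D(G)`-modules to equivariant bundles over `G`, `M ↦ (M_g)`. -/
def fib (k G : Type u) [Field k] [Group G] [Fintype G] : FGModuleCat.{u} (DG k G) ⥤ Bun k G where
  obj M := fibBun M
  map f :=
    { app := fun p => fibHom f p.back
      naturality := fun _ _ a => fibHom_act f a }
  map_id _ := rfl
  map_comp _ _ := rfl

/-! ### Pivotal categories and pivotal functors -/

section
universe v₁ v₂ w₁ w₂
variable {C : Type w₁} [Category.{v₁} C] [MonoidalCategory C] [RightRigidCategory C]
variable {D : Type w₂} [Category.{v₂} D] [MonoidalCategory D] [RightRigidCategory D]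

/-- A pivotal structure: a monoidal natural isomorphism from the identity to the double dual. -/
structure IsPivotal (φ : ∀ X : C, X ⟶ (Xᘁ)ᘁ) : Prop where
  isIso : ∀ X, IsIso (φ X)
  naturality : ∀ {X Y : C} (f : X ⟶ Y), f ≫ φ Y = φ X ≫ (fᘁ)ᘁ
  tensor : ∀ X Y : C, φ (X ⊗ Y) ≫ ((rightDualTensorIso X Y).inv)ᘁ ≫
    (rightDualTensorIso (Yᘁ) (Xᘁ)).hom = φ X ⊗ₘ φ Y

variable (F : C ⥤ D) [F.Monoidal]

/-- The comparison `F(X*) ⟶ F(X)*`: the mate of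
`F(X*) ⊗ F(X) ⟶ F(X* ⊗ X) ⟶ F(1) ⟶ 1`. -/
def dualComparison (X : C) : F.obj (Xᘁ) ⟶ (F.obj X)ᘁ :=
  tensorRightHomEquiv (F.obj (Xᘁ)) (F.obj X) ((F.obj X)ᘁ) (𝟙_ D)
    (Functor.LaxMonoidal.μ F (Xᘁ) X ≫ F.map (ε_ X (Xᘁ)) ≫ Functor.OplaxMonoidal.η F) ≫
    (λ_ ((F.obj X)ᘁ)).hom

/-- A monoidal functor preserves pivotal structures if `F(X) ⟶ F(X**) ⟶ F(X*)*` agrees with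
`F(X) ⟶ F(X)** ⟶ F(X*)*`. -/
def PreservesPivotal (φ : ∀ X : C, X ⟶ (Xᘁ)ᘁ) (ψ : ∀ Y : D, Y ⟶ (Yᘁ)ᘁ) : Prop :=
  ∀ X : C, F.map (φ X) ≫ dualComparison F (Xᘁ) = ψ (F.obj X) ≫ (dualComparison F X)ᘁ

end

/-! ### The pivotal structures -/

/-- The canonical map of a finite dimensional vector space to its double dual. -/
def vpiv (V : FGModuleCat.{u} k) : V ⟶ (Vᘁ)ᘁ :=
  (FGModuleCat.ofHom (Module.Dual.eval k V) : V ⟶ FGModuleCat.FGModuleCatDual k (FGModuleCat.FGModuleCatDual k V))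

/-- The application of a functional. -/
def vap (V : FGModuleCat.{u} k) : ↥(Vᘁ) →ₗ[k] V →ₗ[k] k := LinearMap.id (R := k) (M := Module.Dual k V)

theorem vap_ext {V : FGModuleCat.{u} k} {f g : ↥(Vᘁ)} (h : ∀ v, vap V f v = vap V g v) : f = g :=
  LinearMap.ext (f := vap V f) (g := vap V g) h

/-- The elementary tensors in a tensor product of vector spaces. -/
def vtm (V W : FGModuleCat.{u} k) : V →ₗ[k] W →ₗ[k] (V ⊗ W : FGModuleCat.{u} k) :=
  TensorProduct.mk k V W

theorem vap_mate {V W : FGModuleCat.{u} k} (f : V ⟶ W) (ξ : ↥(Wᘁ)) (v : V) :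
    vap V (flin (fᘁ) ξ) v = vap W ξ (flin f v) := by
  have h := rightAdjointMate_comp_evaluation f
  exact congrArg (fun q => flin q (vtm (Wᘁ) V ξ v)) h

theorem vap_vpiv (V : FGModuleCat.{u} k) (v : V) (ξ : ↥(Vᘁ)) :
    vap (Vᘁ) (flin (vpiv V) v) ξ = vap V ξ v := rfl

theorem vpiv_naturality {V W : FGModuleCat.{u} k} (f : V ⟶ W) : f ≫ vpiv W = vpiv V ≫ (fᘁ)ᘁ :=
  flin_ext fun v => vap_ext fun ξ => by
    change vap _ (flin (vpiv W) (flin f v)) ξ = vap _ (flin ((fᘁ)ᘁ) (flin (vpiv V) v)) ξ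
    rw [vap_vpiv, vap_mate, vap_vpiv, vap_mate]

instance : RightRigidCategory (Bun k G) := Monoidal.rightRigidFunctorCategory

/-- The canonical map of a bundle to its double dual, fiberwise the canonical map of a vector
space to its double dual. -/
def bpiv (V : Bun k G) : V ⟶ (Vᘁ)ᘁ where
  app p := vpiv (V.obj p)
  naturality p q f := by
    refine (vpiv_naturality (V.map f)).trans ?_
    have : IsIso f := IsIso.of_groupoid f
    have h : V.map f = V.map (inv (inv f)) := by rw [IsIso.inv_inv]
    exact congrArg (fun g : V.obj p ⟶ V.obj q => vpiv (V.obj p) ≫ (gᘁ)ᘁ) h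

section
variable [IsAlgClosed k] [CharZero k]

/-- The pivotal structure of `(Z(Rep G), ⊗̄)`, inherited from vector spaces. -/
def zpiv (X : RedCenter k G) : X ⟶ (Xᘁ)ᘁ := pivH (k := k) (G := G) X

end

/-! ### The half-braiding of the reduced tensor product as a sum over simple objects -/

section
variable [IsAlgClosed k] [CharZero k]

theorem exists_split {V : FDRep k G} (hS : ¬ Simple V) (v : V) (hv : v ≠ 0) :
    ∃ (W : FDRep k G) (f : V ⟶ W), Module.finrank k W < Module.finrank k V ∧ lin f v ≠ 0 := by
  have hV1 : (𝟙 V : V ⟶ V) ≠ 0 := fun h => hv (congrArg (fun q => lin q v) h)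
  have : ∃ (W : FDRep k G) (j : W ⟶ V), Mono j ∧ j ≠ 0 ∧ ¬ IsIso j := by
    by_contra! hcon
    apply hS
    refine ⟨fun {W} j hj => ⟨?_, fun h => hcon W j hj h⟩⟩
    intro hi h
    apply hV1
    calc 𝟙 V = inv j ≫ j := (IsIso.inv_hom_id j).symm
      _ = inv j ≫ 0 := congrArg _ h
      _ = 0 := Limits.comp_zero
  obtain ⟨W, j, hj, hj0, hji⟩ := this
  let r : V ⟶ W := Injective.factorThru (𝟙 W) j
  have hr : j ≫ r = 𝟙 W := Injective.comp_factorThru _ _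
  have hr' : ∀ w, lin r (lin j w) = w := fun w => congrArg (fun q => lin q w) hr
  have hjinj : Function.Injective (lin j) := Function.LeftInverse.injective hr'
  have hW : Module.finrank k W < Module.finrank k V := by
    refine lt_of_le_of_ne (LinearMap.finrank_le_finrank_of_injective hjinj) fun heq => hji ?_
    have hsurj := (LinearMap.injective_iff_surjective_of_finrank_eq_finrank heq).mp hjinj
    refine ⟨r, hr, lin_ext (LinearMap.ext fun w => ?_)⟩
    obtain ⟨w, rfl⟩ := hsurj w
    exact congrArg (lin j) (hr' w)
  by_cases h : lin r v = 0
  · have hinv : ∀ g, ∀ u ∈ LinearMap.ker (lin r), V.ρ g u ∈ LinearMap.ker (lin r) := by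
      intro g u hu
      rw [LinearMap.mem_ker] at hu ⊢
      rw [lin_ρ, hu, map_zero]
    have hU : Module.finrank k (subRep V _ hinv) < Module.finrank k V := by
      change Module.finrank k (LinearMap.ker (lin r)) < _
      refine Submodule.finrank_lt (fun htop => hj0 ?_)
      apply lin_ext
      ext w
      have : lin j w ∈ LinearMap.ker (lin r) := by rw [htop]; trivial
      rw [LinearMap.mem_ker, hr'] at this
      rw [this, map_zero]; rfl
    have hmem : ∀ u : V, u - lin j (lin r u) ∈ LinearMap.ker (lin r) := by
      intro u
      rw [LinearMap.mem_ker, map_sub, hr', sub_self]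
    let p : V →ₗ[k] subRep V _ hinv :=
      (LinearMap.id - lin j ∘ₗ lin r).codRestrict (LinearMap.ker (lin r)) hmem
    have hp : ∀ u, lin (subIncl V _ hinv) (p u) = u - lin j (lin r u) := fun u => rfl
    refine ⟨subRep V _ hinv, mkHom p (fun g u => Subtype.val_injective ?_), hU, fun h0 => hv ?_⟩
    · change lin (subIncl V _ hinv) (p (V.ρ g u)) =
        lin (subIncl V _ hinv) ((subRep V _ hinv).ρ g (p u))
      rw [lin_ρ, hp, hp, map_sub, lin_ρ, lin_ρ]
    · change p v = 0 at h0
      have h1 := congrArg (lin (subIncl V _ hinv)) h0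
      rw [hp, h, map_zero, sub_zero, map_zero] at h1
      exact h1
  · exact ⟨W, r, hW, h⟩

theorem exists_simple (n : ℕ) : ∀ V : FDRep k G, Module.finrank k V = n → ∀ v : V, v ≠ 0 →
    ∃ (i : Irr k G) (f : V ⟶ i.rep), lin f v ≠ 0 := by
  induction n using Nat.strong_induction_on with
  | _ n ih =>
  intro V hV v hv
  by_cases hS : Simple V
  · obtain ⟨i, ⟨e⟩⟩ := Irr.exists_iso V
    refine ⟨i, e.hom, fun h => hv ?_⟩
    have h1 : lin e.inv (lin e.hom v) = v := congrArg (fun q => lin q v) e.hom_inv_id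
    rw [← h1, h, map_zero]
  · obtain ⟨W, f, hW, hf⟩ := exists_split hS v hv
    obtain ⟨i, f', hf'⟩ := ih _ (hV ▸ hW) W rfl _ hf
    exact ⟨i, f ≫ f', hf'⟩

theorem to_simple_ext {V W : FDRep k G} {f g : V ⟶ W}
    (h : ∀ (i : Irr k G) (p : W ⟶ i.rep), f ≫ p = g ≫ p) : f = g := by
  apply lin_ext
  ext v
  by_contra hne
  obtain ⟨i, p, hp⟩ := exists_simple _ W rfl (lin f v - lin g v) (sub_ne_zero.mpr hne)
  rw [map_sub] at hp
  exact hp (sub_eq_zero.mpr (congrArg (fun q => lin q v) (h i p)))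

/-- The trace pairing of morphisms `φ : V ⟶ X_j` with morphisms `φ' : X_j ⟶ V` identifies each
of the two spaces with the dual of the other; `TraceDual φ φ'` says that the families `φ` and `φ'`
are dual bases, for each `j`. -/
structure TraceDual {V : FDRep k G} {ι : Irr k G → Type} [∀ j, Fintype (ι j)]
    (φ : ∀ j, Module.Basis (ι j) k (V ⟶ j.rep)) (φ' : ∀ j, ι j → (j.rep ⟶ V)) : Prop where
  diag : ∀ j α, LinearMap.trace k j.rep (lin (φ' j α ≫ φ j α)) = 1
  off : ∀ j α β, α ≠ β → LinearMap.trace k j.rep (lin (φ' j β ≫ φ j α)) = 0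

theorem Irr.dim_ne_zero (i : Irr k G) : i.dim ≠ 0 := by
  rw [Irr.dim, Nat.cast_ne_zero]
  intro h
  have := Module.finrank_zero_iff.mp h
  apply id_nonzero i.rep
  apply lin_ext
  ext v
  exact Subsingleton.elim _ _

theorem Irr.end_eq (i : Irr k G) (f : i.rep ⟶ i.rep) :
    f = (i.dim⁻¹ * LinearMap.trace k i.rep (lin f)) • 𝟙 i.rep := by
  obtain ⟨c, hc⟩ := CategoryTheory.endomorphism_simple_eq_smul_id k f
  rw [← hc]
  congr 1
  rw [lin_smul, map_smul, lin_id, LinearMap.trace_id, smul_eq_mul, ← Irr.dim, mul_comm c,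
    inv_mul_cancel_left₀ i.dim_ne_zero]

theorem TraceDual.sum_eq {V : FDRep k G} {ι : Irr k G → Type} [∀ j, Fintype (ι j)]
    {φ : ∀ j, Module.Basis (ι j) k (V ⟶ j.rep)} {φ' : ∀ j, ι j → (j.rep ⟶ V)}
    (h : TraceDual φ φ') : ∑ j, j.dim • ∑ α, φ j α ≫ φ' j α = 𝟙 V := by
  classical
  apply to_simple_ext
  intro i p
  rw [Category.id_comp, Preadditive.sum_comp, Finset.sum_eq_single i]
  · rw [Linear.smul_comp, Preadditive.sum_comp]
    have h1 : ∀ α, φ' i α ≫ p = (i.dim⁻¹ * (φ i).repr p α) • 𝟙 i.rep := by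
      intro α
      conv_lhs => rw [← (φ i).sum_repr p]
      rw [Preadditive.comp_sum, Finset.sum_eq_single α]
      · rw [Linear.comp_smul, Irr.end_eq i (φ' i α ≫ φ i α), h.diag, mul_one, smul_smul, mul_comm]
      · intro β _ hβ
        rw [Linear.comp_smul, Irr.end_eq i (φ' i α ≫ φ i β), h.off _ _ _ hβ, mul_zero, zero_smul,
          smul_zero]
      · simp
    simp only [Category.assoc, h1, Linear.comp_smul, Category.comp_id, Finset.smul_sum, smul_smul]
    simp only [mul_inv_cancel_left₀ i.dim_ne_zero, (φ i).sum_repr]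
  · intro j _ hj
    rw [Linear.smul_comp, Preadditive.sum_comp, Finset.sum_eq_zero, smul_zero]
    intro α _
    rw [Category.assoc]
    have : φ' j α ≫ p = 0 := by
      by_contra hne
      have := isIso_of_hom_simple hne
      exact hj (Irr.eq_of_iso (asIso (φ' j α ≫ p)))
    rw [this, Limits.comp_zero]
  · simp

/-- The morphism `I* ⟶ J* ⊗ A` obtained from `J ⟶ A ⊗ I` by duality. -/
def legR {A I J : FDRep k G} (φ' : J ⟶ A ⊗ I) : dualRep I ⟶ dualRep J ⊗ A :=
  (λ_ (dualRep I)).inv ≫ (coev J ≫ (β_ J (dualRep J)).hom) ▷ dualRep I ≫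
    (α_ (dualRep J) J (dualRep I)).hom ≫
    dualRep J ◁ (φ' ▷ dualRep I ≫ (α_ A I (dualRep I)).hom ≫ A ◁ ev' I ≫ (ρ_ A).hom)

theorem lin_contract {A I : FDRep k G} (t : (A ⊗ I : FDRep k G)) (ξ : dualRep I) :
    lin ((α_ A I (dualRep I)).hom ≫ A ◁ ev' I ≫ (ρ_ A).hom) (t ⊠ ξ) = pairR A I (ap I ξ) t := by
  refine LinearMap.congr_fun (f := lin ((α_ A I (dualRep I)).hom ≫ A ◁ ev' I ≫ (ρ_ A).hom) ∘ₗ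
    (tmL _ _).flip ξ) (g := pairR A I (ap I ξ)) (tm_ext fun a x => ?_) t
  simp only [LinearMap.comp_apply, LinearMap.flip_apply, lin_comp, lin_assoc, lin_whiskerLeft,
    lin_ev', lin_rightUnitor, pairR_tm]

theorem lin_legR {A I J : FDRep k G} (φ' : J ⟶ A ⊗ I) (ξ : dualRep I) :
    lin (legR φ') ξ = ∑ n, cobas J n ⊠ pairR A I (ap I ξ) (lin φ' (bas J n)) := by
  rw [legR, lin_comp, LinearMap.comp_apply]
  simp only [lin_comp (_ ▷ _), LinearMap.comp_apply, lin_leftUnitor_inv, lin_whiskerRight, lin_comp (coev J), lin_coev, one_smul, map_sum, LinearMap.sum_apply, lin_braid,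
    lin_comp (α_ _ _ _).hom (dualRep J ◁ _), lin_assoc, lin_whiskerLeft, lin_contract]

/-- One summand of the half-braiding: from the top, create a pair `I ⊗ I*` between `X` and `Y`, move
`I` over `X` and half-braid `I*` with `Y`, absorb `A` into `I` on the left and emit it from `I*` on
the right, half-braid the result `J` with `X`, and close the loop. -/
def rbTerm (X Y : Center (FDRep k G)) {A I J : FDRep k G} (φ : A ⊗ I ⟶ J) (φ' : J ⟶ A ⊗ I) :
    A ⊗ (ob X ⊗ ob Y) ⟶ (ob X ⊗ ob Y) ⊗ A :=
  A ◁ (ob X ◁ ((λ_ (ob Y)).inv ≫ coev I ▷ ob Y ≫ (α_ I (dualRep I) (ob Y)).hom)) ≫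
  A ◁ ((α_ (ob X) I (dualRep I ⊗ ob Y)).inv ≫ ((β_ (ob X) I).hom ⊗ₘ gam Y (dualRep I))) ≫
  (α_ A (I ⊗ ob X) (ob Y ⊗ dualRep I)).inv ≫
  ((α_ A I (ob X)).inv ▷ (ob Y ⊗ dualRep I)) ≫
  ((φ ▷ ob X) ⊗ₘ (ob Y ◁ legR φ')) ≫
  (gam X J ⊗ₘ ((α_ (ob Y) (dualRep J) A).inv ≫ (β_ (ob Y) (dualRep J)).hom ▷ A)) ≫
  (α_ (ob X ⊗ J) (dualRep J ⊗ ob Y) A).inv ≫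
  ((α_ (ob X) J (dualRep J ⊗ ob Y)).hom ≫
    ob X ◁ ((α_ J (dualRep J) (ob Y)).inv ≫ ev' J ▷ ob Y ≫ (λ_ (ob Y)).hom)) ▷ A

/-- The half-braiding `γ ⊗̄ μ` on `X ⊗ Y`, with respect to dual bases `φ`, `φ'` for the spaces of
morphisms `A ⊗ X_i ⟶ X_j`. -/
def rbSum (X Y : Center (FDRep k G)) (A : FDRep k G) {ι : Irr k G → Irr k G → Type}
    [∀ i j, Fintype (ι i j)]
    (φ : ∀ i j, Module.Basis (ι i j) k (A ⊗ i.rep ⟶ j.rep))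
    (φ' : ∀ i j : Irr k G, ι i j → (j.rep ⟶ A ⊗ i.rep)) :
    A ⊗ (ob X ⊗ ob Y) ⟶ (ob X ⊗ ob Y) ⊗ A :=
  (globalDim k G)⁻¹ • ∑ i : Irr k G, ∑ j : Irr k G, (i.dim * j.dim) •
    ∑ α, rbTerm X Y (φ i j α) (φ' i j α)

theorem lin_rbTerm (X Y : Center (FDRep k G)) {A I J : FDRep k G} (φ : A ⊗ I ⟶ J)
    (φ' : J ⟶ A ⊗ I) (a : A) (x : ob X) (y : ob Y) :
    lin (rbTerm X Y φ φ') (a ⊠ (x ⊠ y)) = ∑ g, ∑ h, ∑ m,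
      (del X g x ⊠ del Y h y) ⊠ pairR A I (ap I ((dualRep I).ρ h (cobas I m)))
        (lin φ' (J.ρ g (lin φ (a ⊠ bas I m)))) := by
  rw [rbTerm]
  simp only [lin_comp, LinearMap.comp_apply, lin_whiskerLeft, lin_leftUnitor_inv, lin_whiskerRight,
    lin_coev, one_smul, map_sum, LinearMap.sum_apply, lin_assoc, lin_assoc_inv, lin_tensorHom,
    lin_braid, gam_tmul, lin_legR, lin_ev', lin_leftUnitor, map_smul, LinearMap.smul_apply]
  have key : ∀ (m : Fin (Module.finrank k I)) (g h : G), ∑ n, ap J (cobas J n) (J.ρ g (lin φ (a ⊠ bas I m))) •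
      (del X g x ⊠ del Y h y) ⊠ pairR A I (ap I ((dualRep I).ρ h (cobas I m)))
        (lin φ' (bas J n)) = (del X g x ⊠ del Y h y) ⊠
        pairR A I (ap I ((dualRep I).ρ h (cobas I m)))
        (lin φ' (J.ρ g (lin φ (a ⊠ bas I m)))) := by
    intro m g h
    conv_rhs => rw [← bas_expand J (J.ρ g (lin φ (a ⊠ bas I m)))]
    simp only [map_sum, map_smul, LinearMap.smul_apply]
  refine Eq.trans (b := ∑ m, ∑ h, ∑ g, (del X g x ⊠ del Y h y) ⊠
    pairR A I (ap I ((dualRep I).ρ h (cobas I m))) (lin φ' (J.ρ g (lin φ (a ⊠ bas I m))))) ?_ ?_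
  · refine Finset.sum_congr rfl fun m _ => Finset.sum_congr rfl fun h _ => ?_
    rw [Finset.sum_comm]
    refine Finset.sum_congr rfl fun g _ => ?_
    rw [← key]
    rfl
  · refine (Finset.sum_congr rfl fun m _ => Finset.sum_comm).trans ?_
    refine Finset.sum_comm.trans ?_
    exact Finset.sum_congr rfl fun g _ => Finset.sum_comm

theorem TraceDual.sum_apply {V : FDRep k G} {ι : Irr k G → Type} [∀ j, Fintype (ι j)]
    {φ : ∀ j, Module.Basis (ι j) k (V ⟶ j.rep)} {φ' : ∀ j, ι j → (j.rep ⟶ V)}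
    (h : TraceDual φ φ') (t : V) : ∑ j, j.dim • ∑ α, lin (φ' j α) (lin (φ j α) t) = t := by
  have := congrArg (fun q => lin q t) h.sum_eq
  simp only [lin_sum, lin_smul, lin_comp, lin_id, LinearMap.sum_apply, LinearMap.smul_apply,
    LinearMap.comp_apply, LinearMap.id_apply] at this
  exact this

theorem sum_rbTerm (X Y : Center (FDRep k G)) {A I : FDRep k G} {ι : Irr k G → Type}
    [∀ j, Fintype (ι j)] {φ : ∀ j, Module.Basis (ι j) k (A ⊗ I ⟶ j.rep)}
    {φ' : ∀ j, ι j → (j.rep ⟶ A ⊗ I)} (hφ : TraceDual φ φ') (a : A) (x : ob X) (y : ob Y) :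
    ∑ j, j.dim • ∑ α, lin (rbTerm X Y (φ j α) (φ' j α)) (a ⊠ (x ⊠ y)) =
      ∑ g, ∑ h, I.character (h⁻¹ * g) • ((del X g x ⊠ del Y h y) ⊠ A.ρ g a) := by
  let L : (Fin (Module.finrank k I) → (A ⊗ I : FDRep k G)) →ₗ[k]
      ((ob X ⊗ ob Y) ⊗ A : FDRep k G) :=
    ∑ g, ∑ h, ∑ m, tmL (ob X ⊗ ob Y) A (del X g x ⊠ del Y h y) ∘ₗ
      pairR A I (ap I ((dualRep I).ρ h (cobas I m))) ∘ₗ (A ⊗ I).ρ g ∘ₗ LinearMap.proj m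
  have hL : ∀ t, L t = ∑ g, ∑ h, ∑ m, (del X g x ⊠ del Y h y) ⊠
      pairR A I (ap I ((dualRep I).ρ h (cobas I m))) ((A ⊗ I).ρ g (t m)) := by
    intro t
    simp only [L, LinearMap.sum_apply, LinearMap.comp_apply, LinearMap.proj_apply]
  have h1 : ∀ j α, lin (rbTerm X Y (φ j α) (φ' j α)) (a ⊠ (x ⊠ y)) =
      L (fun m => lin (φ' j α) (lin (φ j α) (a ⊠ bas I m))) := by
    intro j α
    rw [lin_rbTerm, hL]
    simp only [lin_ρ]
  have h2 : (∑ j, j.dim • ∑ α, fun m => lin (φ' j α) (lin (φ j α) (a ⊠ bas I m))) =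
      fun m => a ⊠ bas I m := by
    funext m
    simp only [Finset.sum_apply, Pi.smul_apply]
    exact hφ.sum_apply _
  simp only [h1, ← map_smul, ← map_sum, h2]
  rw [hL]
  refine Finset.sum_congr rfl fun g _ => Finset.sum_congr rfl fun h _ => ?_
  simp only [tensor_ρ, pairR_tm, ap_ρ, ρ_mul, map_smul]
  rw [character_eq, Finset.sum_smul]

/-- The half-braiding `γ ⊗̄ μ` on `X ⊗ Y` is the composition of the half-braiding `γ ⊗ c⁻¹` with the
projector `Q`. -/
theorem rbSum_eq (X Y : Center (FDRep k G)) (A : FDRep k G) {ι : Irr k G → Irr k G → Type}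
    [∀ i j, Fintype (ι i j)]
    (φ : ∀ i j, Module.Basis (ι i j) k (A ⊗ i.rep ⟶ j.rep))
    (φ' : ∀ i j : Irr k G, ι i j → (j.rep ⟶ A ⊗ i.rep)) (hφ : ∀ i, TraceDual (φ i) (φ' i)) :
    rbSum X Y A φ φ' = A ◁ Q X Y ≫ redBraid X Y A := by
  classical
  apply hom_ext_tm3'
  intro a x y
  have hG : (Nat.card G : k) ≠ 0 := by simp
  have hgh : ∀ a b : G, b⁻¹ * a = 1 ↔ a = b := fun a b => by
    rw [inv_mul_eq_one]; exact eq_comm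
  have hl : lin (rbSum X Y A φ φ') (a ⊠ (x ⊠ y)) =
      (globalDim k G)⁻¹ • ∑ i : Irr k G, i.dim • ∑ j : Irr k G, j.dim •
        ∑ α, lin (rbTerm X Y (φ i j α) (φ' i j α)) (a ⊠ (x ⊠ y)) := by
    simp only [rbSum, lin_smul, lin_sum, LinearMap.smul_apply, LinearMap.sum_apply, mul_smul,
      Finset.smul_sum]
  rw [hl]
  simp only [sum_rbTerm X Y (hφ _), lin_comp, LinearMap.comp_apply, lin_whiskerLeft, lin_Q, map_sum,
    redBraid, lin_assoc_inv, lin_whiskerRight, gam_tmul, LinearMap.sum_apply, lin_assoc,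
    lin_braid_inv]
  have hr : ∀ g h, (del X g (del X h x) ⊠ del Y h y) ⊠ A.ρ g a =
      if h = g then (del X g x ⊠ del Y g y) ⊠ A.ρ g a else 0 := by
    intro g h
    split_ifs with e
    · rw [e, del_self]
    · rw [del_ne g h _ (fun e' => e e'.symm)]
      simp only [map_zero, LinearMap.zero_apply]
  have hs : ∀ g h, ∑ i : Irr k G, ((globalDim k G)⁻¹ * (i.dim * i.rep.character (h⁻¹ * g))) •
      ((del X g x ⊠ del Y h y) ⊠ A.ρ g a) =
      if g = h then (del X g x ⊠ del Y h y) ⊠ A.ρ g a else 0 := by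
    intro g h
    rw [← Finset.sum_smul, ← Finset.mul_sum, sum_dim_char]
    simp only [hgh]
    split_ifs with e
    · rw [globalDim_eq, inv_mul_cancel₀ hG, one_smul]
    · rw [mul_zero, zero_smul]
  simp only [hr, Finset.sum_ite_eq, Finset.mem_univ, if_true, Finset.smul_sum, smul_smul]
  rw [Finset.sum_comm]
  refine Finset.sum_congr rfl fun g _ => ?_
  rw [Finset.sum_comm]
  simp only [mul_assoc, hs, Finset.sum_ite_eq, Finset.mem_univ, if_true]

/-- On `X ⊗̄ Y`, the half-braiding `γ ⊗̄ μ` is the restriction of the sum over simple objects. -/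
theorem rι_rbSum (X Y : Center (FDRep k G)) (A : FDRep k G) {ι : Irr k G → Irr k G → Type}
    [∀ i j, Fintype (ι i j)]
    (φ : ∀ i j, Module.Basis (ι i j) k (A ⊗ i.rep ⟶ j.rep))
    (φ' : ∀ i j : Irr k G, ι i j → (j.rep ⟶ A ⊗ i.rep)) (hφ : ∀ i, TraceDual (φ i) (φ' i)) :
    A ◁ rι X Y ≫ rbSum X Y A φ φ' = gam (rt X Y) A ≫ rι X Y ▷ A := by
  have h : rι X Y ≫ Q X Y = rι X Y := by
    rw [← rπ_rι, ← Category.assoc, rι_rπ, Category.id_comp]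
  rw [rbSum_eq X Y A φ φ' hφ, ← Category.assoc, ← MonoidalCategory.whiskerLeft_comp, h, rι_gam]

end


/-! ### The fibers of the bundle of an object of the center -/

/-- The fiber over `g` of the bundle of `T X`, as a subset of `X`. -/
def fibT (X : Center (FDRep k G)) (p : ActionCategory (ConjAct G) G)
    (v : fibObj (TFG X) p.back) : ob X :=
  (toT X).symm (fibIncl (TFG X) p.back v)

theorem fibT_injective (X : Center (FDRep k G)) (p : ActionCategory (ConjAct G) G) :
    Function.Injective (fibT X p) :=
  (toT X).symm.injective.comp (fibIncl_injective (TFG X) p.back)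

theorem del_fibT (X : Center (FDRep k G)) (p : ActionCategory (ConjAct G) G)
    (v : fibObj (TFG X) p.back) : del X p.back (fibT X p v) = fibT X p v := by
  classical
  obtain ⟨w, hw⟩ :
      ∃ w : dgK (TFG X), dgEnd (TFG X) (dEl k p.back) w = fibIncl (TFG X) p.back v := v.2
  have h : ∀ x : ob X, dgAct X (dEl k p.back) x = del X p.back x := by
    intro x
    rw [dEl, dgAct_single]
    simp only [fval_fdel, ρ_one, ite_smul, one_smul, zero_smul, Finset.sum_ite_eq,
      Finset.sum_ite_eq', Finset.mem_univ, if_true]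
  have h1 : fibT X p v = del X p.back ((toT X).symm w) := by
    rw [← h, fibT, ← hw]; rfl
  rw [h1, del_self]

section
variable [IsAlgClosed k] [CharZero k]

/-- The tensor structure of the functor from `(Z(Rep G), ⊗̄)` to bundles is the identification of the
fiber `(X ⊗̄ Y)_g ⊆ X ⊗ Y` with `X_g ⊗ Y_g`. -/
def IsFiberwise (k G : Type u) [Field k] [Group G] [Fintype G] [IsAlgClosed k] [CharZero k]
    (m : (T k G ⋙ fib k G).Monoidal) : Prop :=
  ∀ (X Y : Center (FDRep k G)) (p : ActionCategory (ConjAct G) G)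
    (v : fibObj (TFG X) p.back) (w : fibObj (TFG Y) p.back),
    lin (rι X Y) (fibT (rt X Y) p (flin ((m.toLaxMonoidal.μ X Y).app p)
      (vtm (fibObj (TFG X) p.back) (fibObj (TFG Y) p.back) v w))) = fibT X p v ⊠ fibT Y p w

end

end DR

end

noncomputable section
namespace DR

section
variable {k G : Type u} [Field k] [Group G] [Fintype G]

/-! A half-braiding on a representation `X` amounts to a grading of `X` by `G` with `h X_g =
X_{hgh⁻¹}`. Naturality along the maps `k[G] ⟶ A`, `g ↦ g a`, forces `γ_A (a ⊗ x) = ∑ g, δ_g x ⊗ g a`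
(`gam_tmul`), and the tensor axiom with invertibility makes the `δ_g` orthogonal idempotents of sum
`1` (`isGrading_del`). Together with the action of `G` this is an action of `D(G)`, and also a
bundle with fibers `δ_g X`.

Since `D(G)` is spanned by the products `δ_g h` (`single_eq_sum`), a linear map is `D(G)`-linear as
soon as it commutes with `G` and with all `δ_g`; hence `T` is full and faithful. A module is the
direct sum of its fibers, so a morphism of bundles glues to a unique morphism of modules
(`fib_map_surjective`), and `fib` is full and faithful. Conversely, the total space of a bundle `B`
is a graded representation whose bundle is again `B` (`totalIso`). This gives essential surjectivity
of `fib` and, by lifting isomorphisms along `fib`, that of `T`.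

A loop labelled by `X_i` acts on `X_a ⊗ Y_b` by the scalar `χ_i (b⁻¹ a)`, and `∑ d_i χ_i` is `|G|`
times the delta function at `1` (`sum_dim_char`). So `Q` is the projection of `X ⊗ Y` onto the sum
of the `X_g ⊗ Y_g` (`lin_Q`), and the fiber of the reduced tensor product over `g` is `X_g ⊗ Y_g`
inside `X ⊗ Y` (`lin_rι_fel`). This identification is the tensor constraint `tensorIso`. It is
coherent because, on elementary tensors of vectors from the fibers, the associators on both sides
merely move brackets and the unit constraints become scalar multiplication.

Duals in a rigid category are governed by their evaluations. The evaluation of `X*` with `X` in the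
center sends `ξ ⊗ x` to the function `g ↦ ξ (δ_g x)`, whose values sum to `ξ x` (`sumU_rtEv`); for
bundles the evaluation is the pairing on each fiber. Hence dual morphisms, duals of tensor products
and the comparison of duals under the functor are all described by ordinary pairings (`apD_rMate`,
`apD_rtDual`, `bap_dualT`). A pivotal map sends a vector to evaluation at that vector, so each
pivotal identity reduces to an equality of scalars. -/

theorem single_eq_sum (h : G) (b : FunG k G) :
    (SkewMonoidAlgebra.single h b : DG k G) = ∑ g, fval b g • (dEl k g * gEl k h) := by
  classical
  -- It suffices to expand the coefficient: a function is the combination of delta functions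
  -- weighted by its values.
  have hb : b = ∑ g, fval b g • fdel k g := fval_ext fun x => by
    have : ∀ s : Finset G, fval (∑ g ∈ s, fval b g • fdel k g) x =
        ∑ g ∈ s, fval b g * fval (fdel k g) x := fun s =>
      map_sum (Pi.evalAddMonoidHom (fun _ : G => k) x) (fun g => fval b g • fdel k g) s
    rw [this]
    simp [fval_fdel]
  -- Viewing `single h` as an additive homomorphism in its coefficient allows the sum to be pulled
  -- out.
  have h1 : ∀ c : FunG k G, (SkewMonoidAlgebra.single h c : DG k G) =
      SkewMonoidAlgebra.singleAddHom h c := fun _ => rfl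
  conv_lhs => rw [hb, h1, map_sum]
  refine Finset.sum_congr rfl fun g _ => ?_
  rw [← h1, dEl, gEl, SkewMonoidAlgebra.single_mul_single, one_mul, one_smul, mul_one,
    SkewMonoidAlgebra.smul_single]

/-! ### Modules over the Drinfeld double -/

section
variable {M N : FGModuleCat.{u} (DG k G)}

theorem dEl_ne {g h : G} (e : g ≠ h) : dEl k g * dEl k h = 0 := by
  rw [dEl, dEl, SkewMonoidAlgebra.single_mul_single, one_smul, fdel_ne e,
    SkewMonoidAlgebra.single_zero]

/-- The projection onto the fiber `M_g = δ_g M`. -/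
def fibProj (M : FGModuleCat.{u} (DG k G)) (g : G) : dgK M →ₗ[k] fibObj M g :=
  (dgEnd M (dEl k g)).rangeRestrict

theorem fibIncl_proj (g : G) (v : dgK M) : fibIncl M g (fibProj M g v) = dgEnd M (dEl k g) v := rfl

/-- An element of the fiber has the form `δ_g w`, and `δ_g` is idempotent. -/
theorem dEl_fibIncl (g : G) (v : fibObj M g) :
    dgEnd M (dEl k g) (fibIncl M g v) = fibIncl M g v := by
  obtain ⟨w, hw⟩ : ∃ w, dgEnd M (dEl k g) w = fibIncl M g v := v.2
  rw [← hw, dgEnd_mul, dEl_self]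

theorem dEl_fibIncl_ne {g h : G} (e : g ≠ h) (v : fibObj M h) :
    dgEnd M (dEl k g) (fibIncl M h v) = 0 := by
  rw [← dEl_fibIncl, dgEnd_mul, dEl_ne e, map_zero, LinearMap.zero_apply]

theorem fibProj_incl (g : G) (v : fibObj M g) : fibProj M g (fibIncl M g v) = v :=
  fibIncl_injective M g (by rw [fibIncl_proj, dEl_fibIncl])

theorem fibProj_dEl (g : G) (v : dgK M) : fibProj M g (dgEnd M (dEl k g) v) = fibProj M g v :=
  fibIncl_injective M g (by rw [fibIncl_proj, fibIncl_proj, dgEnd_mul, dEl_self])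

theorem fibProj_dEl_ne {g h : G} (e : g ≠ h) (v : dgK M) :
    fibProj M g (dgEnd M (dEl k h) v) = 0 :=
  fibIncl_injective M g (by
    rw [fibIncl_proj, dgEnd_mul, dEl_ne e, map_zero, LinearMap.zero_apply, map_zero])

/-- This is the expansion of the constant function `1`. With orthogonality of the `δ_g` it
decomposes every module into the direct sum of its fibers. -/
theorem sum_dEl : ∑ g : G, dEl k g = 1 := by
  have h := single_eq_sum (k := k) (1 : G) 1
  simp only [fval_one, one_smul, gEl_one, mul_one] at h
  exact h.symm

theorem sum_dgEnd_dEl (v : dgK M) : ∑ g, dgEnd M (dEl k g) v = v := by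
  rw [← LinearMap.sum_apply, ← map_sum, sum_dEl, map_one, Module.End.one_apply]

/-- A `k`-linear map between `D(G)`-modules which commutes with the elements of `G` and with the
delta functions is `D(G)`-linear. -/
theorem dgEnd_comm_of (F : dgK M →ₗ[k] dgK N)
    (hg : ∀ h v, F (dgEnd M (gEl k h) v) = dgEnd N (gEl k h) (F v))
    (hd : ∀ g v, F (dgEnd M (dEl k g) v) = dgEnd N (dEl k g) (F v)) (d : DG k G) (v : dgK M) :
    F (dgEnd M d v) = dgEnd N d (F v) := by
  induction d using SkewMonoidAlgebra.induction_on' with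
  | single h b =>
    -- After this expansion the element is a combination of products `δ_g h`, to which `hg` and `hd`
    -- apply one after the other.
    rw [single_eq_sum]
    simp only [map_sum, map_smul, map_mul, LinearMap.sum_apply, LinearMap.smul_apply,
      Module.End.mul_apply, hg, hd]
  | add a b ha hb => simp only [map_add, LinearMap.add_apply, ha, hb]

/-- A `k`-linear map commuting with the elements of `G` and with the delta functions, as a morphism
of `D(G)`-modules. -/
def dgHom (F : dgK M →ₗ[k] dgK N)
    (hg : ∀ h v, F (dgEnd M (gEl k h) v) = dgEnd N (gEl k h) (F v))
    (hd : ∀ g v, F (dgEnd M (dEl k g) v) = dgEnd N (dEl k g) (F v)) : M ⟶ N :=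
  InducedCategory.homMk (ModuleCat.ofHom
    { toFun := F
      map_add' := F.map_add
      map_smul' := dgEnd_comm_of F hg hd })

theorem dgLin_ext {f g : M ⟶ N} (h : ∀ v, dgLin f v = dgLin g v) : f = g := by
  apply FGModuleCat.hom_ext
  exact LinearMap.ext h

end

/-! ### Full faithfulness of the passage from modules to bundles. -/

instance fib_faithful : (fib k G).Faithful where
  map_injective {M N} f g h := dgLin_ext fun v => by
    -- Every vector is the sum of its components in the fibers, so a morphism is determined by its
    -- restrictions to them.
    rw [← sum_dgEnd_dEl v, map_sum, map_sum]
    refine Finset.sum_congr rfl fun x _ => ?_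
    have h1 := congrArg (fun q : fibBun M ⟶ fibBun N =>
      fibIncl N x (flin (q.app (x : ActionCategory (ConjAct G) G)) (fibProj M x v))) h
    exact h1

/-- A morphism of bundles on the fiber over `p`. -/
def bunApp {M N : FGModuleCat.{u} (DG k G)} (φ : fibBun M ⟶ fibBun N)
    (p : ActionCategory (ConjAct G) G) : fibObj M p.back →ₗ[k] fibObj N p.back := flin (φ.app p)

theorem bunApp_act {M N : FGModuleCat.{u} (DG k G)} (φ : fibBun M ⟶ fibBun N)
    {p q : ActionCategory (ConjAct G) G} (f : p ⟶ q) (v : fibObj M p.back) :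
    bunApp φ q (flin (fibAct M f) v) = flin (fibAct N f) (bunApp φ p v) :=
  congrArg (fun q => flin q v) (φ.naturality f)

/-- The element `g` as an object of the action groupoid. -/
def pt (g : G) : ActionCategory (ConjAct G) G := ⟨(), g⟩

/-- The morphism `g ⟶ h g h⁻¹` of the action groupoid. -/
def conjHom (h g : G) : pt g ⟶ pt (h * g * h⁻¹) := ⟨ConjAct.toConjAct h, rfl⟩

/-- The relation `h δ_g = δ_{hgh⁻¹} h` in terms of projections; it is what makes a map glued from
fibers commute with `G`. -/
theorem fibProj_gEl (M : FGModuleCat.{u} (DG k G)) (h g : G) (v : dgK M) :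
    fibProj M (pt (h * g * h⁻¹)).back (dgEnd M (gEl k h) v) =
      flin (fibAct M (conjHom h g)) (fibProj M (pt g).back v) := fibIncl_injective M _ (by
  rw [fibIncl_proj, dgEnd_mul, fibIncl_act, fibIncl_proj, dgEnd_mul]
  exact congrArg (fun d => dgEnd M d v) (gEl_dEl h g).symm)

/-- The maps on fibers are glued to the block diagonal map `F = ∑ g, incl_g ∘ φ_g ∘ proj_g`. Block
diagonality makes `F` commute with the `δ_g`, naturality of `φ` makes it commute with `G`, and on
each fiber `F` restricts to `φ`. -/
theorem fib_map_surjective {M N : FGModuleCat.{u} (DG k G)} (φ : fibBun M ⟶ fibBun N) :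
    ∃ f : M ⟶ N, (fib k G).map f = φ := by
  let F : dgK M →ₗ[k] dgK N :=
    ∑ g : G, fibIncl N (pt g).back ∘ₗ bunApp φ (pt g) ∘ₗ fibProj M (pt g).back
  have hF : ∀ v, F v =
      ∑ g : G, fibIncl N (pt g).back (bunApp φ (pt g) (fibProj M (pt g).back v)) := fun v => by
    simp only [F, LinearMap.sum_apply, LinearMap.comp_apply]
  -- By orthogonality only the summand of index `g` survives.
  have hd : ∀ (g : G) v, F (dgEnd M (dEl k g) v) =
      fibIncl N (pt g).back (bunApp φ (pt g) (fibProj M (pt g).back v)) := by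
    intro g v
    rw [hF, Finset.sum_eq_single g]
    · congr 2
      exact fibProj_dEl g v
    · intro h _ e
      have : fibProj M (pt h).back (dgEnd M (dEl k g) v) = 0 := fibProj_dEl_ne e v
      rw [this, map_zero, map_zero]
    · simp
  refine ⟨dgHom F (fun h v => ?_) (fun g v => ?_), ?_⟩
  -- The element `h` carries the fiber over `g` to the fiber over `hgh⁻¹`, so the sum on the left is
  -- reindexed by conjugation.
  · rw [hF, hF, map_sum, ← Equiv.sum_comp (MulAut.conj h).toEquiv]
    refine Finset.sum_congr rfl fun g _ => ?_
    -- Base points are written with `pt` so that they match the source and target of `conjHom h g`.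
    have h1 : fibIncl N (pt (h * g * h⁻¹)).back (bunApp φ (pt (h * g * h⁻¹))
        (fibProj M (pt (h * g * h⁻¹)).back (dgEnd M (gEl k h) v))) =
        dgEnd N (gEl k h) (fibIncl N (pt g).back (bunApp φ (pt g) (fibProj M (pt g).back v))) := by
      rw [fibProj_gEl, bunApp_act, fibIncl_act]
      rfl
    exact h1
  · rw [hd, hF, map_sum, Finset.sum_eq_single g]
    · exact (dEl_fibIncl _ _).symm
    · intro h _ e
      exact dEl_fibIncl_ne (Ne.symm e) _
    · simp
  · have h1 : ∀ (p : ActionCategory (ConjAct G) G) (v : fibObj M p.back),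
        F (fibIncl M p.back v) = fibIncl N p.back (bunApp φ p v) := by
      intro p v
      -- A vector of the fiber over `p` is fixed by its own delta function, so `hd` applies to it.
      have h2 : F (dgEnd M (dEl k p.back) (fibIncl M p.back v)) =
        fibIncl N p.back (bunApp φ p (fibProj M p.back (fibIncl M p.back v))) := hd _ _
      rwa [dEl_fibIncl, fibProj_incl] at h2
    apply NatTrans.ext
    funext p
    exact flin_ext fun v => fibIncl_injective N p.back (h1 p v)

instance fib_full : (fib k G).Full where
  map_surjective φ := fib_map_surjective φ

/-! ### The functor from the center -/

section
variable {X Y : Center (FDRep k G)}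

theorem dgAct_dEl (g : G) (x : ob X) : dgAct X (dEl k g) x = del X g x := by
  classical
  rw [dEl, dgAct_single]
  simp only [fval_fdel, ρ_one, ite_smul, one_smul, zero_smul, Finset.sum_ite_eq',
    Finset.mem_univ, if_true]

/-- The function part of `gEl k h` is the constant `1`, which acts by `∑ g, δ_g = id`. -/
theorem dgAct_gEl (h : G) (x : ob X) : dgAct X (gEl k h) x = (ob X).ρ h x := by
  rw [gEl, dgAct_single]
  simp only [fval_one, one_smul, del_sum]

theorem TFGMap_injective {f g : X ⟶ Y} (h : TFGMap f = TFGMap g) : f = g :=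
  ob_ext fun x => congrArg (fun q : TFG X ⟶ TFG Y => dgLin q x) h

/-- A `D(G)`-linear map commutes in particular with the elements of `G` and with the `δ_g`, and by
`homOfDel` this is all that a morphism of the center requires. -/
theorem TFGMap_surjective (φ : TFG X ⟶ TFG Y) : ∃ f : X ⟶ Y, TFGMap f = φ := by
  let φ' : TObj X →ₗ[DG k G] TObj Y := φ.hom.hom
  let F : ob X →ₗ[k] ob Y :=
    (toT Y).symm.toLinearMap ∘ₗ φ'.restrictScalars k ∘ₗ (toT X).toLinearMap
  have hF : ∀ (d : DG k G) x, F (dgAct X d x) = dgAct Y d (F x) :=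
    fun d x => φ'.map_smul d (toT X x)
  refine ⟨homOfDel (mkHom F fun g x => ?_) (fun g x => ?_), rfl⟩
  · rw [← dgAct_gEl, hF, dgAct_gEl]
  · rw [lin_mkHom, ← dgAct_dEl, hF, dgAct_dEl]

instance T_faithful : (T k G).Faithful where
  map_injective h := TFGMap_injective (k := k) (G := G) h

instance T_full : (T k G).Full where
  map_surjective φ := TFGMap_surjective (k := k) (G := G) φ

/-- The projection onto the fiber of the bundle of `T X`. -/
def prF (X : Center (FDRep k G)) (p : ActionCategory (ConjAct G) G) :
    ob X →ₗ[k] fibObj (TFG X) p.back where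
  toFun x := fibProj (TFG X) p.back (toT X x)
  map_add' x y := by rw [map_add]; exact map_add (fibProj (TFG X) p.back) _ _
  map_smul' r x := by
    apply fibIncl_injective
    -- Scalars act on the fiber through `algebraMap k (DG k G)`, but on `X` through the
    -- representation; `AlgHom.commutes` reconciles the two actions.
    change dgAct X (dEl k p.back) (r • x) =
      dgAct X (algebraMap k (DG k G) r) (dgAct X (dEl k p.back) x)
    rw [map_smul, AlgHom.commutes]
    rfl

theorem fibT_prF (p : ActionCategory (ConjAct G) G) (x : ob X) :
    fibT X p (prF X p x) = del X p.back x := dgAct_dEl _ x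

end

end

section
variable {k G : Type u} [Field k] [Group G] [Fintype G]

/-! ### The object of the center attached to a bundle -/

section
variable (B : Bun k G)

/-- The total space of a bundle. -/
def Total : Type u := ∀ g : G, B.obj (pt g)

instance : AddCommGroup (Total B) := inferInstanceAs (AddCommGroup (∀ g : G, B.obj (pt g)))
instance : Module k (Total B) := inferInstanceAs (Module k (∀ g : G, B.obj (pt g)))
instance : Module.Finite k (Total B) :=
  inferInstanceAs (Module.Finite k (∀ g : G, B.obj (pt g)))

/-- The component of an element of the total space in the fiber over `g`. -/
def totalProj (g : G) : Total B →ₗ[k] B.obj (pt g) :=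
  LinearMap.proj (R := k) (φ := fun g : G => B.obj (pt g)) g

variable {B}

theorem total_ext {v w : Total B} (h : ∀ g, totalProj B g v = totalProj B g w) : v = w := funext h

open scoped Classical in
/-- The inclusion of a fiber in the total space. -/
def totalIncl (B : Bun k G) (g : G) : B.obj (pt g) →ₗ[k] Total B :=
  LinearMap.single k (fun g : G => B.obj (pt g)) g

theorem proj_incl_self (g : G) (v : B.obj (pt g)) : totalProj B g (totalIncl B g v) = v := by
  classical
  exact Pi.single_eq_same (M := fun g : G => B.obj (pt g)) g v

theorem proj_incl_ne {g h : G} (e : h ≠ g) (v : B.obj (pt g)) :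
    totalProj B h (totalIncl B g v) = 0 := by
  classical
  exact Pi.single_eq_of_ne (M := fun g : G => B.obj (pt g)) e v

/-- The morphism `h⁻¹ g h ⟶ g` of the action groupoid. -/
def conjHom' (h g : G) : pt (h⁻¹ * g * h) ⟶ pt g :=
  ⟨ConjAct.toConjAct h, by
    change h * (h⁻¹ * g * h) * h⁻¹ = g
    group⟩

/-- The source of a morphism with target `g` is determined by its group element, so two such
morphisms with the same group element coincide. Composing with `totalProj` allows sources that are
only propositionally equal, without transporting vectors between fibers. -/
theorem map_proj_congr {x x' g : G} (m : pt x ⟶ pt g) (m' : pt x' ⟶ pt g) (e : m.1 = m'.1)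
    (v : Total B) : flin (B.map m) (totalProj B x v) = flin (B.map m') (totalProj B x' v) := by
  have h : ConjAct.ofConjAct m.1 * x * (ConjAct.ofConjAct m.1)⁻¹ = g := m.2
  have h' : ConjAct.ofConjAct m'.1 * x' * (ConjAct.ofConjAct m'.1)⁻¹ = g := m'.2
  have hx : x = x' := by
    have h1 : ConjAct.ofConjAct m'.1 * x * (ConjAct.ofConjAct m'.1)⁻¹ = g := by rw [← e]; exact h
    exact mul_left_cancel (mul_right_cancel (h1.trans h'.symm))
  subst hx
  have : m = m' := Subtype.ext e
  rw [this]

/-- The action of `h` on the total space of a bundle. -/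
def totalAct (B : Bun k G) (h : G) : Total B →ₗ[k] Total B :=
  LinearMap.pi (φ := fun g : G => B.obj (pt g))
    fun g => flin (B.map (conjHom' h g)) ∘ₗ totalProj B (h⁻¹ * g * h)

/-- The definition of `totalAct` uses the source `h⁻¹ * g * h`; here any morphism with group element
`h` may replace it, with its source in whatever form it comes. -/
theorem proj_totalAct {x g : G} (m : pt x ⟶ pt g) (v : Total B) :
    totalProj B g (totalAct B (ConjAct.ofConjAct m.1) v) = flin (B.map m) (totalProj B x v) :=
  map_proj_congr (conjHom' (ConjAct.ofConjAct m.1) g) m rfl v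

theorem proj_totalAct' (h g : G) (v : Total B) :
    totalProj B g (totalAct B h v) = flin (B.map (conjHom' h g)) (totalProj B (h⁻¹ * g * h) v) := rfl

theorem flin_map_comp {p q r : ActionCategory (ConjAct G) G} (f : p ⟶ q) (f' : q ⟶ r)
    (v : B.obj p) : flin (B.map (f ≫ f')) v = flin (B.map f') (flin (B.map f) v) := by
  rw [B.map_comp]; rfl

/-- The total space of a bundle as a representation. -/
def totalRep (B : Bun k G) : FDRep k G :=
  FDRep.of (V := Total B)
    { toFun := totalAct B
      map_one' := LinearMap.ext fun v => total_ext fun g => by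
        -- The identity of `pt g` has group element `1`.
        refine (proj_totalAct (𝟙 (pt g)) v).trans ?_
        rw [B.map_id]
        rfl
      map_mul' := fun a b => LinearMap.ext fun v => total_ext fun g => by
        -- The composite has group element `a * b`, so multiplicativity is functoriality of `B`.
        refine (proj_totalAct (conjHom' b _ ≫ conjHom' a g) v).trans ?_
        rw [flin_map_comp]
        rfl }

/-- The first three conditions say that a product of vector spaces over the finite set `G` is their
direct sum. Equivariance holds because `h` maps the fiber over `g` to the fiber over `hgh⁻¹`. -/
theorem isGrading_total (B : Bun k G) : IsGrading (totalRep B)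
    (fun g => (totalIncl B g ∘ₗ totalProj B g : Total B →ₗ[k] Total B)) := by
  refine ⟨fun g v => ?_, fun g h v e => ?_, fun v => ?_, fun h g v => ?_⟩
  · exact congrArg (totalIncl B g) (proj_incl_self g (totalProj B g v))
  · exact (congrArg (totalIncl B g) (proj_incl_ne e (totalProj B h v))).trans (map_zero _)
  · refine total_ext fun g => ?_
    refine (map_sum (totalProj B g) (fun h => totalIncl B h (totalProj B h v)) _).trans ?_
    rw [Finset.sum_eq_single g]
    · exact proj_incl_self g _
    · intro h _ e
      exact proj_incl_ne e.symm _
    · simp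
  · refine total_ext fun x => ?_
    change totalProj B x (totalAct B h (totalIncl B g (totalProj B g v))) =
      totalProj B x (totalIncl B (h * g * h⁻¹) (totalProj B (h * g * h⁻¹) (totalAct B h v)))
    -- Over `hgh⁻¹` both sides are the image of the component of `v` at `g` under `B.map (conjHom h
    -- g)`; over any other point both vanish.
    by_cases e : x = h * g * h⁻¹
    · subst e
      rw [proj_incl_self]
      refine (proj_totalAct (conjHom h g) (totalIncl B g (totalProj B g v))).trans ?_
      rw [proj_incl_self]
      exact (proj_totalAct (conjHom h g) v).symm
    · rw [proj_incl_ne e, proj_totalAct', proj_incl_ne, map_zero]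
      rintro rfl
      exact e (by group)

/-- The total space of a bundle as an object of the center. -/
def totalCenter (B : Bun k G) : Center (FDRep k G) := (isGrading_total B).toCenter

/-- An element of the object of the center attached to a bundle as an element of the total space. -/
def ofC (B : Bun k G) : ob (totalCenter B) ≃ₗ[k] Total B := LinearEquiv.refl k (Total B)

theorem ofC_del (g : G) (x : ob (totalCenter B)) :
    ofC B (del (totalCenter B) g x) = totalIncl B g (totalProj B g (ofC B x)) :=
  LinearMap.congr_fun (toCenter_del (isGrading_total B) g) x

theorem ofC_ρ (h : G) (x : ob (totalCenter B)) :
    ofC B ((ob (totalCenter B)).ρ h x) = totalAct B h (ofC B x) := rfl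

end

/-! ### Elements of the fibers -/

section
variable {X Y : Center (FDRep k G)} {p q : ActionCategory (ConjAct G) G}

/-- `fibT` as a linear map. -/
def fibTL (X : Center (FDRep k G)) (p : ActionCategory (ConjAct G) G) :
    fibObj (TFG X) p.back →ₗ[k] ob X where
  toFun v := fibT X p v
  map_add' _ _ := rfl
  map_smul' r v := by
    change dgAct X (algebraMap k (DG k G) r) (fibT X p v) = r • fibT X p v
    rw [AlgHom.commutes]
    rfl

theorem prF_fibT (v : fibObj (TFG X) p.back) : prF X p (fibT X p v) = v :=
  fibT_injective X p (by rw [fibT_prF, del_fibT])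

theorem fibT_act (f : p ⟶ q) (v : fibObj (TFG X) p.back) :
    fibT X q (flin (fibAct (TFG X) f) v) = (ob X).ρ (ConjAct.ofConjAct f.1) (fibT X p v) :=
  dgAct_gEl _ _

end

/-- The fiber over `p` of the bundle of the object attached to a bundle `B` is the fiber of `B`. -/
def totalFiber (B : Bun k G) (p : ActionCategory (ConjAct G) G) :
    (fibBun (TFG (totalCenter B))).obj p ≅ B.obj p :=
  LinearEquiv.toFGModuleCatIso (R := k) (V := fibObj (TFG (totalCenter B)) p.back) (W := B.obj p)
    (LinearEquiv.ofLinearMap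
      -- The component of a vector over `p.back` lies in `B.obj (pt p.back)`, which is
      -- definitionally `B.obj p`. In the other direction a vector is placed in the total space and
      -- projected to the fiber.
      (totalProj B p.back ∘ₗ (ofC B).toLinearMap ∘ₗ fibTL (totalCenter B) p)
      (prF (totalCenter B) p ∘ₗ (ofC B).symm.toLinearMap ∘ₗ totalIncl B p.back)
      (LinearMap.ext fun v => by
        change totalProj B p.back (ofC B (fibT _ p (prF _ p ((ofC B).symm (totalIncl B p.back v))))) = v
        rw [fibT_prF, ofC_del, LinearEquiv.apply_symm_apply, proj_incl_self]
        exact proj_incl_self p.back v)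
      (LinearMap.ext fun v => fibT_injective _ p (by
        change fibT _ p (prF _ p ((ofC B).symm (totalIncl B p.back
          (totalProj B p.back (ofC B (fibT _ p v)))))) = _
        rw [← ofC_del, LinearEquiv.symm_apply_apply, fibT_prF, del_self, del_fibT]
        rfl)))

/-- Naturality of `totalFiber`: the action of `G` on the total space was built from the maps `B.map
f`. -/
theorem totalFiber_act (B : Bun k G) {p q : ActionCategory (ConjAct G) G} (f : p ⟶ q)
    (v : fibObj (TFG (totalCenter B)) p.back) :
    totalProj B q.back (ofC B (fibT (totalCenter B) q (flin (fibAct (TFG (totalCenter B)) f) v))) =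
      flin (B.map f) (totalProj B p.back (ofC B (fibT (totalCenter B) p v))) := by
  rw [fibT_act, ofC_ρ]
  exact proj_totalAct f _

/-- Every bundle comes from an object of the center. -/
def totalIso (B : Bun k G) : fibBun (TFG (totalCenter B)) ≅ B :=
  NatIso.ofComponents (totalFiber B) fun f => flin_ext (totalFiber_act B f)

/-! ### Essential surjectivity and the two equivalences. -/

instance fib_essSurj : (fib k G).EssSurj where
  mem_essImage B := ⟨TFG (totalCenter B), ⟨totalIso B⟩⟩

/-- The total space of the bundle of `M` has the same bundle as `M`; since `fib` is fully faithful,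
this isomorphism of bundles lifts to one of modules. -/
instance T_essSurj : (T k G).EssSurj where
  mem_essImage M := ⟨(totalCenter (fibBun M) : Center (FDRep k G)),
    ⟨(fib k G).preimageIso (totalIso (fibBun M))⟩⟩

instance fib_isEquivalence : (fib k G).IsEquivalence where
instance T_isEquivalence : (T k G).IsEquivalence where

end

section

/-! ### Evaluations in rigid categories -/

section
universe v₁ v₂ w₁ w₂
variable {C : Type w₁} [Category.{v₁} C] [MonoidalCategory C] [RightRigidCategory C]
variable {D : Type w₂} [Category.{v₂} D] [MonoidalCategory D] [RightRigidCategory D]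

/-- The abstract isomorphism between the dual of a tensor product and the reversed tensor product of
duals becomes computable through this formula: composed with evaluation, it is the nested
evaluation, with `X` inside and `Y` outside. -/
theorem rightDualTensorIso_inv_evaluation (X Y : C) :
    (rightDualTensorIso X Y).inv ▷ (X ⊗ Y) ≫ ε_ (X ⊗ Y) ((X ⊗ Y)ᘁ) =
      (α_ (Yᘁ) (Xᘁ) (X ⊗ Y)).hom ≫
        Yᘁ ◁ ((α_ (Xᘁ) X Y).inv ≫ ε_ X (Xᘁ) ▷ Y ≫ (λ_ Y).hom) ≫ ε_ Y (Yᘁ) := by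
  -- The inverse comparison is the mate of the identity of `X ⊗ Y`, where the source carries its
  -- chosen dual and the target carries `Yᘁ ⊗ Xᘁ` as dual.
  have h := @rightAdjointMate_comp_evaluation C _ _ (X ⊗ Y) (X ⊗ Y) inferInstance
    ⟨Yᘁ ⊗ Xᘁ⟩ (𝟙 (X ⊗ Y))
  refine h.trans ?_
  rw [MonoidalCategory.whiskerLeft_id, Category.id_comp]
  refine ExactPairing.tensor_evaluation.trans ?_
  monoidal

/-- The comparison is defined as a mate, so the adjunction turns its definition into a formula for
its composite with evaluation. Since evaluation detects functionals, this formula suffices to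
compute it. -/
theorem dualComparison_evaluation (F : C ⥤ D) [F.Monoidal] (X : C) :
    dualComparison F X ▷ F.obj X ≫ ε_ (F.obj X) ((F.obj X)ᘁ) =
      Functor.LaxMonoidal.μ F (Xᘁ) X ≫ F.map (ε_ X (Xᘁ)) ≫ Functor.OplaxMonoidal.η F := by
  apply (tensorRightHomEquiv (F.obj (Xᘁ)) (F.obj X) ((F.obj X)ᘁ) (𝟙_ D)).injective
  rw [tensorRightHomEquiv_whiskerRight_comp_evaluation, dualComparison, Category.assoc,
    Iso.hom_inv_id, Category.comp_id]

end

variable {k G : Type u} [Field k] [Group G] [Fintype G] [IsAlgClosed k] [CharZero k]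

/-! ### The pivotal structure of the center -/

section
variable {X Y : Center (FDRep k G)}

/-- The sum of the values of an element of the unit object. -/
def sumU (k G : Type u) [Field k] [Group G] [Fintype G] : ob (rU k G) →ₗ[k] k := ∑ g, cU g

theorem sumU_eU (g : G) : sumU k G (eU g) = 1 := by
  classical
  simp only [sumU, LinearMap.sum_apply, cU_eU, Finset.sum_ite_eq', Finset.mem_univ, if_true]

/-- The evaluation in the center takes values in functions on `G`. Summing these values gives back
the ordinary pairing because `∑ g, δ_g = id`, so identities about duals can be tested in `k`. -/
theorem sumU_rtEv (ξ : ob (rD X)) (x : ob X) : sumU k G (lin (und (rtEv X)) (ξ ⊡ x)) = apD X ξ x := by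
  rw [lin_rtEv, map_sum]
  simp only [map_smul, sumU_eU, smul_eq_mul, mul_one]
  rw [← map_sum, del_sum]

/-- The dual of a morphism. -/
def redMate {X Y : RedCenter k G} (f : X ⟶ Y) : Yᘁ ⟶ Xᘁ := fᘁ

theorem redMate_evaluation {X Y : RedCenter k G} (f : X ⟶ Y) :
    redMate f ▷ X ≫ ε_ X (Xᘁ) = (Yᘁ) ◁ f ≫ ε_ Y (Yᘁ) := rightAdjointMate_comp_evaluation f

/-- The comparison of the dual of a tensor product with the tensor product of the duals. -/
def redDual (X Y : RedCenter k G) : Yᘁ ⊗ Xᘁ ≅ (X ⊗ Y)ᘁ := (rightDualTensorIso X Y).symm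

theorem redDual_evaluation (X Y : RedCenter k G) :
    (redDual X Y).hom ▷ (X ⊗ Y) ≫ ε_ (X ⊗ Y) ((X ⊗ Y)ᘁ) =
      (α_ (Yᘁ) (Xᘁ) (X ⊗ Y)).hom ≫
        Yᘁ ◁ ((α_ (Xᘁ) X Y).inv ≫ ε_ X (Xᘁ) ▷ Y ≫ (λ_ Y).hom) ≫ ε_ Y (Yᘁ) :=
  rightDualTensorIso_inv_evaluation X Y

/-- The dual of a morphism, on objects of the center. -/
def rMate (f : X ⟶ Y) : rD Y ⟶ rD X := redMate (k := k) (G := G) (X := X) (Y := Y) f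

/-- A mate is characterized by its composite with evaluation. Applying `sumU` to that identity shows
that the dual of a morphism is the ordinary transpose. -/
theorem apD_rMate (f : X ⟶ Y) (ξ : ob (rD Y)) (x : ob X) :
    apD X (lin (und (rMate f)) ξ) x = apD Y ξ (lin (und f) x) := by
  -- Whiskerings and evaluations of the category `RedCenter` unfold to `rtHom` and `rtEv`, for which
  -- there are formulas on elements.
  have h : rtHom (rMate f) (𝟙 X) ≫ rtEv X = rtHom (𝟙 (rD Y)) f ≫ rtEv Y :=
    redMate_evaluation (k := k) (G := G) (X := X) (Y := Y) f
  have h1 := congrArg (fun q => sumU k G (lin (und q) (ξ ⊡ x))) h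
  simpa only [und_comp, lin_comp, LinearMap.comp_apply, lin_rtHom, und_id, lin_id,
    LinearMap.id_apply, sumU_rtEv] using h1

/-- The comparison of the dual of a reduced tensor product with the reduced tensor product of the
duals. -/
def rtDual (X Y : Center (FDRep k G)) : rt (rD Y) (rD X) ≅ rD (rt X Y) :=
  redDual (k := k) (G := G) X Y

/-- In the nested evaluation the inner pairing yields the function `g ↦ ξ (δ_g x)`, which acts on
`y` through the left unit constraint. Hence only components of equal degree are paired, and a sum
over `g` appears. -/
theorem apD_rtDual (η : ob (rD Y)) (ξ : ob (rD X)) (x : ob X) (y : ob Y) :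
    apD (rt X Y) (lin (und (rtDual X Y).hom) (η ⊡ ξ)) (x ⊡ y) =
      ∑ g, apD X ξ (del X g x) * apD Y η (del Y g y) := by
  have h : rtHom (rtDual X Y).hom (𝟙 (rt X Y)) ≫ rtEv (rt X Y) =
      (rtAssoc (rD Y) (rD X) (rt X Y)).hom ≫
        rtHom (𝟙 (rD Y)) ((rtAssoc (rD X) X Y).inv ≫ rtHom (rtEv X) (𝟙 Y) ≫
          (rtLeftUnitor Y).hom) ≫ rtEv Y :=
    redDual_evaluation (k := k) (G := G) X Y
  have h1 := congrArg (fun q => sumU k G (lin (und q) (η ⊡ ξ ⊡ (x ⊡ y)))) h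
  simp only [und_comp, lin_comp, LinearMap.comp_apply, lin_rtHom, und_id, lin_id,
    LinearMap.id_apply, sumU_rtEv, lin_rtAssoc_hom, lin_rtAssoc_inv] at h1
  rw [h1]
  simp only [lin_rtEv, map_sum, map_smul, LinearMap.sum_apply, LinearMap.smul_apply,
    lin_rtLeftUnitor_hom, sum_cU_eU, smul_eq_mul]

/-- Paired with `ξ`, both sides give `ξ (f x)`: the double transpose moves `f` from the functional
back to the vector. -/
theorem pivH_naturality (f : X ⟶ Y) : f ≫ pivH Y = pivH X ≫ rMate (rMate f) :=
  ob_ext fun x => apD_ext fun ξ => by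
    simp only [und_comp, lin_comp, LinearMap.comp_apply, lin_pivH, apD_rMate]

/-- Tested on `x ⊡ y` and `η ⊡ ξ`, each side is `∑ g, ξ (δ_g x) * η (δ_g y)` up to the order of the
factors. On the right-hand side the projections fall on the functionals, and `apD_del` moves them to
the vectors. -/
theorem pivH_tensor (X Y : Center (FDRep k G)) :
    pivH (rt X Y) ≫ rMate (rtDual X Y).hom ≫ (rtDual (rD Y) (rD X)).inv =
      rtHom (pivH X) (pivH Y) := by
  -- `apD_rtDual` computes the comparison in the direction `hom`, so the inverse is cleared.
  rw [← Category.assoc, Iso.comp_inv_eq]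
  refine rt_hom_ext fun x y => apD_ext fun t => LinearMap.congr_fun
    (f := apD _ _) (g := apD _ _) (rp_ext fun η ξ => ?_) t
  simp only [und_comp, lin_comp, LinearMap.comp_apply, apD_rMate, lin_pivH, apD_rtDual, lin_rtHom,
    apD_del, mul_comm]

theorem pivH_bijective (X : Center (FDRep k G)) : Function.Bijective (lin (und (pivH X))) :=
  Module.bijective_dual_eval k (ob X)

/-- A bijective morphism of the center is an isomorphism. -/
theorem isIso_of_bijective (f : X ⟶ Y) (h : Function.Bijective (lin (und f))) : IsIso f := by
  let e : ob X ≃ₗ[k] ob Y := LinearEquiv.ofBijective (lin (und f)) h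
  have he : ∀ x, lin (und f) x = e x := fun x => rfl
  have hi : ∀ y, lin (und f) (e.symm y) = y := fun y => e.apply_symm_apply y
  -- Equivariance and compatibility with gradings of the inverse are tested after applying `f`,
  -- which is injective and has both properties.
  refine ⟨homOfDel (mkHom e.symm.toLinearMap fun g y => h.1 ?_) fun g y => h.1 ?_, ?_, ?_⟩
  · rw [lin_ρ]
    exact (hi _).trans (congrArg _ (hi _).symm)
  · rw [und_del]
    exact (hi _).trans (congrArg _ (hi _).symm)
  · exact ob_ext fun x => e.symm_apply_apply x
  · exact ob_ext fun y => hi y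

theorem isPivotal_zpiv : IsPivotal (zpiv (k := k) (G := G)) where
  isIso X := isIso_of_bijective (k := k) (G := G) (pivH X) (pivH_bijective X)
  naturality {X Y} f := pivH_naturality (k := k) (G := G) (X := X) (Y := Y) f
  tensor X Y := pivH_tensor (k := k) (G := G) X Y

end

end

section
variable {k G : Type u} [Field k] [Group G]

/-! ### The pivotal structure of bundles -/

/-- The linear map on the fibers over `p` underlying a morphism of bundles. -/
def blin {V W : Bun k G} (f : V ⟶ W) (p : ActionCategory (ConjAct G) G) : V.obj p →ₗ[k] W.obj p :=
  flin (f.app p)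

theorem blin_ext {V W : Bun k G} {f g : V ⟶ W} (h : ∀ p v, blin f p v = blin g p v) : f = g :=
  NatTrans.ext (funext fun p => flin_ext (h p))

/-- The application of a functional on a fiber. -/
def bap (V : Bun k G) (p : ActionCategory (ConjAct G) G) : (Vᘁ).obj p →ₗ[k] V.obj p →ₗ[k] k :=
  vap (V.obj p)

theorem bap_ext {V : Bun k G} {p : ActionCategory (ConjAct G) G} {ξ ξ' : (Vᘁ).obj p}
    (h : ∀ v, bap V p ξ v = bap V p ξ' v) : ξ = ξ' := vap_ext h

/-- The elementary tensors in a fiber of a tensor product of bundles. -/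
def btm (V W : Bun k G) (p : ActionCategory (ConjAct G) G) :
    V.obj p →ₗ[k] W.obj p →ₗ[k] (V ⊗ W).obj p := vtm (V.obj p) (W.obj p)

theorem btm_ext {V W : Bun k G} {p : ActionCategory (ConjAct G) G} {U : Type*} [AddCommMonoid U]
    [Module k U] {f g : (V ⊗ W).obj p →ₗ[k] U}
    (h : ∀ v w, f (btm V W p v w) = g (btm V W p v w)) : f = g :=
  TensorProduct.ext' (R := k) (M := V.obj p) (N := W.obj p) h

@[simp] theorem blin_comp {U V W : Bun k G} (f : U ⟶ V) (g : V ⟶ W)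
    (p : ActionCategory (ConjAct G) G) (u : U.obj p) :
    blin (f ≫ g) p u = blin g p (blin f p u) := rfl
@[simp] theorem blin_whiskerRight {V W : Bun k G} (f : V ⟶ W) (U : Bun k G)
    (p : ActionCategory (ConjAct G) G) (v : V.obj p) (u : U.obj p) :
    blin (f ▷ U) p (btm V U p v u) = btm W U p (blin f p v) u := rfl
@[simp] theorem blin_whiskerLeft {V W : Bun k G} (f : V ⟶ W) (U : Bun k G)
    (p : ActionCategory (ConjAct G) G) (v : V.obj p) (u : U.obj p) :
    blin (U ◁ f) p (btm U V p u v) = btm U W p u (blin f p v) := rfl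
@[simp] theorem blin_tensorHom {V W V' W' : Bun k G} (f : V ⟶ W) (g : V' ⟶ W')
    (p : ActionCategory (ConjAct G) G) (v : V.obj p) (v' : V'.obj p) :
    blin (f ⊗ₘ g) p (btm V V' p v v') = btm W W' p (blin f p v) (blin g p v') := rfl
@[simp] theorem blin_assoc {U V W : Bun k G} (p : ActionCategory (ConjAct G) G) (u : U.obj p)
    (v : V.obj p) (w : W.obj p) : blin (α_ U V W).hom p (btm _ _ p (btm _ _ p u v) w) =
      btm _ _ p u (btm _ _ p v w) := rfl
@[simp] theorem blin_assoc_inv {U V W : Bun k G} (p : ActionCategory (ConjAct G) G) (u : U.obj p)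
    (v : V.obj p) (w : W.obj p) : blin (α_ U V W).inv p (btm _ _ p u (btm _ _ p v w)) =
      btm _ _ p (btm _ _ p u v) w := rfl

/-- A scalar as an element of a fiber of the unit bundle. -/
def bun (p : ActionCategory (ConjAct G) G) (c : k) : (𝟙_ (Bun k G)).obj p := (c : k)

theorem bun_injective (p : ActionCategory (ConjAct G) G) : Function.Injective (bun (k := k) p) :=
  fun _ _ h => h

@[simp] theorem blin_leftUnitor {V : Bun k G} (p : ActionCategory (ConjAct G) G) (c : k)
    (v : V.obj p) : blin (λ_ V).hom p (btm _ _ p (bun p c) v) = c • v := rfl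
@[simp] theorem blin_rightUnitor {V : Bun k G} (p : ActionCategory (ConjAct G) G) (c : k)
    (v : V.obj p) : blin (ρ_ V).hom p (btm _ _ p v (bun p c)) = c • v := rfl
@[simp] theorem blin_evaluation {V : Bun k G} (p : ActionCategory (ConjAct G) G)
    (ξ : (Vᘁ).obj p) (v : V.obj p) : blin (ε_ V (Vᘁ)) p (btm _ _ p ξ v) = bun p (bap V p ξ v) := rfl
@[simp] theorem bap_bpiv {V : Bun k G} (p : ActionCategory (ConjAct G) G) (v : V.obj p)
    (ξ : (Vᘁ).obj p) : bap (Vᘁ) p (blin (bpiv V) p v) ξ = bap V p ξ v := rfl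

/-- As in the center, evaluation characterizes the mate; here it is scalar valued on each fiber, so
the transpose appears without any summation. -/
theorem bap_mate {V W : Bun k G} (f : V ⟶ W) (p : ActionCategory (ConjAct G) G) (ξ : (Wᘁ).obj p)
    (v : V.obj p) : bap V p (blin (fᘁ) p ξ) v = bap W p ξ (blin f p v) :=
  congrArg (fun q => blin q p (btm (Wᘁ) V p ξ v)) (rightAdjointMate_comp_evaluation f)

/-- On one fiber the nested evaluation is a product of two scalars; this is the single-degree
analogue of `apD_rtDual`. -/
theorem bap_rightDualTensorIso_inv (V W : Bun k G) (p : ActionCategory (ConjAct G) G)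
    (η : (Wᘁ).obj p) (ξ : (Vᘁ).obj p) (v : V.obj p) (w : W.obj p) :
    bap (V ⊗ W) p (blin (rightDualTensorIso V W).inv p (btm _ _ p η ξ)) (btm _ _ p v w) =
      bap V p ξ v * bap W p η w := by
  have h := congrArg (fun q => blin q p (btm _ _ p (btm _ _ p η ξ) (btm _ _ p v w)))
    (rightDualTensorIso_inv_evaluation V W)
  simp only [blin_comp, blin_whiskerRight, blin_evaluation, blin_assoc, blin_whiskerLeft,
    blin_assoc_inv, blin_leftUnitor] at h
  rw [bun_injective p h, map_smul, smul_eq_mul]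

/-- All three conditions hold fiber by fiber: finite dimensional spaces are reflexive, and the two
identities follow by pairing with functionals. -/
theorem isPivotal_bpiv : IsPivotal (bpiv (k := k) (G := G)) where
  isIso V := by
    have (p : ActionCategory (ConjAct G) G) : IsIso ((bpiv V).app p) :=
      inferInstanceAs (IsIso (LinearEquiv.toFGModuleCatIso (Module.evalEquiv k (V.obj p))).hom)
    exact NatIso.isIso_of_isIso_app _
  naturality f := blin_ext fun p v => bap_ext fun ξ => by
    simp only [blin_comp, bap_bpiv, bap_mate]
  tensor V W := by
    -- The formula available is for the inverse of `rightDualTensorIso`, so its `hom` is moved to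
    -- the other side.
    rw [← Category.assoc, ← Iso.eq_comp_inv]
    refine blin_ext fun p t => LinearMap.congr_fun (f := blin _ p) (g := blin _ p)
      (btm_ext fun v w => bap_ext fun t => ?_) t
    refine LinearMap.congr_fun (f := bap _ p _) (g := bap _ p _) (btm_ext fun η ξ => ?_) t
    simp only [blin_comp, bap_mate, bap_bpiv, bap_rightDualTensorIso_inv, blin_tensorHom, mul_comm]

end

section
variable {k G : Type u} [Field k] [Group G] [Fintype G]

/-! ### The fibers of the bundle of an object of the center -/

/-- The bundle of an object of the center. -/
def bunT (X : Center (FDRep k G)) : Bun k G := fibBun (TFG X)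

/-- The inclusion of a fiber of the bundle of `X` in `X`. -/
def fel (X : Center (FDRep k G)) (p : ActionCategory (ConjAct G) G) :
    (bunT X).obj p →ₗ[k] ob X := fibTL X p

/-- The projection of `X` onto a fiber. -/
def fpr (X : Center (FDRep k G)) (p : ActionCategory (ConjAct G) G) :
    ob X →ₗ[k] (bunT X).obj p := prF X p

/-- The map of bundles attached to a morphism of the center. -/
def bunMap {X Y : Center (FDRep k G)} (f : X ⟶ Y) : bunT X ⟶ bunT Y := (fib k G).map (TFGMap f)

section
variable {X Y Z : Center (FDRep k G)} {p q : ActionCategory (ConjAct G) G}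

theorem fel_injective : Function.Injective (fel X p) := fibT_injective X p
theorem fel_fpr (x : ob X) : fel X p (fpr X p x) = del X p.back x := fibT_prF p x
theorem fpr_fel (v : (bunT X).obj p) : fpr X p (fel X p v) = v := prF_fibT v
theorem del_fel (v : (bunT X).obj p) : del X p.back (fel X p v) = fel X p v := del_fibT X p v
theorem del_fel_ne {g : G} (h : g ≠ p.back) (v : (bunT X).obj p) : del X g (fel X p v) = 0 := by
  rw [← del_fel, del_ne _ _ _ h]
theorem fel_map (f : p ⟶ q) (v : (bunT X).obj p) :
    fel X q (flin ((bunT X).map f) v) = (ob X).ρ (ConjAct.ofConjAct f.1) (fel X p v) :=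
  fibT_act f v
theorem fel_bunMap (f : X ⟶ Y) (v : (bunT X).obj p) :
    fel Y p (blin (bunMap f) p v) = lin (und f) (fel X p v) := rfl

/-- A sum over the graded pieces of an element of a fiber has a single term. -/
theorem sum_del_fel {V : Type*} [AddCommMonoid V] (F : G → ob X → V) (h : ∀ g, F g 0 = 0)
    (v : (bunT X).obj p) : ∑ g, F g (del X g (fel X p v)) = F p.back (fel X p v) := by
  rw [Finset.sum_eq_single p.back]
  · rw [del_fel]
  · intro g _ e
    rw [del_fel_ne e, h]
  · simp

/-- A linear map as a morphism of finite dimensional vector spaces. -/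
def vHom {V W : FGModuleCat.{u} k} (f : V →ₗ[k] W) : V ⟶ W :=
  InducedCategory.homMk (ModuleCat.ofHom f)

theorem flin_comp {U V W : FGModuleCat.{u} k} (f : U ⟶ V) (g : V ⟶ W) (u : U) :
    flin (f ≫ g) u = flin g (flin f u) := rfl

/-- A linear map out of a fiber of a tensor product of bundles. -/
def btmLift {V W : Bun k G} {U : Type u} [AddCommGroup U] [Module k U]
    (f : V.obj p →ₗ[k] W.obj p →ₗ[k] U) : (V ⊗ W).obj p →ₗ[k] U :=
  TensorProduct.lift (R := k) (M := V.obj p) (N := W.obj p) f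

@[simp] theorem btmLift_btm {V W : Bun k G} {U : Type u} [AddCommGroup U] [Module k U]
    (f : V.obj p →ₗ[k] W.obj p →ₗ[k] U) (v : V.obj p) (w : W.obj p) :
    btmLift f (btm V W p v w) = f v w :=
  TensorProduct.lift.tmul (R := k) (M := V.obj p) (N := W.obj p) v w

theorem btm_map {V W : Bun k G} (f : p ⟶ q) (v : V.obj p) (w : W.obj p) :
    flin ((V ⊗ W).map f) (btm V W p v w) = btm V W q (flin (V.map f) v) (flin (W.map f) w) := rfl

theorem bun_map (f : p ⟶ q) (c : k) : flin ((𝟙_ (Bun k G)).map f) (bun p c) = bun q c := rfl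

/-- A linear map out of a fiber of the unit bundle. -/
def bunLift {U : Type u} [AddCommGroup U] [Module k U] (p : ActionCategory (ConjAct G) G) (v : U) :
    (𝟙_ (Bun k G)).obj p →ₗ[k] U := LinearMap.toSpanSingleton k U v

@[simp] theorem bunLift_bun {U : Type u} [AddCommGroup U] [Module k U] (v : U) (c : k) :
    bunLift (G := G) p v (bun p c) = c • v := rfl

theorem bun_ext {U : Type*} [AddCommMonoid U] [Module k U] {f g : (𝟙_ (Bun k G)).obj p →ₗ[k] U}
    (h : f (bun p 1) = g (bun p 1)) : f = g := LinearMap.ext_ring (R := k) h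

/-- A scalar as an element of a fiber of the unit bundle, as a linear map. -/
def bunL (p : ActionCategory (ConjAct G) G) : k →ₗ[k] (𝟙_ (Bun k G)).obj p :=
  LinearMap.id (R := k) (M := k)

@[simp] theorem bunL_apply (c : k) : bunL (G := G) p c = bun p c := rfl

/-! ### The tensor structure -/

/-- The unit constraint on fibers: a scalar is sent to the multiple of the delta function. -/
def unitFiber (k G : Type u) [Field k] [Group G] [Fintype G] (p : ActionCategory (ConjAct G) G) :
    (𝟙_ (Bun k G)).obj p ≅ (bunT (rU k G)).obj p where
  hom := vHom (bunLift p (fpr (rU k G) p (oneU k G)))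
  inv := vHom (bunL p ∘ₗ cU p.back ∘ₗ fel (rU k G) p)
  hom_inv_id := flin_ext fun v => LinearMap.congr_fun
    (f := (bunL p ∘ₗ cU p.back ∘ₗ fel (rU k G) p) ∘ₗ bunLift p (fpr (rU k G) p (oneU k G)))
    (g := LinearMap.id) (bun_ext (by
      classical
      simp only [LinearMap.comp_apply, bunLift_bun, one_smul, fel_fpr, del_oneU, cU_eU, if_true,
        bunL_apply, LinearMap.id_apply])) v
  inv_hom_id := flin_ext fun v => fel_injective (by
    change fel _ p (bunLift p _ (bunL p (cU p.back (fel (rU k G) p v)))) = fel _ p v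
    -- Over `g = p.back`, the vector `e (g) • eU g` is `δ_g e`, and `δ_g` fixes the vectors of its
    -- fiber.
    rw [bunL_apply, bunLift_bun, map_smul, fel_fpr, del_oneU, ← eU_del, del_fel])

theorem fel_unitFiber (c : k) :
    fel (rU k G) p (flin (unitFiber k G p).hom (bun p c)) = c • eU p.back := by
  change fel _ p (bunLift p (fpr (rU k G) p (oneU k G)) (bun p c)) = _
  rw [bunLift_bun, map_smul, fel_fpr, del_oneU]

/-- The unit constraint. -/
def unitIso (k G : Type u) [Field k] [Group G] [Fintype G] : 𝟙_ (Bun k G) ≅ bunT (rU k G) :=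
  NatIso.ofComponents (unitFiber k G) fun {p _} f => flin_ext fun c => fel_injective (by
    obtain ⟨c, rfl⟩ : ∃ c' : k, bun p c' = c := ⟨c, rfl⟩
    rw [flin_comp, flin_comp, bun_map, fel_unitFiber, fel_map, fel_unitFiber, map_smul, eU_ρ]
    congr 2
    -- The defining property of a morphism `f : p ⟶ q` is that its group element conjugates `p.back`
    -- to `q.back`.
    exact f.2.symm)

@[simp] theorem fel_unitIso (c : k) :
    fel (rU k G) p (blin (unitIso k G).hom p (bun p c)) = c • eU p.back := fel_unitFiber c

@[simp] theorem unitIso_inv (v : (bunT (rU k G)).obj p) :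
    blin (unitIso k G).inv p v = bun p (cU p.back (fel (rU k G) p v)) := rfl

variable [IsAlgClosed k] [CharZero k]

/-- The tensor constraint on fibers, `v ⊗ w ↦ v ⊗ w`. -/
def tensorFiberHom (X Y : Center (FDRep k G)) (p : ActionCategory (ConjAct G) G) :
    (bunT X ⊗ bunT Y).obj p →ₗ[k] (bunT (rt X Y)).obj p :=
  btmLift (((rpL X Y).compl₁₂ (fel X p) (fel Y p)).compr₂ (fpr (rt X Y) p))

-- The projection `fpr` in `tensorFiberHom` changes nothing, since `δ_g` acts on `x ⊡ y` through
-- `x`, which already lies in the fiber.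
@[simp] theorem fel_tensorFiberHom (v : (bunT X).obj p) (w : (bunT Y).obj p) :
    fel (rt X Y) p (tensorFiberHom X Y p (btm _ _ p v w)) = fel X p v ⊡ fel Y p w := by
  simp only [tensorFiberHom, btmLift_btm, LinearMap.compr₂_apply, LinearMap.compl₁₂_apply, fel_fpr,
    rp_del, del_fel]

/-- The projection of `X ⊗ Y` onto `X_g ⊗ Y_g`. -/
def tensorFiberProj (X Y : Center (FDRep k G)) (p : ActionCategory (ConjAct G) G) :
    (ob X ⊗ ob Y : FDRep k G) →ₗ[k] (bunT X ⊗ bunT Y).obj p :=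
  tmLift ((btm (bunT X) (bunT Y) p).compl₁₂ (fpr X p) (fpr Y p))

@[simp] theorem tensorFiberProj_tm (x : ob X) (y : ob Y) :
    tensorFiberProj X Y p (x ⊠ y) = btm _ _ p (fpr X p x) (fpr Y p y) := by
  simp only [tensorFiberProj, tmLift_tm, LinearMap.compl₁₂_apply]

/-- On `x ⊠ y` the left side is `δ_g x ⊡ δ_g y`; balancing and idempotence turn this into `δ_g x ⊡ y
= δ_g (x ⊡ y)`. It shows that `tensorFiberHom` reaches every element of the fiber. -/
theorem fel_tensorFiberProj (t : (ob X ⊗ ob Y : FDRep k G)) :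
    fel (rt X Y) p (tensorFiberHom X Y p (tensorFiberProj X Y p t)) =
      del (rt X Y) p.back (lin (rπ X Y) t) := by
  refine LinearMap.congr_fun
    (f := fel (rt X Y) p ∘ₗ tensorFiberHom X Y p ∘ₗ tensorFiberProj X Y p)
    (g := del (rt X Y) p.back ∘ₗ lin (rπ X Y)) (tm_ext fun x y => ?_) t
  simp only [LinearMap.comp_apply, tensorFiberProj_tm, fel_tensorFiberHom, fel_fpr, lin_rπ, rp_del]
  rw [← rp_bal, del_self]

/-- Of the sum `∑ h, δ_h x ⊠ δ_h y` only the term `h = p.back` remains for vectors of the fibers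
over `p`. So the elementary tensors of `X_g ⊗ Y_g` lie in the image of `Q` and are left unchanged by
it, which is why the tensor constraint is `v ⊗ w ↦ v ⊗ w`. -/
theorem lin_rι_fel (v : (bunT X).obj p) (w : (bunT Y).obj p) :
    lin (rι X Y) (fel X p v ⊡ fel Y p w) = fel X p v ⊠ fel Y p w := by
  rw [lin_rι, sum_del_fel (fun g x => x ⊠ del Y g (fel Y p w)), del_fel]
  intro g
  rw [map_zero, LinearMap.zero_apply]

/-- The tensor constraint on fibers, as an isomorphism. -/
def tensorFiber (X Y : Center (FDRep k G)) (p : ActionCategory (ConjAct G) G) :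
    (bunT X ⊗ bunT Y).obj p ≅ (bunT (rt X Y)).obj p where
  hom := vHom (tensorFiberHom X Y p)
  inv := vHom (tensorFiberProj X Y p ∘ₗ lin (rι X Y) ∘ₗ fel (rt X Y) p)
  hom_inv_id := flin_ext fun t => LinearMap.congr_fun
    (f := (tensorFiberProj X Y p ∘ₗ lin (rι X Y) ∘ₗ fel (rt X Y) p) ∘ₗ tensorFiberHom X Y p)
    (g := LinearMap.id) (btm_ext fun v w => by
      simp only [LinearMap.comp_apply, fel_tensorFiberHom, lin_rι_fel, tensorFiberProj_tm, fpr_fel,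
        LinearMap.id_apply]) t
  inv_hom_id := flin_ext fun t => fel_injective (by
    change fel _ p (tensorFiberHom X Y p (tensorFiberProj X Y p
      (lin (rι X Y) (fel (rt X Y) p t)))) = fel _ p t
    -- `rπ` undoes `rι` because `Q` is the identity on its image.
    rw [fel_tensorFiberProj, lin_rπ_rι, del_fel])

theorem tensorFiber_natural (f : p ⟶ q) (t : (bunT X ⊗ bunT Y).obj p) :
    fel (rt X Y) q (tensorFiberHom X Y q (flin ((bunT X ⊗ bunT Y).map f) t)) =
      fel (rt X Y) q (flin ((bunT (rt X Y)).map f) (tensorFiberHom X Y p t)) :=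
  LinearMap.congr_fun
    (f := fel (rt X Y) q ∘ₗ tensorFiberHom X Y q ∘ₗ flin ((bunT X ⊗ bunT Y).map f))
    (g := fel (rt X Y) q ∘ₗ flin ((bunT (rt X Y)).map f) ∘ₗ tensorFiberHom X Y p)
    (btm_ext fun v w => by
      simp only [LinearMap.comp_apply, btm_map, fel_tensorFiberHom, fel_map, rp_ρ]) t

/-- The tensor constraint. -/
def tensorIso (X Y : Center (FDRep k G)) : bunT X ⊗ bunT Y ≅ bunT (rt X Y) :=
  NatIso.ofComponents (tensorFiber X Y) fun f => flin_ext fun t =>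
    fel_injective (tensorFiber_natural f t)

@[simp] theorem fel_tensorIso (v : (bunT X).obj p) (w : (bunT Y).obj p) :
    fel (rt X Y) p (blin (tensorIso X Y).hom p (btm _ _ p v w)) = fel X p v ⊡ fel Y p w :=
  fel_tensorFiberHom v w

/-! ### Naturality and coherence of the tensor constraint. -/

theorem btm_hom_ext {U V W : Bun k G} {f g : V ⊗ W ⟶ U}
    (h : ∀ p v w, blin f p (btm _ _ p v w) = blin g p (btm _ _ p v w)) : f = g :=
  blin_ext fun p t => LinearMap.congr_fun (f := blin f p) (g := blin g p) (btm_ext (h p)) t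

theorem btm_hom_ext₃ {U V W S : Bun k G} {f g : (V ⊗ W) ⊗ S ⟶ U}
    (h : ∀ p v w s, blin f p (btm _ _ p (btm _ _ p v w) s) =
      blin g p (btm _ _ p (btm _ _ p v w) s)) : f = g :=
  btm_hom_ext fun p t s => LinearMap.congr_fun (f := blin f p ∘ₗ (btm _ _ p).flip s)
    (g := blin g p ∘ₗ (btm _ _ p).flip s) (btm_ext fun v w => h p v w s) t

theorem tensorIso_natural_left {X' : Center (FDRep k G)} (f : X ⟶ X') :
    bunMap f ▷ bunT Y ≫ (tensorIso X' Y).hom = (tensorIso X Y).hom ≫ bunMap (rtHom f (𝟙 Y)) :=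
  btm_hom_ext fun p v w => fel_injective (by
    simp only [blin_comp, blin_whiskerRight, fel_tensorIso, fel_bunMap, lin_rtHom, und_id, lin_id,
      LinearMap.id_apply])

theorem tensorIso_natural_right {Y' : Center (FDRep k G)} (f : Y ⟶ Y') :
    bunT X ◁ bunMap f ≫ (tensorIso X Y').hom = (tensorIso X Y).hom ≫ bunMap (rtHom (𝟙 X) f) :=
  btm_hom_ext fun p v w => fel_injective (by
    simp only [blin_comp, blin_whiskerLeft, fel_tensorIso, fel_bunMap, lin_rtHom, und_id, lin_id,
      LinearMap.id_apply])

/-- Both composites send `x ⊗ y ⊗ z` to `x ⊡ (y ⊡ z)`, as the associator of the reduced product only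
moves brackets on elementary tensors. -/
theorem tensorIso_assoc (X Y Z : Center (FDRep k G)) :
    (tensorIso X Y).hom ▷ bunT Z ≫ (tensorIso (rt X Y) Z).hom ≫ bunMap (rtAssoc X Y Z).hom =
      (α_ (bunT X) (bunT Y) (bunT Z)).hom ≫ bunT X ◁ (tensorIso Y Z).hom ≫
        (tensorIso X (rt Y Z)).hom :=
  btm_hom_ext₃ fun p x y z => fel_injective (by
    simp only [blin_comp, blin_whiskerRight, blin_whiskerLeft, blin_assoc, fel_tensorIso,
      fel_bunMap, lin_rtAssoc_hom])

/-- The scalar `c` becomes `c • eU g` over `g = p.back`, and `eU g` acts on `X` as `δ_g`, which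
fixes `v`. -/
theorem tensorIso_leftUnitor (X : Center (FDRep k G)) :
    (λ_ (bunT X)).hom = (unitIso k G).hom ▷ bunT X ≫ (tensorIso (rU k G) X).hom ≫
      bunMap (rtLeftUnitor X).hom :=
  btm_hom_ext fun p c v => fel_injective (by
    obtain ⟨c, rfl⟩ : ∃ c' : k, bun p c' = c := ⟨c, rfl⟩
    simp only [blin_comp, blin_whiskerRight, blin_leftUnitor, fel_tensorIso, fel_bunMap,
      fel_unitIso, map_smul, LinearMap.smul_apply, lin_rtLeftUnitor_hom, sum_cU_eU, del_fel])

theorem tensorIso_rightUnitor (X : Center (FDRep k G)) :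
    (ρ_ (bunT X)).hom = bunT X ◁ (unitIso k G).hom ≫ (tensorIso X (rU k G)).hom ≫
      bunMap (rtRightUnitor X).hom :=
  btm_hom_ext fun p v c => fel_injective (by
    obtain ⟨c, rfl⟩ : ∃ c' : k, bun p c' = c := ⟨c, rfl⟩
    simp only [blin_comp, blin_whiskerLeft, blin_rightUnitor, fel_tensorIso, fel_bunMap,
      fel_unitIso, map_smul, lin_rtRightUnitor_hom, sum_cU_eU, del_fel])

end

variable (k G) in
/-- The data of the tensor structure. -/
def coreMonoidal [IsAlgClosed k] [CharZero k] : (T k G ⋙ fib k G).CoreMonoidal where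
  εIso := unitIso k G
  μIso X Y := tensorIso (k := k) (G := G) X Y
  μIso_hom_natural_left {X Y} f X' :=
    tensorIso_natural_left (k := k) (G := G) (X := X) (X' := Y) (Y := X') f
  μIso_hom_natural_right {X Y} X' f :=
    tensorIso_natural_right (k := k) (G := G) (X := X') (Y := X) (Y' := Y) f
  associativity X Y Z := tensorIso_assoc (k := k) (G := G) X Y Z
  left_unitality X := tensorIso_leftUnitor (k := k) (G := G) X
  right_unitality X := tensorIso_rightUnitor (k := k) (G := G) X

/-! ### The tensor structure of the composite functor and its compatibility with the pivotal
structures. -/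

section
variable [IsAlgClosed k] [CharZero k]

/-- The tensor structure of the functor from `(Z(Rep G), ⊗̄)` to bundles. -/
instance tensorStructure : (T k G ⋙ fib k G).Monoidal := (coreMonoidal k G).toMonoidal

theorem isFiberwise_tensorStructure : IsFiberwise k G tensorStructure := fun X Y _ v w =>
  -- The constraint yields `v ⊡ w`, whose image under the inclusion into `X ⊗ Y` is `v ⊠ w` by
  -- `lin_rι_fel`.
  (congrArg (lin (rι (k := k) (G := G) X Y)) (fel_tensorIso (k := k) (G := G) v w)).trans
    (lin_rι_fel (k := k) (G := G) v w)

/-- The comparison of duals, on objects of the center. -/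
def dualT (X : Center (FDRep k G)) : bunT (rD X) ⟶ (bunT X)ᘁ :=
  dualComparison (T k G ⋙ fib k G) (X : RedCenter k G)

/-- By `dualComparison_evaluation` the pairing is the value over `p` of the function `g ↦ ξ (δ_g
v)`. As `v` lies in the fiber over `p`, this value is `ξ v`, so the comparison of duals restricts
functionals to the fiber. -/
theorem bap_dualT (X : Center (FDRep k G)) (p : ActionCategory (ConjAct G) G)
    (ξ : (bunT (rD X)).obj p) (v : (bunT X).obj p) :
    bap (bunT X) p (blin (dualT X) p ξ) v = apD X (fel (rD X) p ξ) (fel X p v) := by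
  have h : dualT X ▷ bunT X ≫ ε_ (bunT X) ((bunT X)ᘁ) =
      (tensorIso (rD X) X).hom ≫ bunMap (rtEv X) ≫ (unitIso k G).inv :=
    dualComparison_evaluation (T k G ⋙ fib k G) (X : RedCenter k G)
  have h1 := congrArg (fun q => blin q p (btm _ _ p ξ v)) h
  simp only [blin_comp, blin_whiskerRight, blin_evaluation, unitIso_inv, fel_bunMap,
    fel_tensorIso, lin_rtEv] at h1
  rw [bun_injective p h1, sum_del_fel (fun g x => apD X (fel (rD X) p ξ) x • (eU g : ob (rU k G))),
    map_smul]
  · classical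
    rw [cU_eU, if_pos rfl, smul_eq_mul, mul_one]
  · intro g
    rw [map_zero, zero_smul]

/-- Applied to `v` and paired with `ξ`, both composites give the pairing of `ξ` with `v` in `X`. -/
theorem pivH_dualT (X : Center (FDRep k G)) :
    bunMap (pivH X) ≫ dualT (rD X) = bpiv (bunT X) ≫ (dualT X)ᘁ :=
  blin_ext fun p v => bap_ext fun ξ => by
    simp only [blin_comp, bap_mate, bap_bpiv, bap_dualT, fel_bunMap, lin_pivH]

theorem preservesPivotal_tensorStructure :
    PreservesPivotal (T k G ⋙ fib k G) zpiv bpiv := fun X => pivH_dualT (k := k) (G := G) X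

end

end

end DR
end

/-- The reduced tensor product, duals and pivotal structure of `D(G)`-modules are those of their
bundles, so the tensor and pivotal statements concern `T ⋙ fib`. As `fib` is an equivalence, nothing
is lost in passing from modules to bundles. -/
theorem theoremt (k G : Type u) [Field k] [IsAlgClosed k] [CharZero k] [Group G] [Fintype G] :
    (DR.T k G).IsEquivalence ∧ (DR.fib k G).IsEquivalence ∧
    DR.IsPivotal (DR.zpiv (k := k) (G := G)) ∧ DR.IsPivotal (DR.bpiv (k := k) (G := G)) ∧
    ∃ m : (DR.T k G ⋙ DR.fib k G).Monoidal,
      DR.IsFiberwise k G m ∧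
      DR.PreservesPivotal (DR.T k G ⋙ DR.fib k G) DR.zpiv DR.bpiv :=
  ⟨DR.T_isEquivalence, DR.fib_isEquivalence, DR.isPivotal_zpiv, DR.isPivotal_bpiv,
    DR.tensorStructure, DR.isFiberwise_tensorStructure, DR.preservesPivotal_tensorStructure⟩
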